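/- Let $\mathbb K=\mathbb Q(q,t)$, $n=m+k>0$ with $m,k\ge 0$. The group $S_n$ acts on $(\mathbb Z_{\ge0})^n$ and, by permuting variables, on $\mathbb K[x_1,\dots,x_n]$; let $s_i=(i,i+1)$, let $\ell(w)$ be the length of $w$, and put $$T_i=ts_i+\frac{(t-1)x_{i+1}}{x_{i+1}-x_i}(1-s_i),\qquad T_w=T_{i_1}\cdots T_{i_l}\ \text{ for a reduced expression } w=s_{i_1}\cdots s_{i_l}.$$ Let $<$ be the Bruhat order on compositions of a fixed number of parts (weakly decreasing compositions being smallest in their orbits): the transitive relation generated, for $i<j$, by $\sigma_{ij}\nu<\nu$ if $\nu_i<\nu_j$, and $\sigma_{ij}\nu+e_i-e_j<\nu$ if $\nu_i-\nu_j>1$, where $\sigma_{ij}$ exchanges the $i$th and $j$th entries. For $\nu\in(\mathbb Z_{\ge0})^n$ let $E_\nu\in\mathbb K[x_1,\dots,x_n]$ be the nonsymmetric Macdonald polynomial, that is, the unique element of $x^\nu+\sum_{\kappa<\nu}\mathbb K x^\kappa$ with $$Y_iE_\nu=q^{-\nu_i}t^{a'_\nu(i)}E_\nu\quad(1\le i\le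 n),\qquad Y_i=(tT_{i-1}^{-1})\cdots(tT_1^{-1})\,\omega\, T_{n-1}\cdots T_i,$$ where $(\omega f)(x_1,\dots,x_n)=f(x_2,\dots,x_n,q^{-1}x_1)$ and $a'_\nu(i)=\#\{r<i:\nu_i<\nu_r\}+\#\{r>i:\nu_i\le\nu_r\}$. Let $S_{[1,m]}\subseteq S_n$ be the subgroup fixing $m+1,\dots,n$. For a weakly decreasing $\lambda\in(\mathbb Z_{\ge0})^m$ and any $\gamma\in(\mathbb Z_{\ge0})^k$, let $(\lambda\mid\gamma)$ be the concatenation and $$P_{(\lambda\mid\gamma)}=\frac1{W_\lambda(t)}\sum_{w\in S_{[1,m]}}T_wE_{(\lambda\mid\gamma)},\qquad W_\lambda(t)=\sum_{w\in S_{[1,m]},\,w\lambda=\lambda}t^{\ell(w)}.$$ The boxes of a composition $\nu$ are the pairs $\square=(i,j)$ with $1\le j\le\nu_i$; put $\ell_\nu(\square)=\nu_i-j$ and $a_\nu(\square)=\#\{r<i: j\le\nu_r\le\nu_i\}+\#\{r>i: j-1\le\nu_r<\nu_i\}$. Let $\lambda^-$ be the weakly increasing rearrangement of $\lambda$ and $S_{[1,m]}(\lambda)$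 the set of all rearrangements of $\lambda$. **Proposition.** $P_{(\lambda\mid\gamma)}$ has a unique expansion as a $\mathbb K$-linear combination of the polynomials $E_\nu$, $\nu\in(\mathbb Z_{\ge 0})^n$, and it has the form $$P_{(\lambda\mid\gamma)}=\sum_{\mu\in S_{[1,m]}(\lambda)}f_\mu\,E_{(\mu\mid\gamma)},\qquad f_\mu\in\mathbb K.$$ Its coefficients satisfy $f_{\lambda^-}=1$ and, whenever $\mu\in S_{[1,m]}(\lambda)$, $1\le i<m$ and $s_i\mu<\mu$, $$f_{s_i\mu}=f_\mu\cdot\frac{t-q^{\ell(u)+1}t^{a(u)}}{1-q^{\ell(u)+1}t^{a(u)}},\qquad u=(i,\mu_i+1),$$ with the leg $\ell(u)$ and the arm $a(u)$ taken in $(s_i\mu\mid\gamma)$. Moreover, for every $\mu\in S_{[1,m]}(\lambda)$ there is a unique element $w_m\in S_{[1,m]}$ of minimal length with $w_m(\lambda^-)=\mu$, and $$f_\mu=t^{\ell(w_m)}\cdot\frac{\prod_{\square\in(\lambda^-\mid\gamma)}\bigl(1-q^{\ell_{(\lambda^-\mid\gamma)}(\square)+1}t^{a_{(\lambda^-\mid\gamma)}(\square)}\bigr)}{\prod_{\square\in(\mu\mid\gamma)}\bigl(1-q^{\ell_{(\mu\mid\gamma)}(\square)+1}t^{a_{(\mu\mid\gamma)}(\square)}\bigr)}.$$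 -/

import Mathlib

open MvPolynomial

noncomputable section

namespace PSMac

/-- The base field `ℚ(q,t)` of rational functions in two independent variables. -/
abbrev K : Type := FractionRing (MvPolynomial (Fin 2) ℚ)

/-- The parameter `q`. -/
def q : K := algebraMap (MvPolynomial (Fin 2) ℚ) K (X 0)

/-- The parameter `t`. -/
def t : K := algebraMap (MvPolynomial (Fin 2) ℚ) K (X 1)

/-! ### The symmetric group and its simple reflections -/

/-- For `i : Fin (n - 1)`, the index `i` in `Fin n`. -/
def lo {n : ℕ} (i : Fin (n - 1)) : Fin n := ⟨i.val, by omega⟩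

/-- For `i : Fin (n - 1)`, the index `i + 1` in `Fin n`. -/
def hi {n : ℕ} (i : Fin (n - 1)) : Fin n := ⟨i.val + 1, by omega⟩

/-- The simple transposition `s_i = (i, i+1)`. -/
def simple {n : ℕ} (i : Fin (n - 1)) : Equiv.Perm (Fin n) := Equiv.swap (lo i) (hi i)

/-- The left action of `S_n` on compositions: `(w ν)_{w(i)} = ν_i`. -/
def act {n : ℕ} (w : Equiv.Perm (Fin n)) (ν : Fin n → ℕ) : Fin n → ℕ := fun i => ν (w.symm i)

/-- The product `s_{i₁} ⋯ s_{i_l}` of a word in the simple transpositions. -/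
def wordProd {n : ℕ} (l : List (Fin (n - 1))) : Equiv.Perm (Fin n) := (l.map simple).prod

/-- Every permutation is a product of simple transpositions. -/
theorem exists_word : ∀ {n : ℕ} (w : Equiv.Perm (Fin n)),
    ∃ l : List (Fin (n - 1)), wordProd l = w := by
  intro n w
  cases n with
  | zero => exact ⟨[], Subsingleton.elim _ _⟩
  | succ n =>
    have hw : w ∈ Submonoid.closure
        (Set.range fun i : Fin n => Equiv.swap i.castSucc i.succ) := by
      rw [Equiv.Perm.mclosure_swap_castSucc_succ]
      exact Submonoid.mem_top w
    induction hw using Submonoid.closure_induction with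
    | mem x hx =>
      obtain ⟨i, rfl⟩ := hx
      exact ⟨[i], by simp [wordProd]; rfl⟩
    | one => exact ⟨[], rfl⟩
    | mul x y _ _ hx hy =>
      obtain ⟨a, rfl⟩ := hx
      obtain ⟨b, rfl⟩ := hy
      exact ⟨a ++ b, by simp [wordProd]⟩

/-- The length `ℓ(w)`: the least length of a word in the simple transpositions with product `w`. -/
def length {n : ℕ} (w : Equiv.Perm (Fin n)) : ℕ :=
  sInf {N | ∃ l : List (Fin (n - 1)), wordProd l = w ∧ l.length = N}

theorem exists_reduced {n : ℕ} (w : Equiv.Perm (Fin n)) :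
    ∃ l : List (Fin (n - 1)), wordProd l = w ∧ l.length = length w := by
  obtain ⟨l, hl⟩ := exists_word w
  exact Nat.sInf_mem (s := {N | ∃ l : List (Fin (n - 1)), wordProd l = w ∧ l.length = N})
    ⟨l.length, l, hl, rfl⟩

/-- A reduced expression of `w`. -/
def reducedWord {n : ℕ} (w : Equiv.Perm (Fin n)) : List (Fin (n - 1)) :=
  (exists_reduced w).choose

/-! ### Demazure-Lusztig operators -/

/-- The action of `S_n` on polynomials by permutation of the variables, `w x_i = x_{w(i)}`. -/
def permPoly {n : ℕ} (w : Equiv.Perm (Fin n)) :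
    MvPolynomial (Fin n) K →ₐ[K] MvPolynomial (Fin n) K := rename w

theorem exists_divDiff {n : ℕ} (i : Fin (n - 1)) (f : MvPolynomial (Fin n) K) :
    ∃ g, f - permPoly (simple i) f = (X (hi i) - X (lo i)) * g := by
  set I : Ideal (MvPolynomial (Fin n) K) := Ideal.span {X (hi i) - X (lo i)} with hI
  have h0 : Ideal.Quotient.mkₐ K I (X (hi i)) = Ideal.Quotient.mkₐ K I (X (lo i)) := by
    simp only [Ideal.Quotient.mkₐ_eq_mk]
    rw [Ideal.Quotient.eq]
    exact Ideal.subset_span rfl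
  have h : Ideal.Quotient.mkₐ K I = (Ideal.Quotient.mkₐ K I).comp (permPoly (simple i)) := by
    apply MvPolynomial.algHom_ext
    intro j
    simp only [AlgHom.comp_apply, permPoly, rename_X, simple]
    by_cases h1 : j = lo i
    · subst h1; rw [Equiv.swap_apply_left]; exact h0.symm
    · by_cases h2 : j = hi i
      · subst h2; rw [Equiv.swap_apply_right]; exact h0
      · rw [Equiv.swap_apply_of_ne_of_ne h1 h2]
  have h3 := DFunLike.congr_fun h f
  rw [AlgHom.comp_apply, Ideal.Quotient.mkₐ_eq_mk, Ideal.Quotient.eq] at h3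
  exact Ideal.mem_span_singleton.mp h3

/-- The divided difference `(f - s_i f) / (x_{i+1} - x_i)`, a polynomial. -/
def divDiff {n : ℕ} (i : Fin (n - 1)) (f : MvPolynomial (Fin n) K) : MvPolynomial (Fin n) K :=
  (exists_divDiff i f).choose

theorem divDiff_spec {n : ℕ} (i : Fin (n - 1)) (f : MvPolynomial (Fin n) K) :
    f - permPoly (simple i) f = (X (hi i) - X (lo i)) * divDiff i f :=
  (exists_divDiff i f).choose_spec

theorem X_sub_X_ne_zero {n : ℕ} (i : Fin (n - 1)) :
    (X (hi i) - X (lo i) : MvPolynomial (Fin n) K) ≠ 0 := by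
  intro h
  have h1 := X_injective (R := K) (sub_eq_zero.mp h)
  simp [hi, lo] at h1

/-- The Demazure-Lusztig operator
`T_i = t s_i + ((t - 1) x_{i+1} / (x_{i+1} - x_i)) (1 - s_i)`. -/
def T {n : ℕ} (i : Fin (n - 1)) : Module.End K (MvPolynomial (Fin n) K) where
  toFun f := t • permPoly (simple i) f + (t - 1) • (X (hi i) * divDiff i f)
  map_add' f g := by
    have h : divDiff i (f + g) = divDiff i f + divDiff i g := by
      apply mul_left_cancel₀ (X_sub_X_ne_zero i)
      rw [mul_add, ← divDiff_spec, ← divDiff_spec, ← divDiff_spec, map_add]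
      ring
    rw [h, map_add, mul_add, smul_add, smul_add]
    abel
  map_smul' c f := by
    have h : divDiff i (c • f) = c • divDiff i f := by
      apply mul_left_cancel₀ (X_sub_X_ne_zero i)
      rw [mul_smul_comm, ← divDiff_spec, ← divDiff_spec, map_smul, smul_sub]
    rw [h, map_smul, mul_smul_comm, RingHom.id_apply, smul_add, smul_comm t c,
      smul_comm (t - 1) c]

/-- `T_w = T_{i₁} ⋯ T_{i_l}` for a reduced expression `w = s_{i₁} ⋯ s_{i_l}`. -/
def Tw {n : ℕ} (w : Equiv.Perm (Fin n)) : Module.End K (MvPolynomial (Fin n) K) :=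
  ((reducedWord w).map T).prod

/-! ### Nonsymmetric Macdonald polynomials -/

/-- One step down in the Bruhat order on compositions (weakly decreasing compositions are the
smallest of their orbit): for `i < j`,
`σ_{ij}(ν)` is below `ν` if `ν_i < ν_j`, and, if `ν_i - ν_j > 1`, the composition
`σ_{ij}(ν) + e_i - e_j` is below `ν`. -/
def BruhatStep {n : ℕ} (κ ν : Fin n → ℕ) : Prop :=
  ∃ i j : Fin n, i < j ∧
    ((ν i < ν j ∧ κ = act (Equiv.swap i j) ν) ∨
     (ν j + 1 < ν i ∧ κ = Function.update (Function.update ν i (ν j + 1)) j (ν i - 1)))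

/-- The strict Bruhat order on compositions. -/
def BruhatLT {n : ℕ} (κ ν : Fin n → ℕ) : Prop := Relation.TransGen BruhatStep κ ν

/-- The operator `(ω f)(x_1, …, x_n) = f(x_2, …, x_n, q⁻¹ x_1)`. -/
def omega {n : ℕ} : MvPolynomial (Fin n) K →ₐ[K] MvPolynomial (Fin n) K :=
  aeval fun i : Fin n =>
    if h : i.val + 1 < n then X ⟨i.val + 1, h⟩ else C q⁻¹ * X ⟨0, i.pos⟩

/-- `t T_i⁻¹`, which equals `T_i + 1 - t` by the relation `(T_i - t)(T_i + 1) = 0`. -/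
def Tbar {n : ℕ} (i : Fin (n - 1)) : Module.End K (MvPolynomial (Fin n) K) :=
  T i + (1 - t) • (1 : Module.End K (MvPolynomial (Fin n) K))

/-- The Cherednik operator
`Y_i = (t T_{i-1}⁻¹) ⋯ (t T_1⁻¹) ω T_{n-1} ⋯ T_{i+1} T_i` (with `i` counted from `1`). -/
def Y {n : ℕ} (i : Fin n) : Module.End K (MvPolynomial (Fin n) K) :=
  ((((List.finRange (n - 1)).filter fun j => decide (j.val < i.val)).reverse.map Tbar).prod *
    omega.toLinearMap) *
  (((List.finRange (n - 1)).filter fun j => decide (i.val ≤ j.val)).reverse.map T).prod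

/-- The coarm of column `i`: `#{r < i : ν_i < ν_r} + #{r > i : ν_i ≤ ν_r}`. -/
def coarm {n : ℕ} (ν : Fin n → ℕ) (i : Fin n) : ℕ :=
  (Finset.univ.filter fun r : Fin n => r < i ∧ ν i < ν r).card +
  (Finset.univ.filter fun r : Fin n => i < r ∧ ν i ≤ ν r).card

/-- `E` is the nonsymmetric Macdonald polynomial of index `ν`: it lies in
`x^ν + span {x^κ : κ < ν}` and `Y_i E = q^{-ν_i} t^{coarm_ν(i)} E` for all `i`. -/
structure IsNonsymMacdonald {n : ℕ} (ν : Fin n → ℕ) (E : MvPolynomial (Fin n) K) : Prop where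
  leading : coeff (Finsupp.equivFunOnFinite.symm ν) E = 1
  triangular : ∀ κ ∈ E.support, (κ : Fin n → ℕ) = ν ∨ BruhatLT (κ : Fin n → ℕ) ν
  eigen : ∀ i : Fin n, Y i E = ((q ^ ν i)⁻¹ * t ^ coarm ν i) • E

/-- The nonsymmetric Macdonald polynomial `E_ν(x; q, t)`. -/
def E {n : ℕ} (ν : Fin n → ℕ) : MvPolynomial (Fin n) K := Classical.epsilon (IsNonsymMacdonald ν)

/-! ### Partially symmetric Macdonald polynomials, with `n = m + k` -/

/-- The split composition `(lam | γ)`. -/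
abbrev split {m k : ℕ} (lam : Fin m → ℕ) (γ : Fin k → ℕ) : Fin (m + k) → ℕ := Fin.append lam γ

open Classical in
/-- The subgroup `S_{[1,m]}` of `S_{m+k}` fixing the last `k` indices (as a finite set). -/
def parabolic (m k : ℕ) : Finset (Equiv.Perm (Fin (m + k))) :=
  Finset.univ.filter fun w => ∀ j : Fin k, w (Fin.natAdd m j) = Fin.natAdd m j

/-- The partial Hecke symmetrizer `e⁺ = ∑_{w ∈ S_{[1,m]}} T_w`. -/
def symmetrizer (m k : ℕ) : Module.End K (MvPolynomial (Fin (m + k)) K) :=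
  ∑ w ∈ parabolic m k, Tw w

open Classical in
/-- `W_lam(t) = ∑ t^{ℓ(w)}` over the stabilizer of `lam` in `S_{[1,m]}`; a permutation in
`S_{[1,m]}` stabilizes `lam` if and only if it stabilizes `(lam | γ)`, here with `γ = 0`. -/
def poincare {m : ℕ} (k : ℕ) (lam : Fin m → ℕ) : K :=
  ∑ w ∈ (parabolic m k).filter
    (fun w => act w (split lam (0 : Fin k → ℕ)) = split lam (0 : Fin k → ℕ)), t ^ length w

/-- The partially symmetric Macdonald polynomial `P_{(lam | γ)}`. -/
def P {m k : ℕ} (lam : Fin m → ℕ) (γ : Fin k → ℕ) : MvPolynomial (Fin (m + k)) K :=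
  (poincare k lam)⁻¹ • symmetrizer m k (E (split lam γ))

/-- The orbit of `lam` under permutations of its entries. -/
def orbit {m : ℕ} (lam : Fin m → ℕ) : Finset (Fin m → ℕ) :=
  Finset.univ.image fun w : Equiv.Perm (Fin m) => act w lam

/-- The weakly increasing rearrangement of `lam`. -/
def increasing {m : ℕ} (lam : Fin m → ℕ) : Fin m → ℕ := lam ∘ Tuple.sort lam

/-! ### Diagrams -/

/-- The diagram of `ν`: the boxes `(i, j)` with `1 ≤ j ≤ ν_i`. -/
def dg {n : ℕ} (ν : Fin n → ℕ) : Finset (Σ _ : Fin n, ℕ) :=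
  Finset.univ.sigma fun i => Finset.Icc 1 (ν i)

/-- The leg of the box `(i, j)` of `ν`. -/
def leg {n : ℕ} (ν : Fin n → ℕ) (b : Σ _ : Fin n, ℕ) : ℕ := ν b.1 - b.2

/-- The arm of the box `(i, j)` of `ν`:
`#{r < i : j ≤ ν_r ≤ ν_i} + #{r > i : j - 1 ≤ ν_r < ν_i}`. -/
def arm {n : ℕ} (ν : Fin n → ℕ) (b : Σ _ : Fin n, ℕ) : ℕ :=
  (Finset.univ.filter fun r : Fin n => r < b.1 ∧ b.2 ≤ ν r ∧ ν r ≤ ν b.1).card +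
  (Finset.univ.filter fun r : Fin n => b.1 < r ∧ b.2 ≤ ν r + 1 ∧ ν r < ν b.1).card

/-- The monomial `q^{ℓ_ν(b) + 1} t^{a_ν(b)}`. -/
def boxWeight {n : ℕ} (ν : Fin n → ℕ) (b : Σ _ : Fin n, ℕ) : K :=
  q ^ (leg ν b + 1) * t ^ arm ν b

/-- The product of `1 - q^{ℓ_ν(b) + 1} t^{a_ν(b)}` over the boxes `b` of `ν`. -/
def boxProd {n : ℕ} (ν : Fin n → ℕ) : K := ∏ b ∈ dg ν, (1 - boxWeight ν b)

/-- `w` is an element of minimal length in `S_{[1,m]}` among those that send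
`lam` to `μ` (equivalently, `(lam | 0)` to `(μ | 0)`). -/
def IsMinimalTransport {m : ℕ} (k : ℕ) (lam μ : Fin m → ℕ) (w : Equiv.Perm (Fin (m + k))) : Prop :=
  (w ∈ parabolic m k ∧ act w (split lam (0 : Fin k → ℕ)) = split μ 0) ∧
  ∀ v ∈ parabolic m k, act v (split lam (0 : Fin k → ℕ)) = split μ 0 → length w ≤ length v

end PSMac

end

/-!
The operators `T_i` satisfy the Hecke relations, hence the Cherednik operators satisfy
`Y_{i+1} T_i = (t T_i⁻¹) Y_i`, `T_i Y_j = Y_j T_i` for `j ≠ i, i + 1` (`Y_hi_T`, `T_Y_comm`), and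
they are permuted cyclically, up to `q⁻¹`, by the raising operator `Φ = x_1 ω`
(`Y_zero_raise`, `Y_succ_raise`). So a suitable `T_i + c` exchanges two neighbouring eigenvalues,
and `Φ` shifts a joint spectrum. Both kinds of operators are triangular for the Bruhat order
(`T_mem_polysIn`, `raise_mem_polysIn`), and starting from the constant `1` they produce all `E_ν`;
this is the recursion of Knop and Sahi (`exists_isNonsymMacdonald`). By triangularity the `E_ν` form
a basis (`macBasis`), whence the uniqueness of expansions. The joint spectra for different `ν` are
different, so the `E_ν` are, up to scalars, the only joint eigenvectors, and `T_i` acts explicitly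
(`T_E_of_gt`, `T_E_of_lt`, `T_E_of_eq`): `T_i` preserves the span of `E_ν` and `E_{s_i ν}`.

By Matsumoto's theorem (`prod_map_eq_of_reduced`), `T_i T_w = T_{s_i w}` if the length increases.
In `(T_i - t) ∑ T_w` the terms of `w` and `s_i w` therefore cancel, so that `T_i P = t P` for `i < m`
(`T_symmetrizer`, `T_P`). Comparing the coefficients of `E_{s_i ν}` on the two sides gives the
one-step recursion (`coeE_of_T_eq`); its factor takes the form stated because the ratio of the
eigenvalues of `Y_i` and `Y_{i+1}` is the weight of a box, a difference of coarms being an arm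
(`arm_add_coarm`).

For the initial value, `T_v E_{(λ|γ)}` equals `t^e E_{(vλ|γ)}` plus a combination of `E_κ` with
`κ` below `(vλ|γ)`, where `e` counts the inversions of `v` between equal entries of `λ`
(`Tw_E_mem`). The increasing rearrangement is not below any other one (`not_increasing_lt`), so the
coefficient of `E_{(λ⁻|γ)}` in the symmetrization is the sum of `t^e` over the `v` with
`vλ = λ⁻`; this sum is the Poincaré polynomial of the stabilizer of `λ` (`sum_blockInv`).

Finally, an exchange `μ_i > μ_{i+1}` changes the weight of exactly one box, by a factor of `t`
(`boxWeight_simple`), so the product formula follows from the recursion by induction on the number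
of decreasing pairs of `μ` (`coeE_P_mul_boxProd`). This number is the length of the shortest
permutation from `λ⁻` to `μ`, which is unique, being the one that sorts `μ` stably
(`isMinimalTransport_iff`).
-/

open MvPolynomial

noncomputable section

namespace PSMac

variable {n : ℕ}

/-! ### The Demazure–Lusztig operators and their Hecke relations -/

theorem t_ne_zero : t ≠ 0 := by
  rw [t, Ne, FaithfulSMul.algebraMap_eq_zero_iff]
  exact X_ne_zero _

theorem q_ne_zero : q ≠ 0 := by
  rw [q, Ne, FaithfulSMul.algebraMap_eq_zero_iff]
  exact X_ne_zero _

@[simp] theorem simple_symm (i : Fin (n - 1)) : (simple i).symm = simple i := Equiv.symm_swap _ _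

theorem lo_lt_hi (i : Fin (n - 1)) : lo i < hi i := by simp [lo, hi, Fin.lt_def]

theorem lo_ne_hi (i : Fin (n - 1)) : lo i ≠ hi i := (lo_lt_hi i).ne

@[simp] theorem simple_lo (i : Fin (n - 1)) : simple i (lo i) = hi i := Equiv.swap_apply_left _ _

@[simp] theorem simple_hi (i : Fin (n - 1)) : simple i (hi i) = lo i := Equiv.swap_apply_right _ _

theorem simple_of_ne {i : Fin (n - 1)} {j : Fin n} (h1 : j ≠ lo i) (h2 : j ≠ hi i) :
    simple i j = j := Equiv.swap_apply_of_ne_of_ne h1 h2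

@[simp] theorem simple_simple (i : Fin (n - 1)) (j : Fin n) : simple i (simple i j) = j :=
  Equiv.swap_apply_self _ _ _

@[simp] theorem simple_mul_self (i : Fin (n - 1)) : simple i * simple i = 1 :=
  Equiv.swap_mul_self _ _

@[simp] theorem permPoly_X (w : Equiv.Perm (Fin n)) (j : Fin n) :
    permPoly w (X j) = X (w j) := rename_X _ _

@[simp] theorem permPoly_simple_permPoly (i : Fin (n - 1)) (f : MvPolynomial (Fin n) K) :
    permPoly (simple i) (permPoly (simple i) f) = f := by
  rw [permPoly, rename_rename]
  convert rename_id_apply f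
  ext j : 1
  simp

/-- The Demazure–Lusztig operator with its denominator cleared. -/
theorem T_spec (i : Fin (n - 1)) (f : MvPolynomial (Fin n) K) :
    (X (hi i) - X (lo i)) * T i f =
      (C t - 1) * X (hi i) * f + (X (hi i) - C t * X (lo i)) * permPoly (simple i) f := by
  have h := divDiff_spec i f
  simp only [T, LinearMap.coe_mk, AddHom.coe_mk, smul_eq_C_mul, map_sub, map_one]
  linear_combination -(C t - 1) * X (hi i) * h

theorem eq_T_of_mul {i : Fin (n - 1)} {f g : MvPolynomial (Fin n) K}
    (h : (X (hi i) - X (lo i)) * g =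
      (C t - 1) * X (hi i) * f + (X (hi i) - C t * X (lo i)) * permPoly (simple i) f) :
    g = T i f :=
  mul_left_cancel₀ (X_sub_X_ne_zero i) (h.trans (T_spec i f).symm)

theorem permPoly_T_spec (w : Equiv.Perm (Fin n)) (i : Fin (n - 1)) (f : MvPolynomial (Fin n) K) :
    (X (w (hi i)) - X (w (lo i))) * permPoly w (T i f) =
      (C t - 1) * X (w (hi i)) * permPoly w f +
        (X (w (hi i)) - C t * X (w (lo i))) * permPoly w (permPoly (simple i) f) := by
  have h := congrArg (permPoly w) (T_spec i f)
  have hC : permPoly w (C t) = C t := (permPoly w).commutes t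
  simpa [hC] using h

theorem Tbar_apply (i : Fin (n - 1)) (f : MvPolynomial (Fin n) K) :
    Tbar i f = T i f + (1 - t) • f := rfl

/-- The quadratic relation `(T_i - t) (T_i + 1) = 0`. -/
theorem T_T (i : Fin (n - 1)) (f : MvPolynomial (Fin n) K) :
    T i (T i f) = (t - 1) • T i f + t • f := by
  symm
  apply eq_T_of_mul
  have h1 := T_spec i f
  have h2 := permPoly_T_spec (simple i) i f
  simp only [simple_hi, simple_lo, permPoly_simple_permPoly] at h2
  simp only [smul_eq_C_mul, map_sub, map_one]
  apply mul_left_cancel₀ (X_sub_X_ne_zero i)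
  linear_combination (X (hi i) - C t * X (lo i)) * h2 - (C t - 1) * X (lo i) * h1

theorem T_mul_Tbar (i : Fin (n - 1)) : T i * Tbar i = t • 1 := by
  refine LinearMap.ext fun f => ?_
  rw [Module.End.mul_apply, Tbar_apply, map_add, map_smul, T_T]
  simp only [LinearMap.smul_apply, Module.End.one_apply, smul_eq_C_mul, map_sub, map_one]
  ring

theorem Tbar_mul_T (i : Fin (n - 1)) : Tbar i * T i = t • 1 := by
  refine LinearMap.ext fun f => ?_
  simp only [Module.End.mul_apply, Tbar_apply, T_T, LinearMap.smul_apply,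
    Module.End.one_apply, smul_eq_C_mul, map_sub, map_one]
  ring

theorem T_one (i : Fin (n - 1)) : T i 1 = t • 1 := by
  symm
  apply eq_T_of_mul
  simp only [smul_eq_C_mul, map_one]
  ring

theorem Tbar_one (i : Fin (n - 1)) : Tbar i 1 = 1 := by
  rw [Tbar_apply, T_one]
  simp only [smul_eq_C_mul, map_sub, map_one]
  ring

/-- `T_i x_i = x_{i+1} (t T_i⁻¹)`. -/
theorem T_X_lo (i : Fin (n - 1)) (f : MvPolynomial (Fin n) K) :
    T i (X (lo i) * f) = X (hi i) * Tbar i f := by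
  symm
  apply eq_T_of_mul
  have h1 := T_spec i f
  simp only [Tbar_apply, smul_eq_C_mul, map_sub, map_one, map_mul, permPoly_X, simple_lo]
  linear_combination X (hi i) * h1

/-- `t T_i⁻¹ x_{i+1} = x_i T_i`. -/
theorem Tbar_X_hi (i : Fin (n - 1)) (f : MvPolynomial (Fin n) K) :
    Tbar i (X (hi i) * f) = X (lo i) * T i f := by
  rw [Tbar_apply, ← eq_sub_iff_add_eq]
  symm
  apply eq_T_of_mul
  have h1 := T_spec i f
  simp only [smul_eq_C_mul, map_sub, map_one, map_mul, permPoly_X, simple_hi]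
  linear_combination X (lo i) * h1

theorem T_X_of_ne {i : Fin (n - 1)} {j : Fin n} (h1 : j ≠ lo i) (h2 : j ≠ hi i)
    (f : MvPolynomial (Fin n) K) : T i (X j * f) = X j * T i f := by
  symm
  apply eq_T_of_mul
  have h := T_spec i f
  simp only [map_mul, permPoly_X, simple_of_ne h1 h2]
  linear_combination X j * h

/-- An algebra endomorphism that carries `x_i, x_{i+1}` to the same multiple of `x_j, x_{j+1}` and
intertwines `s_i` with `s_j` intertwines `T_i` with `T_j`. -/
theorem algHom_T {i j : Fin (n - 1)} (θ : MvPolynomial (Fin n) K →ₐ[K] MvPolynomial (Fin n) K)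
    {c : K} (hc : c ≠ 0) (hlo : θ (X (lo i)) = C c * X (lo j)) (hhi : θ (X (hi i)) = C c * X (hi j))
    (hs : ∀ r, θ (X (simple i r)) = permPoly (simple j) (θ (X r)))
    (f : MvPolynomial (Fin n) K) : θ (T i f) = T j (θ f) := by
  have hs' : θ.comp (permPoly (simple i)) = (permPoly (simple j)).comp θ := by
    apply MvPolynomial.algHom_ext
    intro r
    simpa using hs r
  have hf : θ (permPoly (simple i) f) = permPoly (simple j) (θ f) := DFunLike.congr_fun hs' f
  apply eq_T_of_mul
  have h := congrArg θ (T_spec i f)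
  have hC : θ (C t) = C t := θ.commutes t
  simp only [map_mul, map_sub, map_add, map_one, hC, hlo, hhi, hf] at h
  have hc' : (C c : MvPolynomial (Fin n) K) ≠ 0 := by simpa using hc
  apply mul_left_cancel₀ hc'
  linear_combination h

theorem T_comm {i j : Fin (n - 1)} (h : i.val + 1 < j.val) : T i * T j = T j * T i := by
  have e1 : lo i ≠ lo j := by simp only [lo, ne_eq, Fin.ext_iff]; omega
  have e2 : lo i ≠ hi j := by simp only [lo, hi, ne_eq, Fin.ext_iff]; omega
  have e3 : hi i ≠ lo j := by simp only [lo, hi, ne_eq, Fin.ext_iff]; omega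
  have e4 : hi i ≠ hi j := by simp only [hi, ne_eq, Fin.ext_iff]; omega
  refine LinearMap.ext fun f => ?_
  simp only [Module.End.mul_apply]
  apply mul_left_cancel₀ (X_sub_X_ne_zero i)
  apply mul_left_cancel₀ (X_sub_X_ne_zero j)
  have a1 := T_spec i (T j f)
  have a2 := T_spec j f
  have a3 := permPoly_T_spec (simple i) j f
  have b1 := T_spec j (T i f)
  have b2 := T_spec i f
  have b3 := permPoly_T_spec (simple j) i f
  rw [simple_of_ne e1.symm e3.symm, simple_of_ne e2.symm e4.symm] at a3
  rw [simple_of_ne e1 e2, simple_of_ne e3 e4] at b3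
  have hs : permPoly (simple i) (permPoly (simple j) f) =
      permPoly (simple j) (permPoly (simple i) f) := by
    simp only [permPoly, rename_rename]
    congr 1
    congr 1
    have : simple i * simple j = simple j * simple i :=
      (Equiv.Perm.disjoint_swap_swap (by simp [e1, e2, e3, e4, lo_ne_hi])).commute
    exact congrArg (fun w : Equiv.Perm (Fin n) => (w : Fin n → Fin n)) this
  linear_combination (X (hi j) - X (lo j)) * a1 - (X (hi i) - X (lo i)) * b1
    + ((C t - 1) * X (hi i)) * a2 + (X (hi i) - C t * X (lo i)) * a3
    - ((C t - 1) * X (hi j)) * b2 - (X (hi j) - C t * X (lo j)) * b3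
    + (X (hi i) - C t * X (lo i)) * (X (hi j) - C t * X (lo j)) * hs

theorem simple_braid {i j : Fin (n - 1)} (h : i.val + 1 = j.val) :
    simple i * simple j * simple i = simple j * simple i * simple j := by
  have e : hi i = lo j := by simp only [lo, hi, Fin.ext_iff]; omega
  have e2 : lo i ≠ hi j := by simp only [lo, hi, ne_eq, Fin.ext_iff]; omega
  have e3 : lo i ≠ lo j := by simp only [lo, ne_eq, Fin.ext_iff]; omega
  simp only [simple, e]
  rw [Equiv.swap_mul_swap_mul_swap e3 e2, Equiv.swap_comm (lo i) (lo j),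
    Equiv.swap_comm (lo j) (hi j), Equiv.swap_mul_swap_mul_swap (lo_ne_hi j).symm e2.symm,
    Equiv.swap_comm]

/-- The rational-function identity behind the braid relation: `p` and `r` are the values of
`T_i T_j T_i` and `T_j T_i T_j` at `f`, computed from the six images of `f` under the permutations
of `a = x_i`, `b = x_{i+1}`, `c = x_{i+2}` by clearing one denominator per hypothesis. -/
theorem braid_identity {L : Type*} [Field L] {a b c τ f f1 f2 f12 f21 f121 : L}
    {g g1 g2 g12 h h1 p u u1 u2 u21 v v2 r : L}
    (hab : b - a ≠ 0) (hbc : c - b ≠ 0) (hac : c - a ≠ 0)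
    (hg : (b - a) * g = (τ - 1) * b * f + (b - τ * a) * f1)
    (hg1 : (a - b) * g1 = (τ - 1) * a * f1 + (a - τ * b) * f)
    (hg2 : (c - a) * g2 = (τ - 1) * c * f2 + (c - τ * a) * f21)
    (hg12 : (c - b) * g12 = (τ - 1) * c * f12 + (c - τ * b) * f121)
    (hh : (c - b) * h = (τ - 1) * c * g + (c - τ * b) * g2)
    (hh1 : (c - a) * h1 = (τ - 1) * c * g1 + (c - τ * a) * g12)
    (hp : (b - a) * p = (τ - 1) * b * h + (b - τ * a) * h1)
    (hu : (c - b) * u = (τ - 1) * c * f + (c - τ * b) * f2)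
    (hu2 : (b - c) * u2 = (τ - 1) * b * f2 + (b - τ * c) * f)
    (hu1 : (c - a) * u1 = (τ - 1) * c * f1 + (c - τ * a) * f12)
    (hu21 : (b - a) * u21 = (τ - 1) * b * f21 + (b - τ * a) * f121)
    (hv : (b - a) * v = (τ - 1) * b * u + (b - τ * a) * u1)
    (hv2 : (c - a) * v2 = (τ - 1) * c * u2 + (c - τ * a) * u21)
    (hr : (c - b) * r = (τ - 1) * c * v + (c - τ * b) * v2) : p = r := by
  have hba : a - b ≠ 0 := by rw [← neg_sub]; exact neg_ne_zero.mpr hab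
  have hcb : b - c ≠ 0 := by rw [← neg_sub]; exact neg_ne_zero.mpr hbc
  rw [mul_comm, ← eq_div_iff (by assumption)] at hg hg1 hg2 hg12 hh hh1 hp hu hu2 hu1 hu21 hv hv2 hr
  subst hg hg1 hg2 hg12 hu hu2 hu1 hu21
  subst hh hh1 hv hv2
  subst hp hr
  rw [← neg_sub b a, ← neg_sub c b]
  field_simp
  ring

theorem T_braid {i j : Fin (n - 1)} (h : i.val + 1 = j.val) :
    T i * T j * T i = T j * T i * T j := by
  have e : lo j = hi i := by simp only [lo, hi, Fin.ext_iff]; omega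
  have e2 : lo i ≠ hi j := by simp only [lo, hi, ne_eq, Fin.ext_iff]; omega
  have e4 : hi i ≠ hi j := by simp only [hi, ne_eq, Fin.ext_iff]; omega
  have h1c : simple i (hi j) = hi j := simple_of_ne e2.symm e4.symm
  have h2a : simple j (lo i) = lo i := simple_of_ne (e ▸ lo_ne_hi i) e2
  have h2b : simple j (hi i) = hi j := by rw [← e, simple_lo]
  have h2c : simple j (hi j) = hi i := by rw [simple_hi, e]
  refine LinearMap.ext fun f => ?_
  simp only [Module.End.mul_apply]
  have hs : permPoly (simple i) (permPoly (simple j) (permPoly (simple i) f)) =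
      permPoly (simple j) (permPoly (simple i) (permPoly (simple j) f)) := by
    simp only [permPoly, rename_rename]
    congr 1
    congr 1
    exact congrArg (fun w : Equiv.Perm (Fin n) => (w : Fin n → Fin n)) (simple_braid h)
  -- compare both sides, and all their images under permutations, in the field of fractions
  let L := FractionRing (MvPolynomial (Fin n) K)
  let φ : MvPolynomial (Fin n) K →+* L := algebraMap _ L
  have hφ : Function.Injective φ := IsFractionRing.injective _ _
  have key : ∀ w : Equiv.Perm (Fin n), ∀ (r : Fin (n - 1)) (x y : Fin n)
      (g : MvPolynomial (Fin n) K), w (lo r) = x → w (hi r) = y →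
      (φ (X y) - φ (X x)) * φ (permPoly w (T r g)) =
        (φ (C t) - 1) * φ (X y) * φ (permPoly w g) +
          (φ (X y) - φ (C t) * φ (X x)) * φ (permPoly w (permPoly (simple r) g)) := by
    rintro w r x y g rfl rfl
    simpa using congrArg φ (permPoly_T_spec w r g)
  have hne : ∀ x y : Fin n, x ≠ y → φ (X y) - φ (X x) ≠ 0 := by
    intro x y hxy h0
    exact hxy (X_injective (hφ (sub_eq_zero.mp h0))).symm
  apply hφ
  have p1 : ∀ g : MvPolynomial (Fin n) K, permPoly 1 g = g := fun g => rename_id_apply g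
  have key1 := key 1
  simp only [p1] at key1
  have p2 : ∀ (w : Equiv.Perm (Fin n)) (x : Fin (n - 1)) (g : MvPolynomial (Fin n) K),
      permPoly w (permPoly (simple x) g) = permPoly (w * simple x) g := by
    intro w x g; simp only [permPoly, rename_rename]; rfl
  refine braid_identity
    (f121 := φ (permPoly (simple i) (permPoly (simple j) (permPoly (simple i) f))))
    (hne _ _ (lo_ne_hi i)) (hne _ _ e4) (hne _ _ e2)
    (key1 i _ _ f rfl rfl) ?_ (key (simple j) i _ _ f h2a h2b) ?_
    (key1 j _ _ (T i f) e rfl) (key (simple i) j _ _ (T i f) (by rw [e, simple_hi]) h1c)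
    (key1 i _ _ _ rfl rfl)
    (key1 j _ _ f e rfl) ?_ (key (simple i) j _ _ f (by rw [e, simple_hi]) h1c) ?_
    (key1 i _ _ (T j f) rfl rfl) (key (simple j) i _ _ (T j f) h2a h2b)
    (key1 j _ _ _ e rfl)
  · have := key (simple i) i _ _ f (simple_lo i) (simple_hi i)
    rwa [permPoly_simple_permPoly] at this
  · have := key (simple i * simple j) i (hi i) (hi j) f (by simp [h2a]) (by simp [h2b, h1c])
    simpa only [← p2] using this
  · have := key (simple j) j (hi j) (hi i) f (by rw [simple_lo]) h2c
    rwa [permPoly_simple_permPoly] at this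
  · have := key (simple j * simple i) j (lo i) (hi i) f (by simp [e, h2a]) (by simp [h2c, h1c])
    simp only [← p2] at this
    rw [hs]
    exact this

/-! ### The Cherednik operators as descending products -/

/-- The descending product `F_{b-1} ⋯ F_{a+1} F_a`. -/
def descProd {M : Type*} [Monoid M] {N : ℕ} (F : Fin N → M) (a b : ℕ) : M :=
  (((List.finRange N).filter fun j => decide (a ≤ j.val ∧ j.val < b)).reverse.map F).prod

section descProd

variable {M : Type*} [Monoid M] {N : ℕ} (F : Fin N → M)

theorem descProd_of_le {a b : ℕ} (h : b ≤ a) : descProd F a b = 1 := by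
  have : (List.finRange N).filter (fun j => decide (a ≤ j.val ∧ j.val < b)) = [] := by
    rw [List.filter_eq_nil_iff]
    intro j _
    simp only [decide_eq_true_eq]
    omega
  rw [descProd, this]
  rfl

theorem sortedLT_filter_finRange (p : Fin N → Bool) :
    ((List.finRange N).filter p).SortedLT :=
  ((List.sortedLT_finRange N).pairwise.filter p).sortedLT

theorem descProd_succ {a : ℕ} (i : Fin N) (h : a ≤ i.val) :
    descProd F a (i.val + 1) = F i * descProd F a i.val := by
  have : (List.finRange N).filter (fun j => decide (a ≤ j.val ∧ j.val < i.val + 1)) =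
      (List.finRange N).filter (fun j => decide (a ≤ j.val ∧ j.val < i.val)) ++ [i] := by
    refine (sortedLT_filter_finRange _).eq_of_mem_iff ?_ ?_
    · rw [List.sortedLT_iff_pairwise, List.pairwise_append]
      refine ⟨(sortedLT_filter_finRange _).pairwise, List.pairwise_singleton _ _, ?_⟩
      intro x hx y hy
      simp only [List.mem_filter, decide_eq_true_eq, List.mem_singleton] at hx hy
      subst hy
      exact hx.2.2
    · intro x
      simp only [List.mem_filter, List.mem_finRange, decide_eq_true_eq, List.mem_append,
        List.mem_singleton, true_and, Fin.ext_iff]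
      omega
  rw [descProd, this, List.reverse_append, List.map_append, List.prod_append]
  simp only [List.reverse_singleton, List.map_singleton, List.prod_singleton]
  rfl

theorem descProd_eq_mul {b : ℕ} (i : Fin N) (h : i.val < b) :
    descProd F i.val b = descProd F (i.val + 1) b * F i := by
  have : (List.finRange N).filter (fun j => decide (i.val ≤ j.val ∧ j.val < b)) =
      i :: (List.finRange N).filter (fun j => decide (i.val + 1 ≤ j.val ∧ j.val < b)) := by
    refine (sortedLT_filter_finRange _).eq_of_mem_iff ?_ ?_
    · rw [List.sortedLT_iff_pairwise, List.pairwise_cons]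
      refine ⟨?_, (sortedLT_filter_finRange _).pairwise⟩
      intro x hx
      simp only [List.mem_filter, decide_eq_true_eq] at hx
      exact hx.2.1
    · intro x
      simp only [List.mem_filter, List.mem_finRange, decide_eq_true_eq, List.mem_cons,
        true_and, Fin.ext_iff]
      omega
  rw [descProd, this, List.reverse_cons, List.map_append, List.prod_append]
  simp only [List.map_singleton, List.prod_singleton]
  rfl

end descProd

theorem Y_eq (i : Fin n) :
    Y i = descProd Tbar 0 i.val * omega.toLinearMap * descProd T i.val (n - 1) := by
  have h1 : (List.finRange (n - 1)).filter (fun j => decide (j.val < i.val)) =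
      (List.finRange (n - 1)).filter (fun j => decide (0 ≤ j.val ∧ j.val < i.val)) := by
    apply List.filter_congr; intro x _; simp
  have h2 : (List.finRange (n - 1)).filter (fun j => decide (i.val ≤ j.val)) =
      (List.finRange (n - 1)).filter (fun j => decide (i.val ≤ j.val ∧ j.val < n - 1)) := by
    apply List.filter_congr; intro x _; simp
  rw [Y, h1, h2]
  rfl

theorem Y_hi_mul_T (i : Fin (n - 1)) : Y (hi i) * T i = Tbar i * Y (lo i) := by
  rw [Y_eq, Y_eq]
  change descProd Tbar 0 (i.val + 1) * _ * descProd T (i.val + 1) (n - 1) * _ =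
    _ * (descProd Tbar 0 i.val * _ * descProd T i.val (n - 1))
  rw [descProd_succ Tbar i (Nat.zero_le _), descProd_eq_mul T i i.isLt]
  simp only [mul_assoc]

theorem T_Tbar (i : Fin (n - 1)) (f : MvPolynomial (Fin n) K) : T i (Tbar i f) = t • f :=
  DFunLike.congr_fun (T_mul_Tbar i) f

theorem Tbar_T (i : Fin (n - 1)) (f : MvPolynomial (Fin n) K) : Tbar i (T i f) = t • f :=
  DFunLike.congr_fun (Tbar_mul_T i) f

theorem smul_t_injective : Function.Injective fun f : MvPolynomial (Fin n) K => t • f :=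
  smul_right_injective _ t_ne_zero

/-- `Y_{i+1} T_i = (t T_i⁻¹) Y_i`. -/
theorem Y_hi_T (i : Fin (n - 1)) (f : MvPolynomial (Fin n) K) :
    Y (hi i) (T i f) = Tbar i (Y (lo i) f) :=
  DFunLike.congr_fun (Y_hi_mul_T i) f

/-- `Y_i (t T_i⁻¹) = T_i Y_{i+1}`. -/
theorem Y_lo_Tbar (i : Fin (n - 1)) (f : MvPolynomial (Fin n) K) :
    Y (lo i) (Tbar i f) = T i (Y (hi i) f) := by
  apply smul_t_injective
  simp only
  rw [← T_Tbar i, ← Y_hi_T, T_Tbar, map_smul, map_smul]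

/-- `t Y_{i+1} = (t T_i⁻¹) Y_i (t T_i⁻¹)`, which reduces statements on the `Y_j` to `Y_1`. -/
theorem smul_Y_hi (i : Fin (n - 1)) (f : MvPolynomial (Fin n) K) :
    t • Y (hi i) f = Tbar i (Y (lo i) (Tbar i f)) := by
  rw [Y_lo_Tbar, Tbar_T]

theorem omega_X_of_lt (r : Fin n) (h : r.val + 1 < n) :
    omega (X r) = X ⟨r.val + 1, h⟩ := by
  rw [omega, aeval_X, dif_pos h]

theorem omega_X_of_eq (r : Fin n) (h : r.val + 1 = n) :
    omega (X r) = C q⁻¹ * X ⟨0, r.pos⟩ := by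
  rw [omega, aeval_X, dif_neg h.not_lt]

theorem omega_C (c : K) : omega (C c : MvPolynomial (Fin n) K) = C c := omega.commutes c

/-- `ω T_i = T_{i+1} ω`. -/
theorem omega_T {i j : Fin (n - 1)} (h : j.val = i.val + 1) (f : MvPolynomial (Fin n) K) :
    omega (T i f) = T j (omega f) := by
  have hlo : omega (X (lo i)) = X (lo j) := by
    rw [omega_X_of_lt _ (by simp only [lo]; omega)]
    congr 1
    simp only [lo, Fin.ext_iff]; omega
  have hhi : omega (X (hi i)) = X (hi j) := by
    rw [omega_X_of_lt _ (by simp only [hi]; omega)]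
    congr 1
    simp only [hi, Fin.ext_iff]; omega
  refine algHom_T omega one_ne_zero (by simpa using hlo) (by simpa using hhi) ?_ f
  intro r
  by_cases h1 : r = lo i
  · subst h1; simp [hlo, hhi]
  by_cases h2 : r = hi i
  · subst h2; simp [hlo, hhi]
  rw [simple_of_ne h1 h2]
  simp only [lo, hi, Fin.ext_iff] at h1 h2
  by_cases hr : r.val + 1 < n
  · rw [omega_X_of_lt r hr, permPoly_X, simple_of_ne]
    · simp only [lo, ne_eq, Fin.ext_iff]; omega
    · simp only [hi, ne_eq, Fin.ext_iff]; omega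
  · rw [omega_X_of_eq r (by omega), map_mul, permPoly_X, simple_of_ne]
    · congr 1
      exact ((permPoly (simple j)).commutes _).symm
    · simp only [lo, ne_eq, Fin.ext_iff]; omega
    · simp only [hi, ne_eq, Fin.ext_iff]; omega

/-- `ω² T_{n-1} = T_1 ω²`. -/
theorem omega_omega_T {i j : Fin (n - 1)} (hj : j.val = 0) (hi' : i.val + 2 = n)
    (f : MvPolynomial (Fin n) K) : omega (omega (T i f)) = T j (omega (omega f)) := by
  have hlo : omega (omega (X (lo i))) = C q⁻¹ * X (lo j) := by
    rw [omega_X_of_lt _ (by simp only [lo]; omega), omega_X_of_eq _ (by simp only [lo]; omega)]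
    congr 2
    simp only [lo, Fin.ext_iff]; omega
  have hhi : omega (omega (X (hi i))) = C q⁻¹ * X (hi j) := by
    rw [omega_X_of_eq _ (by simp only [hi]; omega), map_mul, omega_C,
      omega_X_of_lt _ (by simp only; omega)]
    congr 2
    simp only [hi, Fin.ext_iff]; omega
  have hC : ∀ c, permPoly (simple j) (C c) = C c := (permPoly (simple j)).commutes
  refine algHom_T (omega.comp omega) (inv_ne_zero q_ne_zero) hlo hhi ?_ f
  intro r
  simp only [AlgHom.comp_apply]
  by_cases h1 : r = lo i
  · subst h1; simp [hlo, hhi, hC]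
  by_cases h2 : r = hi i
  · subst h2; simp [hlo, hhi, hC]
  rw [simple_of_ne h1 h2]
  simp only [lo, hi, Fin.ext_iff] at h1 h2
  rw [omega_X_of_lt r (by omega), omega_X_of_lt _ (by simp only; omega), permPoly_X, simple_of_ne]
  · simp only [lo, ne_eq, Fin.ext_iff]; omega
  · simp only [hi, ne_eq, Fin.ext_iff]; omega

/-! ### Commutation of `T_i` with `Y_j` -/

theorem T_T_comm {i j : Fin (n - 1)} (h : i.val + 1 < j.val ∨ j.val + 1 < i.val)
    (f : MvPolynomial (Fin n) K) : T i (T j f) = T j (T i f) := by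
  rcases h with h | h
  · exact DFunLike.congr_fun (T_comm h) f
  · exact (DFunLike.congr_fun (T_comm h) f).symm

theorem T_Tbar_comm {i j : Fin (n - 1)} (h : i.val + 1 < j.val ∨ j.val + 1 < i.val)
    (f : MvPolynomial (Fin n) K) : T i (Tbar j f) = Tbar j (T i f) := by
  rw [Tbar_apply, Tbar_apply, map_add, map_smul, T_T_comm h]

theorem T_T_T_braid {i j : Fin (n - 1)} (h : i.val + 1 = j.val) (f : MvPolynomial (Fin n) K) :
    T i (T j (T i f)) = T j (T i (T j f)) :=
  DFunLike.congr_fun (T_braid h) f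

/-- The product `T_{b-1} ⋯ T_0` shifts the indices of the `T_i` with `0 < i < b` by one. -/
theorem T_descProd {i i' : Fin (n - 1)} (h : i.val = i'.val + 1) {b : ℕ} (hb : i.val + 1 ≤ b)
    (hbn : b ≤ n - 1) (f : MvPolynomial (Fin n) K) :
    T i' (descProd T 0 b f) = descProd T 0 b (T i f) := by
  induction b, hb using Nat.le_induction with
  | base =>
    have hc : ∀ b ≤ i'.val, ∀ f, T i (descProd T 0 b f) = descProd T 0 b (T i f) := by
      intro b
      induction b with
      | zero => intro _ f; rw [descProd_of_le T le_rfl]; rfl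
      | succ b ih =>
        intro hb f
        rw [descProd_succ T ⟨b, by omega⟩ (Nat.zero_le _), Module.End.mul_apply,
          Module.End.mul_apply, T_T_comm (by simp only; omega), ih (by omega)]
    rw [descProd_succ T i (Nat.zero_le _), h, descProd_succ T i' (Nat.zero_le _)]
    simp only [Module.End.mul_apply]
    rw [T_T_T_braid h.symm, hc _ le_rfl]
  | succ b hb ih =>
    rw [descProd_succ T ⟨b, by omega⟩ (Nat.zero_le _), Module.End.mul_apply,
      Module.End.mul_apply, T_T_comm (by simp only; omega), ih (by omega)]

/-- `T_i` commutes with `Y_1 = ω T_{n-1} ⋯ T_1` for `i > 1`: passing through `T_{n-1} ⋯ T_1`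
lowers the index by one, and passing through `ω` raises it again. -/
theorem T_Y_zero {i : Fin (n - 1)} {j : Fin n} (hj : j.val = 0) (h : 0 < i.val)
    (f : MvPolynomial (Fin n) K) : T i (Y j f) = Y j (T i f) := by
  have hY : ∀ f, Y j f = omega (descProd T 0 (n - 1) f) := by
    intro f
    rw [Y_eq, hj, descProd_of_le Tbar le_rfl, one_mul]
    rfl
  rw [hY, hY, ← omega_T (i := ⟨i.val - 1, by omega⟩) (by simp only; omega),
    T_descProd (i := i) (by simp only; omega) (by omega) le_rfl]

theorem T_Y_hi {i j : Fin (n - 1)} (h1 : i.val + 1 < j.val ∨ j.val + 1 < i.val)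
    (h2 : ∀ f, T i (Y (lo j) f) = Y (lo j) (T i f)) (f : MvPolynomial (Fin n) K) :
    T i (Y (hi j) f) = Y (hi j) (T i f) := by
  apply smul_t_injective
  simp only
  rw [← map_smul, smul_Y_hi, smul_Y_hi, T_Tbar_comm h1, h2, T_Tbar_comm h1]

theorem T_Y_of_lt {i : Fin (n - 1)} (j : ℕ) (hj : j < i.val) (f : MvPolynomial (Fin n) K) :
    T i (Y ⟨j, by omega⟩ f) = Y ⟨j, by omega⟩ (T i f) := by
  induction j generalizing f with
  | zero => exact T_Y_zero rfl hj f
  | succ j ih =>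
    exact T_Y_hi (j := ⟨j, by omega⟩) (by simp only; omega) (fun f => ih (by omega) f) f

theorem T_Tbar_Tbar {i j : Fin (n - 1)} (h : i.val + 1 = j.val ∨ j.val + 1 = i.val)
    (f : MvPolynomial (Fin n) K) : T i (Tbar j (Tbar i f)) = Tbar j (Tbar i (T j f)) := by
  have hb : T i (T j (T i f)) = T j (T i (T j f)) := by
    rcases h with h | h
    · exact T_T_T_braid h f
    · exact (T_T_T_braid h f).symm
  simp only [Tbar_apply, map_add, map_smul, hb, T_T]
  simp only [smul_eq_C_mul, map_sub, map_one]
  ring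

/-- `T_i` commutes with `Y_j` for `j ≠ i, i + 1`. -/
theorem T_Y_comm {i : Fin (n - 1)} {j : Fin n} (h1 : j ≠ lo i) (h2 : j ≠ hi i)
    (f : MvPolynomial (Fin n) K) : T i (Y j f) = Y j (T i f) := by
  simp only [lo, hi, ne_eq, Fin.ext_iff] at h1 h2
  by_cases hj : j.val < i.val
  · exact T_Y_of_lt j.val hj f
  suffices H : ∀ j (h : i.val + 2 ≤ j) (hn : j < n) (f : MvPolynomial (Fin n) K),
      T i (Y ⟨j, hn⟩ f) = Y ⟨j, hn⟩ (T i f) from H j.val (by omega) j.isLt f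
  intro j h
  induction j, h using Nat.le_induction with
  | base =>
    intro hn f
    -- moving `T_i` past either product of `t T_i⁻¹` and `t T_{i+1}⁻¹` in this formula exchanges it
    -- with `T_{i+1}`, which commutes with `Y_i`
    have hY : ∀ f, t • t • Y ⟨i.val + 2, hn⟩ f =
        Tbar ⟨i.val + 1, by omega⟩ (Tbar i (Y (lo i)
          (Tbar i (Tbar ⟨i.val + 1, by omega⟩ f)))) := by
      intro f
      have e := smul_Y_hi (n := n) ⟨i.val + 1, by omega⟩ f
      have e' := smul_Y_hi i (Tbar ⟨i.val + 1, by omega⟩ f)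
      change t • Y ⟨i.val + 2, hn⟩ f = Tbar _ (Y (hi i) _) at e
      rw [e, ← map_smul, e']
    apply smul_t_injective
    apply smul_t_injective
    simp only
    rw [← map_smul, ← map_smul, hY, hY, T_Tbar_Tbar (Or.inl rfl)]
    have e0 := T_Y_of_lt (n := n) (i := ⟨i.val + 1, by omega⟩) i.val (Nat.lt_succ_self _)
    change ∀ f, T _ (Y (lo i) f) = Y (lo i) (T _ f) at e0
    rw [e0, T_Tbar_Tbar (Or.inr rfl)]
  | succ j h ih =>
    intro hn f
    exact T_Y_hi (j := ⟨j, by omega⟩) (by simp only; omega) (fun f => ih (by omega) f) f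

/-! ### The raising operator -/

/-- The raising operator `Φ = x_1 ω`. -/
def raise (h : 0 < n) : Module.End K (MvPolynomial (Fin n) K) :=
  LinearMap.mulLeft K (X ⟨0, h⟩) * omega.toLinearMap

theorem raise_apply (h : 0 < n) (f : MvPolynomial (Fin n) K) :
    raise h f = X ⟨0, h⟩ * omega f := rfl

theorem T_raise (h : 0 < n) {i j : Fin (n - 1)} (hij : j.val = i.val + 1)
    (f : MvPolynomial (Fin n) K) : T j (raise h f) = raise h (T i f) := by
  rw [raise_apply, raise_apply, T_X_of_ne, omega_T hij]
  · simp only [lo, ne_eq, Fin.ext_iff]; omega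
  · simp only [hi, ne_eq, Fin.ext_iff]; omega

theorem Tbar_raise (h : 0 < n) {i j : Fin (n - 1)} (hij : j.val = i.val + 1)
    (f : MvPolynomial (Fin n) K) : Tbar j (raise h f) = raise h (Tbar i f) := by
  rw [Tbar_apply, Tbar_apply, T_raise h hij, map_add, map_smul]

/-- `Y_1 Φ = q⁻¹ Φ Y_n`. -/
theorem Y_zero_raise (h : 0 < n) (f : MvPolynomial (Fin n) K) :
    Y ⟨0, h⟩ (raise h f) = q⁻¹ • raise h (Y ⟨n - 1, by omega⟩ f) := by
  have key : ∀ b, (hb : b ≤ n - 1) → ∀ g, descProd T 0 b (X ⟨0, h⟩ * g) =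
      X ⟨b, by omega⟩ * descProd Tbar 0 b g := by
    intro b
    induction b with
    | zero => intro _ g; rw [descProd_of_le T le_rfl, descProd_of_le Tbar le_rfl]; rfl
    | succ b ih =>
      intro hb g
      rw [descProd_succ T ⟨b, by omega⟩ (Nat.zero_le _),
        descProd_succ Tbar ⟨b, by omega⟩ (Nat.zero_le _), Module.End.mul_apply,
        Module.End.mul_apply, ih (by omega)]
      exact T_X_lo ⟨b, by omega⟩ _
  rw [Y_eq, Y_eq, descProd_of_le Tbar le_rfl, descProd_of_le T le_rfl]
  simp only [one_mul, mul_one, Module.End.mul_apply, raise_apply, AlgHom.toLinearMap_apply]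
  rw [key _ le_rfl, map_mul, omega_X_of_eq _ (by simp only; omega), smul_eq_C_mul, mul_assoc]

/-- `Y_2 Φ = Φ Y_1`. -/
theorem Y_one_raise (h : 1 < n) (f : MvPolynomial (Fin n) K) :
    Y ⟨1, h⟩ (raise (by omega) f) = raise (by omega) (Y ⟨0, by omega⟩ f) := by
  let i0 : Fin (n - 1) := ⟨0, by omega⟩
  have h0 : 0 < n := by omega
  have hD : ∀ b, b + 1 ≤ n - 1 → ∀ g : MvPolynomial (Fin n) K,
      descProd T 1 (b + 1) (omega g) = omega (descProd T 0 b g) := by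
    intro b
    induction b with
    | zero => intro _ g; rw [descProd_of_le T le_rfl, descProd_of_le T le_rfl]; rfl
    | succ b ih =>
      intro hb g
      rw [descProd_succ T ⟨b + 1, by omega⟩ (by simp only; omega),
        descProd_succ T ⟨b, by omega⟩ (Nat.zero_le _), Module.End.mul_apply,
        Module.End.mul_apply, ih (by omega)]
      exact (omega_T rfl _).symm
  have hX : ∀ b, 1 ≤ b → b ≤ n - 1 → ∀ g : MvPolynomial (Fin n) K,
      descProd T 1 b (X ⟨0, h0⟩ * g) = X ⟨0, h0⟩ * descProd T 1 b g := by
    intro b hb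
    induction b, hb using Nat.le_induction with
    | base => intro _ g; rw [descProd_of_le T le_rfl]; rfl
    | succ b hb ih =>
      intro hbn g
      rw [descProd_succ T ⟨b, by omega⟩ hb, Module.End.mul_apply, Module.End.mul_apply,
        ih (by omega), T_X_of_ne]
      · simp only [lo, ne_eq, Fin.ext_iff]; omega
      · simp only [hi, ne_eq, Fin.ext_iff]; omega
  have e4 : ∀ a, descProd (T (n := n)) a (n - 1) = descProd T a (n - 2 + 1) := fun a =>
    congrArg (descProd T a) (by omega)
  rw [Y_eq, Y_eq]
  simp only
  rw [descProd_succ Tbar i0 (Nat.zero_le _), descProd_of_le Tbar le_rfl]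
  simp only [one_mul, mul_one, Module.End.mul_apply, raise_apply, AlgHom.toLinearMap_apply]
  rw [hX _ (by omega) le_rfl]
  have e2 : descProd T 0 (n - 1) f = T ⟨n - 2, by omega⟩ (descProd T 0 (n - 2) f) := by
    rw [e4, descProd_succ T ⟨n - 2, by omega⟩ (Nat.zero_le _)]
    rfl
  have e3 : descProd T 1 (n - 1) (omega f) = omega (descProd T 0 (n - 2) f) := by
    rw [e4]
    exact hD (n - 2) (by omega) f
  rw [e2, e3, omega_omega_T (j := i0) rfl (by simp only; omega), map_mul,
    omega_X_of_lt _ (by simp only; omega)]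
  exact Tbar_X_hi i0 _

/-- `Y_{j+1} Φ = Φ Y_j`. -/
theorem Y_succ_raise (h0 : 0 < n) (j : ℕ) (h : j + 1 < n) (f : MvPolynomial (Fin n) K) :
    Y ⟨j + 1, h⟩ (raise h0 f) = raise h0 (Y ⟨j, by omega⟩ f) := by
  induction j generalizing f with
  | zero => exact Y_one_raise h f
  | succ j ih =>
    have e1 := smul_Y_hi (n := n) ⟨j + 1, by omega⟩ (raise h0 f)
    have e2 := smul_Y_hi (n := n) ⟨j, by omega⟩ f
    have e3 : Y (lo ⟨j + 1, by omega⟩) (raise h0 (Tbar ⟨j, by omega⟩ f)) =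
        raise h0 (Y (lo ⟨j, by omega⟩) (Tbar ⟨j, by omega⟩ f)) := ih (by omega) _
    rw [Tbar_raise h0 (i := ⟨j, by omega⟩) rfl, e3, Tbar_raise h0 (i := ⟨j, by omega⟩) rfl,
      ← e2, map_smul] at e1
    exact smul_t_injective e1

/-! ### The Bruhat order on compositions -/

@[simp] theorem act_simple_apply (i : Fin (n - 1)) (ν : Fin n → ℕ) (r : Fin n) :
    act (simple i) ν r = ν (simple i r) := by
  simp [act]

@[simp] theorem act_simple_act_simple (i : Fin (n - 1)) (ν : Fin n → ℕ) :
    act (simple i) (act (simple i) ν) = ν := by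
  ext r; simp

theorem simple_val (i : Fin (n - 1)) (r : Fin n) : (simple i r).val =
    if r.val = i.val then i.val + 1 else if r.val = i.val + 1 then i.val else r.val := by
  by_cases h1 : r = lo i
  · subst h1; rw [simple_lo]; simp [lo, hi]
  by_cases h2 : r = hi i
  · subst h2; rw [simple_hi]; simp [lo, hi]
  rw [simple_of_ne h1 h2]
  simp only [lo, hi, Fin.ext_iff] at h1 h2
  rw [if_neg h1, if_neg h2]

theorem simple_lt_simple_iff {i : Fin (n - 1)} {a b : Fin n} (h1 : ¬ (a = lo i ∧ b = hi i))
    (h2 : ¬ (a = hi i ∧ b = lo i)) : simple i a < simple i b ↔ a < b := by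
  simp only [lo, hi, Fin.ext_iff] at h1 h2
  rw [Fin.lt_def, Fin.lt_def, simple_val, simple_val]
  split_ifs <;> omega

/-- A step of the Bruhat order, in terms of the entries of the two compositions. -/
theorem bruhatStep_iff {κ ν : Fin n → ℕ} :
    BruhatStep κ ν ↔ ∃ i j : Fin n, i < j ∧ (∀ r, r ≠ i → r ≠ j → κ r = ν r) ∧
      ((ν i < ν j ∧ κ i = ν j ∧ κ j = ν i) ∨
        (ν j + 1 < ν i ∧ κ i = ν j + 1 ∧ κ j = ν i - 1)) := by
  constructor
  · rintro ⟨i, j, hij, h | h⟩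
    · refine ⟨i, j, hij, ?_, Or.inl ⟨h.1, ?_, ?_⟩⟩
      · intro r h1 h2
        rw [h.2, act, Equiv.symm_swap, Equiv.swap_apply_of_ne_of_ne h1 h2]
      · rw [h.2, act, Equiv.symm_swap, Equiv.swap_apply_left]
      · rw [h.2, act, Equiv.symm_swap, Equiv.swap_apply_right]
    · refine ⟨i, j, hij, ?_, Or.inr ⟨h.1, ?_, ?_⟩⟩
      · intro r h1 h2
        rw [h.2, Function.update_of_ne h2, Function.update_of_ne h1]
      · rw [h.2, Function.update_of_ne hij.ne, Function.update_self]
      · rw [h.2, Function.update_self]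
  · rintro ⟨i, j, hij, hr, h | h⟩
    · refine ⟨i, j, hij, Or.inl ⟨h.1, ?_⟩⟩
      ext r
      rw [act, Equiv.symm_swap]
      by_cases h1 : r = i
      · subst h1; rw [Equiv.swap_apply_left, h.2.1]
      by_cases h2 : r = j
      · subst h2; rw [Equiv.swap_apply_right, h.2.2]
      rw [Equiv.swap_apply_of_ne_of_ne h1 h2, hr r h1 h2]
    · refine ⟨i, j, hij, Or.inr ⟨h.1, ?_⟩⟩
      ext r
      by_cases h2 : r = j
      · subst h2; rw [Function.update_self, h.2.2]
      rw [Function.update_of_ne h2]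
      by_cases h1 : r = i
      · subst h1; rw [Function.update_self, h.2.1]
      rw [Function.update_of_ne h1, hr r h1 h2]

/-- A rank function for the Bruhat order: `(∑ ν_r², ∑ r ν_r)`, ordered lexicographically. -/
def rank (ν : Fin n → ℕ) : ℕ ×ₗ ℕ := toLex (∑ r, ν r ^ 2, ∑ r, r.val * ν r)

theorem sum_eq_pair {i j : Fin n} (hij : i ≠ j) (F : Fin n → ℕ) :
    ∑ r, F r = F i + F j + ∑ r ∈ (Finset.univ.erase i).erase j, F r := by
  rw [← Finset.add_sum_erase _ F (Finset.mem_univ i),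
    ← Finset.add_sum_erase _ F (Finset.mem_erase.mpr ⟨hij.symm, Finset.mem_univ j⟩), add_assoc]

theorem sum_erase_pair_congr {i j : Fin n} {F G : Fin n → ℕ}
    (h : ∀ r, r ≠ i → r ≠ j → F r = G r) :
    ∑ r ∈ (Finset.univ.erase i).erase j, F r = ∑ r ∈ (Finset.univ.erase i).erase j, G r := by
  refine Finset.sum_congr rfl fun r hr => h r ?_ ?_
  · exact Finset.ne_of_mem_erase (Finset.mem_of_mem_erase hr)
  · exact Finset.ne_of_mem_erase hr

theorem rank_lt_of_step {κ ν : Fin n → ℕ} (h : BruhatStep κ ν) : rank κ < rank ν := by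
  obtain ⟨i, j, hij, hr, h⟩ := bruhatStep_iff.mp h
  have e1 := sum_erase_pair_congr (i := i) (j := j) (F := fun r => κ r ^ 2) (G := fun r => ν r ^ 2)
    (fun r h1 h2 => by simp only [hr r h1 h2])
  have e2 := sum_erase_pair_congr (i := i) (j := j) (F := fun r => r.val * κ r)
    (G := fun r => r.val * ν r) (fun r h1 h2 => by simp only [hr r h1 h2])
  rw [rank, rank, Prod.Lex.toLex_lt_toLex]
  simp only
  rw [sum_eq_pair hij.ne (fun r => κ r ^ 2), sum_eq_pair hij.ne (fun r => ν r ^ 2),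
    sum_eq_pair hij.ne (fun r => r.val * κ r), sum_eq_pair hij.ne (fun r => r.val * ν r), e1, e2]
  rw [Fin.lt_def] at hij
  rcases h with ⟨h, hi, hj⟩ | ⟨h, hi, hj⟩
  · right
    rw [hi, hj]
    refine ⟨by ring, ?_⟩
    obtain ⟨a, ha⟩ := Nat.exists_eq_add_of_lt hij
    obtain ⟨b, hb⟩ := Nat.exists_eq_add_of_lt h
    rw [ha, hb]
    nlinarith
  · left
    rw [hi, hj]
    obtain ⟨b, hb⟩ := Nat.exists_eq_add_of_lt h
    have : ν i - 1 = ν j + 1 + b := by omega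
    rw [this, hb]
    nlinarith

theorem rank_lt {κ ν : Fin n → ℕ} (h : BruhatLT κ ν) : rank κ < rank ν := by
  induction h with
  | single h => exact rank_lt_of_step h
  | tail _ h ih => exact ih.trans (rank_lt_of_step h)

theorem bruhatLT_irrefl (ν : Fin n → ℕ) : ¬ BruhatLT ν ν := fun h => lt_irrefl _ (rank_lt h)

/-- The Bruhat order, as a reflexive relation. -/
def BruhatLE (κ ν : Fin n → ℕ) : Prop := κ = ν ∨ BruhatLT κ ν

theorem BruhatLE.refl (ν : Fin n → ℕ) : BruhatLE ν ν := Or.inl rfl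

theorem BruhatLT.le {κ ν : Fin n → ℕ} (h : BruhatLT κ ν) : BruhatLE κ ν := Or.inr h

theorem BruhatStep.lt {κ ν : Fin n → ℕ} (h : BruhatStep κ ν) : BruhatLT κ ν := .single h

theorem BruhatLT.trans {κ ν μ : Fin n → ℕ} (h : BruhatLT κ ν) (h' : BruhatLT ν μ) :
    BruhatLT κ μ := Relation.TransGen.trans h h'

theorem BruhatLE.trans_lt {κ ν μ : Fin n → ℕ} (h : BruhatLE κ ν) (h' : BruhatLT ν μ) :
    BruhatLT κ μ := by
  rcases h with rfl | h
  · exact h'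
  · exact h.trans h'

theorem BruhatLE.trans {κ ν μ : Fin n → ℕ} (h : BruhatLE κ ν) (h' : BruhatLE ν μ) :
    BruhatLE κ μ := by
  rcases h' with rfl | h'
  · exact h
  · exact (h.trans_lt h').le

theorem BruhatLE.antisymm {κ ν : Fin n → ℕ} (h : BruhatLE κ ν) (h' : BruhatLE ν κ) : κ = ν := by
  rcases h' with rfl | h'
  · rfl
  · exact (bruhatLT_irrefl _ (h.trans_lt h')).elim

/-- `s_i ν < ν` if `ν_i < ν_{i+1}`. -/
theorem act_simple_lt {i : Fin (n - 1)} {ν : Fin n → ℕ} (h : ν (lo i) < ν (hi i)) :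
    BruhatLT (act (simple i) ν) ν :=
  BruhatStep.lt ⟨lo i, hi i, lo_lt_hi i, Or.inl ⟨h, rfl⟩⟩

theorem lt_act_simple {i : Fin (n - 1)} {ν : Fin n → ℕ} (h : ν (hi i) < ν (lo i)) :
    BruhatLT ν (act (simple i) ν) := by
  have := act_simple_lt (i := i) (ν := act (simple i) ν) (by simpa using h)
  simpa using this

theorem act_simple_eq {i : Fin (n - 1)} {ν : Fin n → ℕ} (h : ν (lo i) = ν (hi i)) :
    act (simple i) ν = ν := by
  ext r
  rw [act_simple_apply]
  by_cases h1 : r = lo i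
  · subst h1; simp [h]
  by_cases h2 : r = hi i
  · subst h2; simp [h]
  rw [simple_of_ne h1 h2]

theorem act_simple_lt_iff {i : Fin (n - 1)} {ν : Fin n → ℕ} :
    BruhatLT (act (simple i) ν) ν ↔ ν (lo i) < ν (hi i) := by
  refine ⟨fun h => ?_, act_simple_lt⟩
  by_contra! h'
  rcases h'.lt_or_eq with h' | h'
  · exact bruhatLT_irrefl _ (h.trans (lt_act_simple h'))
  · rw [act_simple_eq h'.symm] at h
    exact bruhatLT_irrefl _ h

/-- The larger of `ν` and `s_i ν`. -/
def top (i : Fin (n - 1)) (ν : Fin n → ℕ) : Fin n → ℕ :=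
  if ν (lo i) ≤ ν (hi i) then ν else act (simple i) ν

theorem top_of_le {i : Fin (n - 1)} {ν : Fin n → ℕ} (h : ν (lo i) ≤ ν (hi i)) : top i ν = ν :=
  if_pos h

theorem top_of_ge {i : Fin (n - 1)} {ν : Fin n → ℕ} (h : ν (hi i) ≤ ν (lo i)) :
    top i ν = act (simple i) ν := by
  rcases h.lt_or_eq with h | h
  · exact if_neg h.not_ge
  · rw [top_of_le h.ge, act_simple_eq h.symm]

theorem le_top (i : Fin (n - 1)) (ν : Fin n → ℕ) : BruhatLE ν (top i ν) := by
  rcases le_or_gt (ν (lo i)) (ν (hi i)) with h | h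
  · rw [top_of_le h]; exact .refl _
  · rw [top_of_ge h.le]; exact (lt_act_simple h).le

theorem act_simple_le_top (i : Fin (n - 1)) (ν : Fin n → ℕ) :
    BruhatLE (act (simple i) ν) (top i ν) := by
  rcases lt_or_ge (ν (lo i)) (ν (hi i)) with h | h
  · rw [top_of_le h.le]; exact (act_simple_lt h).le
  · rw [top_of_ge h]; exact .refl _

/-- `κ'` arises from `κ` by moving the entries `i` and `i + 1` towards each other or exchanging
them: these are the exponents that occur in `T_i x^κ`. -/
structure Within (i : Fin (n - 1)) (κ' κ : Fin n → ℕ) : Prop where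
  off : ∀ r, r ≠ lo i → r ≠ hi i → κ' r = κ r
  sum : κ' (lo i) + κ' (hi i) = κ (lo i) + κ (hi i)
  min_lo : min (κ (lo i)) (κ (hi i)) ≤ κ' (lo i)
  min_hi : min (κ (lo i)) (κ (hi i)) ≤ κ' (hi i)

theorem ext_pair {i : Fin (n - 1)} {κ ν : Fin n → ℕ} (h : ∀ r, r ≠ lo i → r ≠ hi i → κ r = ν r)
    (h1 : κ (lo i) = ν (lo i)) (h2 : κ (hi i) = ν (hi i)) : κ = ν := by
  ext r
  by_cases e1 : r = lo i
  · rw [e1, h1]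
  by_cases e2 : r = hi i
  · rw [e2, h2]
  exact h r e1 e2

/-- The exponents within a pair of entries `ν_i ≤ ν_{i+1}` lie below `ν`. -/
theorem Within.le {i : Fin (n - 1)} {κ ν : Fin n → ℕ} (h : Within i κ ν)
    (hν : ν (lo i) ≤ ν (hi i)) : BruhatLE κ ν := by
  induction hd : ν (hi i) using Nat.strong_induction_on generalizing ν with
  | _ d ih =>
  obtain ⟨h1, h2, h3, h4⟩ := h
  rw [min_eq_left hν] at h3 h4
  by_cases e1 : κ (lo i) = ν (lo i)
  · exact Or.inl (ext_pair h1 e1 (by omega))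
  have hlt : ν (lo i) < ν (hi i) := by omega
  by_cases e2 : κ (hi i) = ν (lo i)
  · have : κ = act (simple i) ν := by
      refine ext_pair (i := i) (fun r a b => ?_) ?_ ?_
      · rw [act_simple_apply, simple_of_ne a b, h1 r a b]
      · rw [act_simple_apply, simple_lo]; omega
      · rw [act_simple_apply, simple_hi]; omega
    rw [this]
    exact (act_simple_lt hlt).le
  -- the step from `s_i ν` moves its two entries towards each other by one
  set ν' : Fin n → ℕ :=
    Function.update (Function.update ν (lo i) (ν (lo i) + 1)) (hi i) (ν (hi i) - 1) with hν'
  have a1 : ν' (lo i) = ν (lo i) + 1 := by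
    rw [hν', Function.update_of_ne (lo_ne_hi i), Function.update_self]
  have a2 : ν' (hi i) = ν (hi i) - 1 := by rw [hν', Function.update_self]
  have a3 : ∀ r, r ≠ lo i → r ≠ hi i → ν' r = ν r := by
    intro r b1 b2
    rw [hν', Function.update_of_ne b2, Function.update_of_ne b1]
  have hle : BruhatLT ν' ν := by
    refine BruhatLT.trans (BruhatStep.lt ?_) (act_simple_lt hlt)
    rw [bruhatStep_iff]
    refine ⟨lo i, hi i, lo_lt_hi i, fun r b1 b2 => ?_, Or.inr ?_⟩
    · rw [a3 r b1 b2, act_simple_apply, simple_of_ne b1 b2]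
    · rw [act_simple_apply, act_simple_apply, simple_lo, simple_hi, a1, a2]
      omega
  refine (ih (ν (hi i) - 1) (by omega) ⟨fun r b1 b2 => ?_, ?_, ?_, ?_⟩ ?_ a2).trans hle.le
  · rw [h1 r b1 b2, a3 r b1 b2]
  all_goals rw [a1, a2]; omega

theorem Within.le_top {i : Fin (n - 1)} {κ ν : Fin n → ℕ} (h : Within i κ ν) :
    BruhatLE κ (top i ν) := by
  rcases le_total (ν (lo i)) (ν (hi i)) with h' | h'
  · rw [top_of_le h']; exact h.le h'
  · rw [top_of_ge h']
    refine Within.le (i := i) ⟨fun r a b => ?_, ?_, ?_, ?_⟩ ?_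
    · rw [h.off r a b, act_simple_apply, simple_of_ne a b]
    all_goals simp only [act_simple_apply, simple_lo, simple_hi]
    · rw [h.sum, add_comm]
    · rw [min_comm]; exact h.min_lo
    · rw [min_comm]; exact h.min_hi
    · exact h'

theorem BruhatStep.top_le {i : Fin (n - 1)} {κ ν : Fin n → ℕ} (h : BruhatStep κ ν) :
    BruhatLE (top i κ) (top i ν) := by
  obtain ⟨a, b, hab, hr, h'⟩ := bruhatStep_iff.mp h
  by_cases hs : a = lo i ∧ b = hi i
  · obtain ⟨rfl, rfl⟩ := hs
    have hw : Within i κ ν := ⟨hr, by omega, by omega, by omega⟩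
    rcases le_total (κ (lo i)) (κ (hi i)) with hk | hk
    · rw [top_of_le hk]; exact hw.le_top
    · rw [top_of_ge hk]
      refine Within.le_top ⟨fun r a b => ?_, ?_, ?_, ?_⟩
      · rw [act_simple_apply, simple_of_ne a b, hr r a b]
      all_goals simp only [act_simple_apply, simple_lo, simple_hi]
      · rw [add_comm, hw.sum]
      · exact hw.min_hi
      · exact hw.min_lo
  -- otherwise `s_i` preserves the order of `a` and `b`, and carries the step to a step
  · have hlt : simple i a < simple i b := by
      refine (simple_lt_simple_iff hs ?_).mpr hab
      rintro ⟨rfl, rfl⟩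
      exact hab.not_gt (lo_lt_hi i)
    have hstep : BruhatStep (act (simple i) κ) (act (simple i) ν) := by
      rw [bruhatStep_iff]
      refine ⟨simple i a, simple i b, hlt, fun r h1 h2 => ?_, ?_⟩
      · rw [act_simple_apply, act_simple_apply]
        apply hr
        · rintro rfl; simp at h1
        · rintro rfl; simp at h2
      · simpa using h'
    rcases le_total (κ (lo i)) (κ (hi i)) with hk | hk
    · rw [top_of_le hk]; exact h.lt.le.trans (PSMac.le_top i ν)
    · rw [top_of_ge hk]; exact hstep.lt.le.trans (act_simple_le_top i ν)

/-- The lifting property of the Bruhat order. -/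
theorem BruhatLE.top_le {i : Fin (n - 1)} {κ ν : Fin n → ℕ} (h : BruhatLE κ ν) :
    BruhatLE (top i κ) (top i ν) := by
  rcases h with rfl | h
  · exact .refl _
  · induction h with
    | single h => exact h.top_le
    | tail _ h ih => exact ih.trans h.top_le

/-- The exponent of `Φ x^ν`: the last entry, increased by one, followed by the others. -/
def shift {N : ℕ} (ν : Fin (N + 1) → ℕ) : Fin (N + 1) → ℕ :=
  Fin.cons (ν (Fin.last N) + 1) fun r : Fin N => ν r.castSucc

@[simp] theorem shift_zero {N : ℕ} (ν : Fin (N + 1) → ℕ) : shift ν 0 = ν (Fin.last N) + 1 := rfl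

@[simp] theorem shift_succ {N : ℕ} (ν : Fin (N + 1) → ℕ) (r : Fin N) :
    shift ν r.succ = ν r.castSucc := rfl

theorem BruhatStep.shift {N : ℕ} {κ ν : Fin (N + 1) → ℕ} (h : BruhatStep κ ν) :
    BruhatStep (shift κ) (shift ν) := by
  obtain ⟨i, j, hij, hr, h⟩ := bruhatStep_iff.mp h
  rw [bruhatStep_iff]
  obtain ⟨i, rfl⟩ : ∃ i' : Fin N, i = i'.castSucc :=
    ⟨i.castPred (Fin.ne_last_of_lt hij), by simp⟩
  induction j using Fin.lastCases with
  | cast j =>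
    refine ⟨i.succ, j.succ, by simpa using hij, fun r => ?_, ?_⟩
    · cases r using Fin.cases with
      | zero =>
        intro _ _
        simp only [shift_zero]
        rw [hr _ (Fin.castSucc_lt_last _).ne' (Fin.castSucc_lt_last _).ne']
      | succ r =>
        intro h1 h2
        simp only [shift_succ]
        exact hr _ (by simpa using h1) (by simpa using h2)
    · simpa using h
  | last =>
    refine ⟨0, i.succ, Fin.succ_pos i, fun r => ?_, ?_⟩
    · cases r using Fin.cases with
      | zero => intro h1; exact absurd rfl h1
      | succ r =>
        intro _ h2
        simp only [shift_succ]
        exact hr _ (by simpa using h2) (Fin.castSucc_lt_last _).ne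
    · simp only [shift_zero, shift_succ]
      omega

theorem BruhatLT.shift {N : ℕ} {κ ν : Fin (N + 1) → ℕ} (h : BruhatLT κ ν) :
    BruhatLT (shift κ) (shift ν) :=
  Relation.TransGen.lift PSMac.shift (fun _ _ => BruhatStep.shift) _ _ h

/-! ### Triangularity of the operators on monomials -/

/-- The monomial `x^ν` of a composition `ν`. -/
def mon (ν : Fin n → ℕ) : MvPolynomial (Fin n) K := ∏ r, X r ^ ν r

/-- The coefficient of `x^ν`, as a linear form. -/
def coe (ν : Fin n → ℕ) : MvPolynomial (Fin n) K →ₗ[K] K :=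
  lcoeff K (Finsupp.equivFunOnFinite.symm ν)

theorem coe_apply (ν : Fin n → ℕ) (f : MvPolynomial (Fin n) K) :
    coe ν f = coeff (Finsupp.equivFunOnFinite.symm ν) f := rfl

theorem mon_eq (ν : Fin n → ℕ) : mon ν = monomial (Finsupp.equivFunOnFinite.symm ν) 1 := by
  rw [mon, monomial_eq, C_1, one_mul, Finsupp.prod_fintype _ _ (fun _ => pow_zero _)]
  rfl

theorem coe_mon (κ ν : Fin n → ℕ) : coe κ (mon ν) = if ν = κ then 1 else 0 := by
  rw [coe_apply, mon_eq, coeff_monomial]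
  simp only [EmbeddingLike.apply_eq_iff_eq]

theorem mon_zero : mon (0 : Fin n → ℕ) = 1 := by simp [mon]

/-- The polynomials all of whose exponents lie in `S`. -/
def polysIn (S : Set (Fin n → ℕ)) : Submodule K (MvPolynomial (Fin n) K) where
  carrier := {f | ∀ κ, κ ∉ S → coe κ f = 0}
  add_mem' hf hg κ hκ := by rw [map_add, hf κ hκ, hg κ hκ, add_zero]
  zero_mem' _ _ := map_zero _
  smul_mem' c f hf κ hκ := by rw [map_smul, hf κ hκ, smul_zero]

theorem mon_mem {S : Set (Fin n → ℕ)} {κ : Fin n → ℕ} (h : κ ∈ S) : mon κ ∈ polysIn S := by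
  intro μ hμ
  rw [coe_mon, if_neg]
  rintro rfl
  exact hμ h

theorem polysIn_mono {S S' : Set (Fin n → ℕ)} (h : S ⊆ S') : polysIn S ≤ polysIn S' :=
  fun _ hf κ hκ => hf κ fun h' => hκ (h h')

/-- A polynomial as the combination of its monomials. -/
theorem sum_coe_mon (f : MvPolynomial (Fin n) K) :
    f = ∑ κ ∈ f.support, coe (κ : Fin n → ℕ) f • mon (κ : Fin n → ℕ) := by
  conv_lhs => rw [← support_sum_monomial_coeff f]
  refine Finset.sum_congr rfl fun κ _ => ?_
  have : Finsupp.equivFunOnFinite.symm (κ : Fin n → ℕ) = κ := Finsupp.equivFunOnFinite_symm_coe κ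
  rw [coe_apply, mon_eq, this, smul_monomial, smul_eq_mul, mul_one]

theorem mem_of_mem_support {S : Set (Fin n → ℕ)} {f : MvPolynomial (Fin n) K} (hf : f ∈ polysIn S)
    {κ : Fin n →₀ ℕ} (hκ : κ ∈ f.support) : (κ : Fin n → ℕ) ∈ S := by
  by_contra h
  have := hf _ h
  rw [coe_apply, Finsupp.equivFunOnFinite_symm_coe] at this
  exact mem_support_iff.mp hκ this

/-- A linear map carries `polysIn S` into a subspace if it does so for the monomials in `S`. -/
theorem polysIn_le_comap {S : Set (Fin n → ℕ)} (A : Module.End K (MvPolynomial (Fin n) K))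
    {V : Submodule K (MvPolynomial (Fin n) K)} (h : ∀ κ ∈ S, A (mon κ) ∈ V)
    {f : MvPolynomial (Fin n) K} (hf : f ∈ polysIn S) : A f ∈ V := by
  rw [sum_coe_mon f, map_sum]
  refine Submodule.sum_mem _ fun κ hκ => ?_
  rw [map_smul]
  exact Submodule.smul_mem _ _ (h _ (mem_of_mem_support hf hκ))

theorem polysIn_induction {S : Set (Fin n → ℕ)} {V : Submodule K (MvPolynomial (Fin n) K)}
    (h : ∀ κ ∈ S, mon κ ∈ V) {f : MvPolynomial (Fin n) K} (hf : f ∈ polysIn S) : f ∈ V :=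
  polysIn_le_comap 1 h hf

theorem T_mul_of_symm {i : Fin (n - 1)} {p : MvPolynomial (Fin n) K}
    (hp : permPoly (simple i) p = p) (f : MvPolynomial (Fin n) K) : T i (p * f) = p * T i f := by
  symm
  apply eq_T_of_mul
  have h := T_spec i f
  rw [map_mul, hp]
  linear_combination p * h

theorem T_X_hi (i : Fin (n - 1)) (f : MvPolynomial (Fin n) K) :
    T i (X (hi i) * f) = X (lo i) * T i f + C (t - 1) * (X (hi i) * f) := by
  rw [← Tbar_X_hi, Tbar_apply, smul_eq_C_mul, map_sub, map_sub]
  ring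

theorem T_X_lo_pow (i : Fin (n - 1)) (d : ℕ) :
    T i (X (lo i) ^ (d + 1)) = ∑ c ∈ Finset.range (d + 1),
      C (if c = 0 then 1 else 1 - t) * (X (lo i) ^ c * X (hi i) ^ (d + 1 - c)) := by
  induction d with
  | zero =>
    have h := T_X_lo i 1
    rw [mul_one, Tbar_one, mul_one] at h
    simp [h]
  | succ d ih =>
    rw [pow_succ', T_X_lo, Tbar_apply, ih, Finset.sum_range_succ _ (d + 1),
      if_neg (Nat.succ_ne_zero d), mul_add, Finset.mul_sum, smul_eq_C_mul]
    congr 1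
    · refine Finset.sum_congr rfl fun c hc => ?_
      rw [Finset.mem_range] at hc
      rw [show d + 1 + 1 - c = (d + 1 - c) + 1 by omega, pow_succ]
      ring
    · rw [show d + 1 + 1 - (d + 1) = 1 by omega]
      ring

theorem T_X_hi_pow (i : Fin (n - 1)) (d : ℕ) :
    ∃ a : ℕ → K, T i (X (hi i) ^ d) = ∑ c ∈ Finset.range (d + 1),
      C (a c) * (X (lo i) ^ c * X (hi i) ^ (d - c)) := by
  induction d with
  | zero => exact ⟨fun _ => t, by simp [T_one, smul_eq_C_mul]⟩
  | succ d ih =>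
    obtain ⟨a, ha⟩ := ih
    refine ⟨fun c => if c = 0 then t - 1 else a (c - 1), ?_⟩
    rw [pow_succ', T_X_hi, ha, Finset.sum_range_succ' _ (d + 1), Finset.mul_sum]
    simp only [if_true]
    congr 1
    · refine Finset.sum_congr rfl fun c hc => ?_
      rw [if_neg (Nat.succ_ne_zero c), show c + 1 - 1 = c by omega,
        show d + 1 - (c + 1) = d - c by omega, pow_succ]
      ring
    · rw [pow_zero, Nat.sub_zero, pow_succ]
      ring

theorem mon_mul (κ ν : Fin n → ℕ) : mon (κ + ν) = mon κ * mon ν := by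
  simp [mon, pow_add, Finset.prod_mul_distrib]

theorem mon_single (r : Fin n) (c : ℕ) : mon (Pi.single r c) = X r ^ c := by
  rw [mon, Finset.prod_eq_single r]
  · rw [Pi.single_eq_same]
  · intro b _ hb; rw [Pi.single_eq_of_ne hb, pow_zero]
  · simp

theorem permPoly_mon (i : Fin (n - 1)) (ν : Fin n → ℕ) :
    permPoly (simple i) (mon ν) = mon (act (simple i) ν) := by
  rw [mon, mon, map_prod]
  rw [← Equiv.prod_comp (simple i) (fun r => X r ^ act (simple i) ν r)]
  refine Finset.prod_congr rfl fun r _ => ?_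
  simp

theorem single_pair_lo {i : Fin (n - 1)} (b c : ℕ) :
    (Pi.single (lo i) b + Pi.single (hi i) c : Fin n → ℕ) (lo i) = b := by
  simp [lo_ne_hi i]

theorem single_pair_hi {i : Fin (n - 1)} (b c : ℕ) :
    (Pi.single (lo i) b + Pi.single (hi i) c : Fin n → ℕ) (hi i) = c := by
  simp [(lo_ne_hi i).symm]

theorem single_pair_of_ne {i : Fin (n - 1)} (b c : ℕ) {r : Fin n} (h1 : r ≠ lo i) (h2 : r ≠ hi i) :
    (Pi.single (lo i) b + Pi.single (hi i) c : Fin n → ℕ) r = 0 := by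
  simp [h1, h2]

/-- `T_i x^κ` for `κ_i > κ_{i+1}`: the monomial `x^{s_i κ}` has coefficient one. -/
theorem T_mon_of_gt {i : Fin (n - 1)} {κ : Fin n → ℕ} (h : κ (hi i) < κ (lo i)) :
    T i (mon κ) ∈ polysIn {κ' | Within i κ' κ} ∧ coe (act (simple i) κ) (T i (mon κ)) = 1 := by
  -- split off the largest factor of `x^κ` that is symmetric in `x_i, x_{i+1}`
  obtain ⟨d, hd⟩ := Nat.exists_eq_add_of_lt h
  set κ0 : Fin n → ℕ := Function.update κ (lo i) (κ (hi i)) with hκ0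
  have a1 : κ0 (lo i) = κ (hi i) := Function.update_self _ _ _
  have a2 : κ0 (hi i) = κ (hi i) := Function.update_of_ne (lo_ne_hi i).symm _ _
  have a3 : ∀ r, r ≠ lo i → κ0 r = κ r := fun r hr => Function.update_of_ne hr _ _
  have hs : permPoly (simple i) (mon κ0) = mon κ0 := by
    rw [permPoly_mon, act_simple_eq (a1.trans a2.symm)]
  have e : mon κ = mon κ0 * X (lo i) ^ (d + 1) := by
    rw [← mon_single, ← mon_mul]
    congr 1
    refine ext_pair (i := i) (fun r h1 h2 => ?_) ?_ ?_
    · simp [h1, a3 r h1]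
    · simp [a1]; omega
    · simp [a2, (lo_ne_hi i).symm]
  have e' : T i (mon κ) = ∑ c ∈ Finset.range (d + 1), (if c = 0 then 1 else 1 - t) •
      mon (κ0 + (Pi.single (lo i) c + Pi.single (hi i) (d + 1 - c))) := by
    rw [e, T_mul_of_symm hs, T_X_lo_pow, Finset.mul_sum]
    refine Finset.sum_congr rfl fun c _ => ?_
    rw [mon_mul, mon_mul, mon_single, mon_single, smul_eq_C_mul]
    ring
  constructor
  · rw [e']
    refine Submodule.sum_mem _ fun c hc => Submodule.smul_mem _ _ (mon_mem ?_)
    rw [Finset.mem_range] at hc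
    refine ⟨fun r h1 h2 => ?_, ?_, ?_, ?_⟩
    · rw [Pi.add_apply, single_pair_of_ne _ _ h1 h2, a3 r h1, add_zero]
    all_goals
      simp only [Pi.add_apply κ0, single_pair_lo, single_pair_hi, a1, a2]
      omega
  · rw [e', map_sum, Finset.sum_eq_single 0]
    · rw [if_pos rfl, one_smul, coe_mon, if_pos]
      refine ext_pair (i := i) (fun r h1 h2 => ?_) ?_ ?_
      · rw [Pi.add_apply, single_pair_of_ne _ _ h1 h2, a3 r h1, add_zero, act_simple_apply,
          simple_of_ne h1 h2]
      · rw [Pi.add_apply, single_pair_lo, a1, act_simple_apply, simple_lo, add_zero]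
      · rw [Pi.add_apply, single_pair_hi, a2, act_simple_apply, simple_hi]; omega
    · intro c _ hc
      rw [map_smul, coe_mon, if_neg hc, if_neg, smul_zero]
      intro h0
      have := congrFun h0 (lo i)
      rw [Pi.add_apply, single_pair_lo, a1, act_simple_apply, simple_lo] at this
      omega
    · simp

theorem T_mon_mem (i : Fin (n - 1)) (κ : Fin n → ℕ) :
    T i (mon κ) ∈ polysIn {κ' | Within i κ' κ} := by
  rcases lt_or_ge (κ (hi i)) (κ (lo i)) with h | h
  · exact (T_mon_of_gt h).1
  obtain ⟨d, hd⟩ := Nat.exists_eq_add_of_le h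
  set κ0 : Fin n → ℕ := Function.update κ (hi i) (κ (lo i)) with hκ0
  have a1 : κ0 (hi i) = κ (lo i) := Function.update_self _ _ _
  have a2 : κ0 (lo i) = κ (lo i) := Function.update_of_ne (lo_ne_hi i) _ _
  have a3 : ∀ r, r ≠ hi i → κ0 r = κ r := fun r hr => Function.update_of_ne hr _ _
  have hs : permPoly (simple i) (mon κ0) = mon κ0 := by
    rw [permPoly_mon, act_simple_eq (a2.trans a1.symm)]
  have e : mon κ = mon κ0 * X (hi i) ^ d := by
    rw [← mon_single, ← mon_mul]
    congr 1
    refine ext_pair (i := i) (fun r h1 h2 => ?_) ?_ ?_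
    · simp [h2, a3 r h2]
    · simp [a2, lo_ne_hi i]
    · simp [a1, hd]
  obtain ⟨a, ha⟩ := T_X_hi_pow i d
  have e' : T i (mon κ) = ∑ c ∈ Finset.range (d + 1), a c •
      mon (κ0 + (Pi.single (lo i) c + Pi.single (hi i) (d - c))) := by
    rw [e, T_mul_of_symm hs, ha, Finset.mul_sum]
    refine Finset.sum_congr rfl fun c _ => ?_
    rw [mon_mul, mon_mul, mon_single, mon_single, smul_eq_C_mul]
    ring
  rw [e']
  refine Submodule.sum_mem _ fun c hc => Submodule.smul_mem _ _ (mon_mem ?_)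
  rw [Finset.mem_range] at hc
  refine ⟨fun r h1 h2 => ?_, ?_, ?_, ?_⟩
  · rw [Pi.add_apply, single_pair_of_ne _ _ h1 h2, a3 r h2, add_zero]
  all_goals
    simp only [Pi.add_apply κ0, single_pair_lo, single_pair_hi, a1, a2]
    omega

/-- `T_i` maps combinations of the `x^κ` with `κ ≤ ν` to combinations of those with
`κ ≤ max(ν, s_i ν)`. -/
theorem T_mem_polysIn (i : Fin (n - 1)) {ν : Fin n → ℕ} {f : MvPolynomial (Fin n) K}
    (hf : f ∈ polysIn {κ | BruhatLE κ ν}) : T i f ∈ polysIn {κ | BruhatLE κ (top i ν)} :=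
  polysIn_le_comap (T i) (fun κ hκ => polysIn_mono
    (fun _ (h : Within i _ κ) => h.le_top.trans (BruhatLE.top_le hκ)) (T_mon_mem i κ)) hf

/-- For `ν_i > ν_{i+1}`, `T_i` carries the leading coefficient at `x^ν` to `x^{s_i ν}`. -/
theorem coe_T {i : Fin (n - 1)} {ν : Fin n → ℕ} (hν : ν (hi i) < ν (lo i))
    {f : MvPolynomial (Fin n) K} (hf : f ∈ polysIn {κ | BruhatLE κ ν}) :
    coe (act (simple i) ν) (T i f) = coe ν f := by
  have key : T i f - coe ν f • T i (mon ν) ∈ polysIn {κ | κ ≠ act (simple i) ν} := by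
    rw [← map_smul, ← map_sub]
    have hf' : f - coe ν f • mon ν ∈ polysIn {κ | BruhatLT κ ν} := by
      intro κ hκ
      rw [map_sub, map_smul, coe_mon, smul_eq_mul]
      split_ifs with h
      · subst h; ring
      · rw [hf κ, mul_zero, sub_zero]
        rintro (h' | h')
        · exact h h'.symm
        · exact hκ h'
    refine polysIn_le_comap (T i) (fun κ hκ => polysIn_mono ?_ (T_mon_mem i κ)) hf'
    -- `x^{s_i ν}` cannot occur in `T_i x^κ` for `κ < ν`
    rintro _ hw rfl
    have h1 := Within.le_top hw
    have h2 : BruhatLE (top i κ) (top i ν) := BruhatLE.top_le (BruhatLT.le hκ)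
    rw [top_of_ge hν.le] at h2
    have h3 := h2.antisymm h1
    have h4 := lt_act_simple hν
    rcases le_total (κ (lo i)) (κ (hi i)) with h | h
    · rw [top_of_le h] at h3
      rw [h3] at hκ
      exact bruhatLT_irrefl _ (h4.trans hκ)
    · rw [top_of_ge h] at h3
      have := congrArg (act (simple i)) h3
      simp only [act_simple_act_simple] at this
      rw [this] at hκ
      exact bruhatLT_irrefl _ hκ
  have := key (act (simple i) ν) (by simp)
  rw [map_sub, map_smul, (T_mon_of_gt hν).2, smul_eq_mul, mul_one, sub_eq_zero] at this
  exact this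

/-- The raising operator sends monomials to multiples of monomials. -/
theorem raise_mon {N : ℕ} (ν : Fin (N + 1) → ℕ) :
    raise N.succ_pos (mon ν) = (q⁻¹ ^ ν (Fin.last N)) • mon (shift ν) := by
  rw [raise_apply, mon, mon, map_prod, Fin.prod_univ_castSucc, Fin.prod_univ_succ]
  have h1 : ∀ r : Fin N, omega (X r.castSucc ^ ν r.castSucc) =
      (X r.succ ^ shift ν r.succ : MvPolynomial (Fin (N + 1)) K) := by
    intro r
    rw [map_pow, omega_X_of_lt _ (by simp)]
    rfl
  rw [Finset.prod_congr rfl fun r _ => h1 r, map_pow, omega_X_of_eq _ (by simp), shift_zero,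
    mul_pow, smul_eq_C_mul, pow_succ, map_pow]
  change X 0 * (_ * (_ * X 0 ^ _)) = _
  ring

theorem raise_mem_polysIn {N : ℕ} {ν : Fin (N + 1) → ℕ} {f : MvPolynomial (Fin (N + 1)) K}
    (hf : f ∈ polysIn {κ | BruhatLE κ ν}) :
    raise N.succ_pos f ∈ polysIn {κ | BruhatLE κ (shift ν)} := by
  refine polysIn_le_comap _ (fun κ hκ => ?_) hf
  rw [raise_mon]
  refine Submodule.smul_mem _ _ (mon_mem ?_)
  rcases hκ with rfl | hκ
  · exact .refl _
  · exact (BruhatLT.shift hκ).le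

theorem shift_injective {N : ℕ} : Function.Injective (shift (N := N)) := by
  intro κ ν h
  ext r
  induction r using Fin.lastCases with
  | last => have := congrFun h 0; simpa using this
  | cast r => have := congrFun h r.succ; simpa using this

theorem coe_raise {N : ℕ} (ν : Fin (N + 1) → ℕ) (f : MvPolynomial (Fin (N + 1)) K) :
    coe (shift ν) (raise N.succ_pos f) = q⁻¹ ^ ν (Fin.last N) * coe ν f := by
  have hc : ∀ κ, coe (shift ν) (raise N.succ_pos (mon κ)) =
      q⁻¹ ^ ν (Fin.last N) * coe ν (mon κ) := by
    intro κ
    rw [raise_mon, map_smul, coe_mon, coe_mon, smul_eq_mul]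
    by_cases h : κ = ν
    · rw [h, if_pos rfl, if_pos rfl]
    · rw [if_neg h, if_neg fun h' => h (shift_injective h'), mul_zero, mul_zero]
  conv_lhs => rw [sum_coe_mon f]
  conv_rhs => rw [sum_coe_mon f]
  simp only [map_sum, map_smul, Finset.mul_sum, hc, smul_eq_mul]
  refine Finset.sum_congr rfl fun κ _ => ?_
  ring

/-! ### The spectrum of the Cherednik operators -/

theorem q_pow_mul_t_pow (a b : ℕ) : q ^ a * t ^ b = algebraMap (MvPolynomial (Fin 2) ℚ) K
    (monomial (Finsupp.single 0 a + Finsupp.single 1 b) 1) := by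
  have h : (monomial (Finsupp.single 0 a + Finsupp.single 1 b) 1 : MvPolynomial (Fin 2) ℚ) =
      X 0 ^ a * X 1 ^ b := by
    rw [X_pow_eq_monomial, X_pow_eq_monomial, monomial_mul, one_mul]
  rw [h, map_mul, map_pow, map_pow, q, t]

/-- The parameters `q` and `t` are multiplicatively independent. -/
theorem q_pow_mul_t_pow_inj {a b c d : ℕ} (h : q ^ a * t ^ b = q ^ c * t ^ d) :
    a = c ∧ b = d := by
  rw [q_pow_mul_t_pow, q_pow_mul_t_pow] at h
  have h1 := monomial_left_injective one_ne_zero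
    (IsFractionRing.injective (MvPolynomial (Fin 2) ℚ) K h)
  constructor
  · simpa using DFunLike.congr_fun h1 0
  · simpa using DFunLike.congr_fun h1 1

/-- The eigenvalue `q^{-ν_i} t^{coarm_ν(i)}` of `Y_i` on `E_ν`. -/
def spec (ν : Fin n → ℕ) (i : Fin n) : K := (q ^ ν i)⁻¹ * t ^ coarm ν i

theorem spec_eq_iff {κ ν : Fin n → ℕ} {i j : Fin n} :
    spec κ i = spec ν j ↔ κ i = ν j ∧ coarm κ i = coarm ν j := by
  constructor
  · intro h
    rw [spec, spec, inv_mul_eq_iff_eq_mul₀ (pow_ne_zero _ q_ne_zero), mul_left_comm,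
      eq_inv_mul_iff_mul_eq₀ (pow_ne_zero _ q_ne_zero)] at h
    have := q_pow_mul_t_pow_inj h
    exact ⟨this.1.symm, this.2⟩
  · rintro ⟨h1, h2⟩
    rw [spec, spec, h1, h2]

theorem spec_ne_zero (ν : Fin n → ℕ) (i : Fin n) : spec ν i ≠ 0 :=
  mul_ne_zero (inv_ne_zero (pow_ne_zero _ q_ne_zero)) (pow_ne_zero _ t_ne_zero)

/-- The joint spectra of the `Y_i` separate the compositions. -/
theorem spec_injective : Function.Injective (spec (n := n)) := by
  intro κ ν h
  ext i
  exact (spec_eq_iff.mp (congrFun h i)).1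

theorem coarm_eq_card (ν : Fin n → ℕ) (i : Fin n) : coarm ν i =
    (Finset.univ.filter fun r : Fin n => r < i ∧ ν i < ν r ∨ i < r ∧ ν i ≤ ν r).card := by
  rw [coarm, Finset.filter_or, Finset.card_union_of_disjoint]
  rw [Finset.disjoint_filter]
  intro r _ h1 h2
  exact lt_asymm h1.1 h2.1

theorem coarm_act {i : Fin (n - 1)} {ν : Fin n → ℕ} (h : ν (lo i) ≠ ν (hi i)) (j : Fin n) :
    coarm (act (simple i) ν) j = coarm ν (simple i j) := by
  rw [coarm_eq_card, coarm_eq_card]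
  refine Finset.card_equiv (simple i) fun r => ?_
  simp only [Finset.mem_filter, Finset.mem_univ, true_and, act_simple_apply]
  by_cases h1 : r = lo i ∧ j = hi i
  · obtain ⟨rfl, rfl⟩ := h1
    simp only [simple_lo, simple_hi, lo_lt_hi, (lo_lt_hi i).not_gt]
    grind
  by_cases h2 : r = hi i ∧ j = lo i
  · obtain ⟨rfl, rfl⟩ := h2
    simp only [simple_lo, simple_hi, lo_lt_hi, (lo_lt_hi i).not_gt]
    grind
  rw [simple_lt_simple_iff h1 h2, simple_lt_simple_iff (by tauto) (by tauto)]

theorem coarm_lo_of_eq {i : Fin (n - 1)} {ν : Fin n → ℕ} (h : ν (lo i) = ν (hi i)) :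
    coarm ν (lo i) = coarm ν (hi i) + 1 := by
  rw [coarm_eq_card, coarm_eq_card, ← Finset.card_insert_of_notMem (a := hi i) (by simp)]
  congr 1
  ext r
  have hlo : (lo i).val = i.val := rfl
  have hhi : (hi i).val = i.val + 1 := rfl
  simp only [Finset.mem_filter, Finset.mem_univ, true_and, Finset.mem_insert, h, Fin.lt_def,
    Fin.ext_iff]
  by_cases hr : r = lo i
  · subst hr; rw [h]; omega
  by_cases hr' : r = hi i
  · subst hr'; omega
  · rw [Fin.ext_iff] at hr hr'
    omega

theorem spec_act {i : Fin (n - 1)} {ν : Fin n → ℕ} (h : ν (lo i) ≠ ν (hi i)) (j : Fin n) :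
    spec (act (simple i) ν) j = spec ν (simple i j) := by
  rw [spec, spec, coarm_act h, act_simple_apply]

theorem spec_lo_of_eq {i : Fin (n - 1)} {ν : Fin n → ℕ} (h : ν (lo i) = ν (hi i)) :
    spec ν (lo i) = t * spec ν (hi i) := by
  rw [spec, spec, coarm_lo_of_eq h, h, pow_succ]; ring

theorem spec_lo_ne_hi (ν : Fin n → ℕ) (i : Fin (n - 1)) : spec ν (lo i) ≠ spec ν (hi i) := by
  intro h
  rw [spec_eq_iff] at h
  have := coarm_lo_of_eq h.1
  omega

/-! ### Existence of the nonsymmetric Macdonald polynomials -/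

theorem isNonsymMacdonald_iff {ν : Fin n → ℕ} {f : MvPolynomial (Fin n) K} :
    IsNonsymMacdonald ν f ↔ coe ν f = 1 ∧ f ∈ polysIn {κ | BruhatLE κ ν} ∧
      ∀ i, Y i f = spec ν i • f := by
  constructor
  · rintro ⟨h1, h2, h3⟩
    refine ⟨h1, fun κ hκ => ?_, h3⟩
    by_contra h
    exact hκ (h2 (Finsupp.equivFunOnFinite.symm κ) (mem_support_iff.mpr h))
  · rintro ⟨h1, h2, h3⟩
    exact ⟨h1, fun κ hκ => mem_of_mem_support h2 hκ, h3⟩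

/-- The constant `c = (1 - t) y_i / (y_i - y_{i+1})`, with `y` the spectrum of `E_ν`, by which `T_i` has to be corrected to exchange the eigenvalues of `Y_i` and
`Y_{i+1}` on `E_ν`. -/
def corr (i : Fin (n - 1)) (ν : Fin n → ℕ) : K :=
  (1 - t) * spec ν (lo i) / (spec ν (lo i) - spec ν (hi i))

theorem corr_mul (i : Fin (n - 1)) (ν : Fin n → ℕ) :
    corr i ν * (spec ν (lo i) - spec ν (hi i)) = (1 - t) * spec ν (lo i) :=
  div_mul_cancel₀ _ (sub_ne_zero.mpr (spec_lo_ne_hi ν i))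

/-- The intertwiner `T_i + c` exchanges the eigenvalues of `Y_i` and `Y_{i+1}`. -/
theorem Y_intertwiner {i : Fin (n - 1)} {ν : Fin n → ℕ} {f : MvPolynomial (Fin n) K}
    (hf : ∀ j, Y j f = spec ν j • f) (j : Fin n) :
    Y j (T i f + corr i ν • f) = spec ν (simple i j) • (T i f + corr i ν • f) := by
  have hc := corr_mul i ν
  by_cases h1 : j = lo i
  · subst h1
    have e1 := Y_lo_Tbar i f
    rw [Tbar_apply, hf (hi i), map_add, map_smul, map_smul, hf (lo i)] at e1
    rw [map_add, map_smul, hf (lo i), simple_lo, eq_sub_of_add_eq e1]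
    rw [← sub_eq_zero]
    have : corr i ν • spec ν (lo i) • f - (1 - t) • spec ν (lo i) • f -
        (spec ν (hi i) * corr i ν) • f = 0 := by
      rw [smul_smul, smul_smul, ← sub_smul, ← sub_smul]
      rw [show corr i ν * spec ν (lo i) - (1 - t) * spec ν (lo i) - spec ν (hi i) * corr i ν = 0
        by linear_combination hc, zero_smul]
    rw [← this, smul_add, smul_smul (spec ν (hi i)) (corr i ν)]
    abel
  by_cases h2 : j = hi i
  · subst h2
    rw [map_add, map_smul, Y_hi_T, hf (lo i), hf (hi i), simple_hi, map_smul, Tbar_apply]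
    rw [← sub_eq_zero]
    have : corr i ν • spec ν (hi i) • f + (spec ν (lo i) * (1 - t)) • f -
        (spec ν (lo i) * corr i ν) • f = 0 := by
      rw [smul_smul, ← add_smul, ← sub_smul]
      rw [show corr i ν * spec ν (hi i) + spec ν (lo i) * (1 - t) - spec ν (lo i) * corr i ν = 0
        by linear_combination -hc, zero_smul]
    rw [← this, smul_add, smul_add, smul_smul (spec ν (lo i)) (corr i ν),
      smul_smul (spec ν (lo i)) (1 - t)]
    abel
  · rw [simple_of_ne h1 h2, map_add, map_smul, ← T_Y_comm h1 h2, hf, map_smul, smul_add,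
      smul_comm (corr i ν)]

/-- For `ν_i > ν_{i+1}` the intertwiner sends `E_ν` to `E_{s_i ν}`. -/
theorem IsNonsymMacdonald.intertwine {i : Fin (n - 1)} {ν : Fin n → ℕ}
    {f : MvPolynomial (Fin n) K} (hf : IsNonsymMacdonald ν f) (hν : ν (hi i) < ν (lo i)) :
    IsNonsymMacdonald (act (simple i) ν) (T i f + corr i ν • f) := by
  rw [isNonsymMacdonald_iff] at hf ⊢
  obtain ⟨h1, h2, h3⟩ := hf
  have hlt := lt_act_simple hν
  refine ⟨?_, ?_, fun j => ?_⟩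
  · rw [map_add, map_smul, coe_T hν h2, h1, h2 (act (simple i) ν), smul_zero, add_zero]
    exact fun h => bruhatLT_irrefl _ (BruhatLE.trans_lt h hlt)
  · refine Submodule.add_mem _ ?_ (Submodule.smul_mem _ _ ?_)
    · have := T_mem_polysIn i h2
      rwa [top_of_ge hν.le] at this
    · exact polysIn_mono (fun κ hκ => BruhatLE.trans hκ hlt.le) h2
  · rw [Y_intertwiner h3, spec_act hν.ne']

theorem coarm_shift_zero {N : ℕ} (ν : Fin (N + 1) → ℕ) :
    coarm (shift ν) 0 = coarm ν (Fin.last N) := by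
  rw [coarm_eq_card, coarm_eq_card]
  rw [eq_comm]
  refine Finset.card_equiv (finRotate (N + 1)) fun r => ?_
  simp only [Finset.mem_filter, Finset.mem_univ, true_and]
  induction r using Fin.lastCases with
  | last => simp
  | cast r =>
    rw [finRotate_apply, Fin.coeSucc_eq_succ]
    simp only [shift_zero, shift_succ, Fin.not_lt_zero, false_and, false_or, Fin.succ_pos,
      Fin.castSucc_lt_last, true_and, (Fin.castSucc_lt_last r).not_gt, or_false]
    omega

theorem coarm_shift_succ {N : ℕ} (ν : Fin (N + 1) → ℕ) (j : Fin N) :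
    coarm (shift ν) j.succ = coarm ν j.castSucc := by
  rw [coarm_eq_card, coarm_eq_card]
  rw [eq_comm]
  refine Finset.card_equiv (finRotate (N + 1)) fun r => ?_
  simp only [Finset.mem_filter, Finset.mem_univ, true_and]
  induction r using Fin.lastCases with
  | last =>
    rw [finRotate_last]
    simp only [shift_zero, shift_succ, Fin.not_lt_zero, false_and, or_false, Fin.succ_pos,
      Fin.castSucc_lt_last, true_and, (Fin.castSucc_lt_last j).not_gt, false_or]
    omega
  | cast r =>
    rw [finRotate_apply, Fin.coeSucc_eq_succ]
    simp

/-- The raising operator sends `E_ν` to a multiple of the `E` of the shifted composition. -/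
theorem IsNonsymMacdonald.raise {N : ℕ} {ν : Fin (N + 1) → ℕ}
    {f : MvPolynomial (Fin (N + 1)) K} (hf : IsNonsymMacdonald ν f) :
    IsNonsymMacdonald (shift ν) (q ^ ν (Fin.last N) • PSMac.raise N.succ_pos f) := by
  rw [isNonsymMacdonald_iff] at hf ⊢
  obtain ⟨h1, h2, h3⟩ := hf
  refine ⟨?_, Submodule.smul_mem _ _ (raise_mem_polysIn h2), fun j => ?_⟩
  · rw [map_smul, coe_raise, h1, mul_one, smul_eq_mul, inv_pow,
      mul_inv_cancel₀ (pow_ne_zero _ q_ne_zero)]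
  · rw [map_smul, smul_comm (spec _ _)]
    congr 1
    cases j using Fin.cases with
    | zero =>
      have e := Y_zero_raise N.succ_pos f
      have e' : Y ⟨N + 1 - 1, by omega⟩ f = spec ν (Fin.last N) • f := h3 _
      rw [e', map_smul, smul_smul] at e
      refine Eq.trans e ?_
      congr 1
      rw [spec, spec, coarm_shift_zero, shift_zero, pow_succ, mul_inv]
      ring
    | succ j =>
      have e := Y_succ_raise N.succ_pos j.val (by omega) f
      have e' : Y ⟨j.val, by omega⟩ f = spec ν j.castSucc • f := h3 _
      rw [e', map_smul] at e
      refine Eq.trans e ?_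
      congr 1
      rw [spec, spec, coarm_shift_succ, shift_succ]

theorem isNonsymMacdonald_zero : IsNonsymMacdonald (0 : Fin n → ℕ) 1 := by
  rw [isNonsymMacdonald_iff]
  refine ⟨?_, ?_, fun i => ?_⟩
  · rw [← mon_zero, coe_mon, if_pos rfl]
  · rw [← mon_zero]; exact mon_mem (.refl _)
  · have h1 : ∀ b ≤ n - 1, descProd (Tbar (n := n)) 0 b 1 = 1 := by
      intro b
      induction b with
      | zero => intro _; rw [descProd_of_le _ le_rfl]; rfl
      | succ b ih =>
        intro hb
        rw [descProd_succ Tbar ⟨b, by omega⟩ (Nat.zero_le _), Module.End.mul_apply, ih (by omega),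
          Tbar_one]
    have h2 : ∀ b ≤ n - 1, i.val ≤ b → descProd (T (n := n)) i.val b 1 = t ^ (b - i.val) • 1 := by
      intro b hb hib
      induction b, hib using Nat.le_induction with
      | base => rw [descProd_of_le _ le_rfl, Nat.sub_self, pow_zero, one_smul]; rfl
      | succ b hib ih =>
        rw [descProd_succ T ⟨b, by omega⟩ hib, Module.End.mul_apply, ih (by omega), map_smul, T_one,
          smul_smul, ← pow_succ, Nat.sub_add_comm hib]
    have h3 : coarm (0 : Fin n → ℕ) i = n - 1 - i.val := by
      rw [coarm]
      simp only [Pi.zero_apply, lt_self_iff_false, and_false, le_refl, and_true]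
      rw [Finset.filter_lt_eq_Ioi, Fin.card_Ioi]
      simp
    rw [Y_eq, Module.End.mul_apply, h2 _ le_rfl (by omega), map_smul, Module.End.mul_apply,
      AlgHom.toLinearMap_apply, map_one, h1 _ (by omega), spec, h3]
    simp

/-- Existence, by the recursion of Knop and Sahi: every composition arises from `0` by raising and
by exchanging neighbours `ν_i > ν_{i+1}`. The first nonzero entry decides: in front, it comes from
raising, and else it can be moved forward by an exchange, which decreases `∑ r ν_r`. -/
theorem exists_isNonsymMacdonald (ν : Fin n → ℕ) : ∃ f, IsNonsymMacdonald ν f := by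
  induction hd : ∑ r, ν r using Nat.strong_induction_on generalizing ν with
  | _ d ihd =>
  induction hp : ∑ r, r.val * ν r using Nat.strong_induction_on generalizing ν with
  | _ p ihp =>
  by_cases h0 : ν = 0
  · exact ⟨1, h0 ▸ isNonsymMacdonald_zero⟩
  obtain ⟨r, hr⟩ := Function.ne_iff.mp h0
  have hex : ∃ a : ℕ, ∃ h : a < n, ν ⟨a, h⟩ ≠ 0 := ⟨r.val, r.isLt, hr⟩
  classical
  obtain ⟨hN, hr⟩ := Nat.find_spec hex
  have hmin : ∀ b < Nat.find hex, ∀ h : b < n, ν ⟨b, h⟩ = 0 := fun b hb h => by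
    have := Nat.find_min hex hb
    push Not at this
    exact this h
  generalize Nat.find hex = a at hN hr hmin
  cases a with
  | zero =>
    obtain ⟨N, rfl⟩ : ∃ N, n = N + 1 := ⟨n - 1, by omega⟩
    set κ : Fin (N + 1) → ℕ := Fin.snoc (fun r : Fin N => ν r.succ) (ν 0 - 1) with hκ
    have hr' : ν 0 ≠ 0 := hr
    have e : ν = shift κ := by
      ext r
      cases r using Fin.cases with
      | zero => rw [shift_zero, hκ, Fin.snoc_last]; omega
      | succ r => rw [shift_succ, hκ, Fin.snoc_castSucc]
    have hsum : ∑ r, κ r < d := by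
      rw [← hd, Fin.sum_univ_castSucc, Fin.sum_univ_succ, hκ]
      simp only [Fin.snoc_castSucc, Fin.snoc_last]
      omega
    obtain ⟨f, hf⟩ := ihd _ hsum κ rfl
    rw [e]
    exact ⟨_, hf.raise⟩
  | succ a =>
    set i : Fin (n - 1) := ⟨a, by omega⟩ with hi'
    have hlo : ν (lo i) = 0 := hmin a (Nat.lt_succ_self a) _
    have hhi : ν (hi i) ≠ 0 := hr
    have hlt : ν (lo i) < ν (hi i) := by omega
    have hrank := rank_lt (act_simple_lt hlt)
    have hsq : ∀ k : ℕ, ∑ r, act (simple i) ν r ^ k = ∑ r, ν r ^ k := by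
      intro k
      rw [← Equiv.sum_comp (simple i) fun r => ν r ^ k]
      simp
    rw [rank, rank, Prod.Lex.toLex_lt_toLex, hsq 2] at hrank
    simp only [lt_self_iff_false, true_and, false_or] at hrank
    obtain ⟨f, hf⟩ := ihp _ (hp ▸ hrank) (act (simple i) ν)
      (by rw [← hd]; simpa using hsq 1) rfl
    have := hf.intertwine (i := i) (by simpa using hlt)
    rw [act_simple_act_simple] at this
    exact ⟨_, this⟩

theorem isNonsymMacdonald_E (ν : Fin n → ℕ) : IsNonsymMacdonald ν (E ν) :=
  Classical.epsilon_spec (exists_isNonsymMacdonald ν)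

theorem coe_E_self (ν : Fin n → ℕ) : coe ν (E ν) = 1 :=
  (isNonsymMacdonald_iff.mp (isNonsymMacdonald_E ν)).1

theorem E_mem (ν : Fin n → ℕ) : E ν ∈ polysIn {κ | BruhatLE κ ν} :=
  (isNonsymMacdonald_iff.mp (isNonsymMacdonald_E ν)).2.1

theorem Y_E (ν : Fin n → ℕ) (i : Fin n) : Y i (E ν) = spec ν i • E ν :=
  (isNonsymMacdonald_iff.mp (isNonsymMacdonald_E ν)).2.2 i

/-! ### The basis of nonsymmetric Macdonald polynomials -/

theorem linearIndependent_E : LinearIndependent K (E (n := n)) := by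
  rw [linearIndependent_iff']
  intro s g hg κ hκ
  by_contra hne
  -- the leading monomial of a term of maximal rank occurs in no other term
  obtain ⟨ν, hν, hmax⟩ := Finset.exists_max_image (s.filter fun μ => g μ ≠ 0) rank
    ⟨κ, Finset.mem_filter.mpr ⟨hκ, hne⟩⟩
  rw [Finset.mem_filter] at hν
  have h := congrArg (coe ν) hg
  rw [map_sum, Finset.sum_eq_single ν, map_smul, coe_E_self, smul_eq_mul, mul_one, map_zero] at h
  · exact hν.2 h
  · intro μ hμ hμν
    rw [map_smul, smul_eq_mul]
    by_cases h0 : g μ = 0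
    · rw [h0, zero_mul]
    rw [E_mem μ ν, mul_zero]
    rintro (h' | h')
    · exact hμν h'.symm
    · exact (rank_lt h').not_ge (hmax μ (Finset.mem_filter.mpr ⟨hμ, h0⟩))
  · exact fun h' => absurd hν.1 h'

theorem mon_mem_span_E (ν : Fin n → ℕ) : mon ν ∈ Submodule.span K (Set.range (E (n := n))) := by
  induction hr : rank ν using WellFoundedLT.induction generalizing ν with
  | _ x ih =>
  have h : E ν - mon ν ∈ Submodule.span K (Set.range (E (n := n))) := by
    refine polysIn_induction (S := {κ | BruhatLT κ ν}) (fun κ hκ => ih _ (hr ▸ rank_lt hκ) κ rfl) ?_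
    intro κ hκ
    rw [map_sub, coe_mon]
    split_ifs with h
    · subst h; rw [coe_E_self, sub_self]
    · rw [E_mem ν κ, sub_zero]
      rintro (h' | h')
      · exact h h'.symm
      · exact hκ h'
  have := Submodule.sub_mem _ (Submodule.subset_span (Set.mem_range_self ν)) h
  rwa [sub_sub_cancel] at this

/-- The basis of the polynomial ring formed by the nonsymmetric Macdonald polynomials. -/
def macBasis (n : ℕ) : Module.Basis (Fin n → ℕ) K (MvPolynomial (Fin n) K) :=
  Module.Basis.mk linearIndependent_E fun f _ => by
    rw [sum_coe_mon f]
    exact Submodule.sum_mem _ fun κ _ => Submodule.smul_mem _ _ (mon_mem_span_E _)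

@[simp] theorem macBasis_apply (ν : Fin n → ℕ) : macBasis n ν = E ν := by
  rw [macBasis, Module.Basis.mk_apply]

/-- The coefficient of `E_ν` in a polynomial. -/
def coeE (ν : Fin n → ℕ) : MvPolynomial (Fin n) K →ₗ[K] K := (macBasis n).coord ν

theorem coeE_E (κ ν : Fin n → ℕ) : coeE κ (E ν) = if ν = κ then 1 else 0 := by
  rw [coeE, ← macBasis_apply, Module.Basis.coord_apply, Module.Basis.repr_self,
    Finsupp.single_apply]

theorem ext_coeE {f g : MvPolynomial (Fin n) K} (h : ∀ ν, coeE ν f = coeE ν g) : f = g :=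
  (macBasis n).ext_elem h

theorem coeE_Y (ν : Fin n → ℕ) (i : Fin n) (f : MvPolynomial (Fin n) K) :
    coeE ν (Y i f) = spec ν i * coeE ν f := by
  have : (coeE ν).comp (Y i) = spec ν i • coeE ν := by
    refine (macBasis n).ext fun κ => ?_
    rw [macBasis_apply, LinearMap.comp_apply, Y_E, map_smul, LinearMap.smul_apply, coeE_E,
      smul_eq_mul, smul_eq_mul]
    split_ifs with h
    · rw [h]
    · simp
  exact DFunLike.congr_fun this f

/-- A joint eigenvector of the `Y_i` only involves the `E_ν` with the same eigenvalues. -/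
theorem coeE_eq_zero {f : MvPolynomial (Fin n) K} {w : Fin n → K} (hf : ∀ i, Y i f = w i • f)
    {ν : Fin n → ℕ} {i : Fin n} (h : w i ≠ spec ν i) : coeE ν f = 0 := by
  have e := coeE_Y ν i f
  rw [hf, map_smul, smul_eq_mul, ← sub_eq_zero, ← sub_mul] at e
  exact (mul_eq_zero.mp e).resolve_left (sub_ne_zero.mpr h)

theorem eq_smul_E {ν : Fin n → ℕ} {f : MvPolynomial (Fin n) K}
    (hf : ∀ i, Y i f = spec ν i • f) : f = coeE ν f • E ν := by
  refine ext_coeE fun κ => ?_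
  rw [map_smul, coeE_E, smul_eq_mul]
  split_ifs with h
  · rw [h, mul_one]
  · have hne : spec ν ≠ spec κ := fun h' => h (spec_injective h')
    obtain ⟨i, hi'⟩ := Function.ne_iff.mp hne
    rw [coeE_eq_zero hf hi', mul_zero]

/-- Uniqueness of the nonsymmetric Macdonald polynomials. -/
theorem IsNonsymMacdonald.eq_E {ν : Fin n → ℕ} {f : MvPolynomial (Fin n) K}
    (hf : IsNonsymMacdonald ν f) : f = E ν := by
  rw [isNonsymMacdonald_iff] at hf
  have h := eq_smul_E hf.2.2
  have h1 := congrArg (coe ν) h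
  rw [hf.1, map_smul, coe_E_self, smul_eq_mul, mul_one] at h1
  rw [h, ← h1, one_smul]

theorem T_E_of_gt {i : Fin (n - 1)} {ν : Fin n → ℕ} (h : ν (hi i) < ν (lo i)) :
    T i (E ν) = E (act (simple i) ν) - corr i ν • E ν := by
  rw [← ((isNonsymMacdonald_E ν).intertwine h).eq_E, add_sub_cancel_right]

theorem T_E_of_lt {i : Fin (n - 1)} {ν : Fin n → ℕ} (h : ν (lo i) < ν (hi i)) :
    T i (E ν) = (t - 1 + corr i (act (simple i) ν)) • E ν +
      (t - corr i (act (simple i) ν) * (t - 1 + corr i (act (simple i) ν))) •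
        E (act (simple i) ν) := by
  set κ := act (simple i) ν with hκ
  have h1 : T i (E κ) = E ν - corr i κ • E κ := by
    rw [T_E_of_gt (by simpa [hκ] using h), hκ, act_simple_act_simple]
  have h2 : E ν = T i (E κ) + corr i κ • E κ := by rw [h1, sub_add_cancel]
  have h3 : T i (E ν) = (t - 1 + corr i κ) • T i (E κ) + t • E κ := by
    conv_lhs => rw [h2]
    rw [map_add, map_smul, T_T, add_smul]
    abel
  rw [h3, h1, smul_sub, smul_smul, sub_smul, mul_comm (corr i κ)]
  abel

theorem T_E_of_eq {i : Fin (n - 1)} {ν : Fin n → ℕ} (h : ν (lo i) = ν (hi i)) :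
    T i (E ν) = t • E ν := by
  have hc : corr i ν = -t := by
    have h1 := corr_mul i ν
    have h2 := sub_ne_zero.mpr (spec_lo_ne_hi ν i)
    apply mul_right_cancel₀ h2
    rw [h1, spec_lo_of_eq h]
    ring
  -- `(T_i - t) E_ν` has eigenvalues that occur for no composition
  have hz : T i (E ν) + corr i ν • E ν = 0 := by
    refine ext_coeE fun κ => ?_
    rw [map_zero]
    by_cases hκ : κ = ν
    · subst hκ
      refine coeE_eq_zero (Y_intertwiner (Y_E κ)) (i := lo i) ?_
      rw [simple_lo]
      exact (spec_lo_ne_hi κ i).symm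
    · obtain ⟨j, hj⟩ := Function.ne_iff.mp hκ
      refine coeE_eq_zero (Y_intertwiner (Y_E ν)) (i := j) ?_
      intro h'
      have := (spec_eq_iff.mp h').1
      rw [← act_simple_apply i ν j, act_simple_eq h] at this
      exact hj this.symm
  rw [hc, neg_smul, add_neg_eq_zero] at hz
  exact hz

/-! ### Inversions and reduced words -/

/-- The number of inversions of a permutation. -/
def inv (w : Equiv.Perm (Fin n)) : ℕ :=
  (Finset.univ.filter fun p : Fin n × Fin n => p.1 < p.2 ∧ w p.2 < w p.1).card

/-- The number of inversions of a permutation between positions at which `ν` has equal entries. -/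
def blockInv (ν : Fin n → ℕ) (w : Equiv.Perm (Fin n)) : ℕ :=
  (Finset.univ.filter fun p : Fin n × Fin n =>
    p.1 < p.2 ∧ ν p.1 = ν p.2 ∧ w p.2 < w p.1).card

theorem inversion_simple_mul {i : Fin (n - 1)} {w : Equiv.Perm (Fin n)}
    (h : w.symm (lo i) < w.symm (hi i)) (p : Fin n × Fin n) :
    (p.1 < p.2 ∧ (simple i * w) p.2 < (simple i * w) p.1) ↔
      (p = (w.symm (lo i), w.symm (hi i)) ∨ (p.1 < p.2 ∧ w p.2 < w p.1)) := by
  obtain ⟨a, b⟩ := p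
  simp only [Equiv.Perm.mul_apply, Prod.mk.injEq, Equiv.eq_symm_apply]
  by_cases h1 : w b = lo i ∧ w a = hi i
  · have hb : b = w.symm (lo i) := (Equiv.eq_symm_apply w).mpr h1.1
    have ha : a = w.symm (hi i) := (Equiv.eq_symm_apply w).mpr h1.2
    have hab : ¬ a < b := by rw [ha, hb]; exact h.not_gt
    simp [hab, h1.1, h1.2, (lo_ne_hi i), (lo_ne_hi i).symm]
  by_cases h2 : w b = hi i ∧ w a = lo i
  · have hb : b = w.symm (hi i) := (Equiv.eq_symm_apply w).mpr h2.1
    have ha : a = w.symm (lo i) := (Equiv.eq_symm_apply w).mpr h2.2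
    have hab : a < b := by rw [ha, hb]; exact h
    simp [hab, h2.1, h2.2, lo_lt_hi]
  rw [simple_lt_simple_iff h1 h2]
  tauto

theorem inv_simple_mul {i : Fin (n - 1)} {w : Equiv.Perm (Fin n)}
    (h : w.symm (lo i) < w.symm (hi i)) : inv (simple i * w) = inv w + 1 := by
  rw [inv, inv, ← Finset.card_insert_of_notMem (a := (w.symm (lo i), w.symm (hi i)))]
  · congr 1
    ext p
    simp only [Finset.mem_insert, Finset.mem_filter, Finset.mem_univ, true_and]
    exact inversion_simple_mul h p
  · simp only [Finset.mem_filter, Finset.mem_univ, true_and, Equiv.apply_symm_apply, not_and,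
      not_lt]
    exact fun _ => (lo_lt_hi i).le

theorem blockInv_simple_mul (ν : Fin n → ℕ) {i : Fin (n - 1)} {w : Equiv.Perm (Fin n)}
    (h : w.symm (lo i) < w.symm (hi i)) : blockInv ν (simple i * w) =
      blockInv ν w + if ν (w.symm (lo i)) = ν (w.symm (hi i)) then 1 else 0 := by
  rw [blockInv, blockInv]
  split_ifs with he
  · rw [← Finset.card_insert_of_notMem (a := (w.symm (lo i), w.symm (hi i)))]
    · congr 1
      ext p
      simp only [Finset.mem_insert, Finset.mem_filter, Finset.mem_univ, true_and]
      have := inversion_simple_mul h p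
      constructor
      · rintro ⟨h1, h2, h3⟩
        rcases this.mp ⟨h1, h3⟩ with h4 | h4
        · exact Or.inl h4
        · exact Or.inr ⟨h1, h2, h4.2⟩
      · rintro (h1 | ⟨h1, h2, h3⟩)
        · have h5 := this.mpr (Or.inl h1)
          exact ⟨h5.1, by rw [h1]; exact he, h5.2⟩
        · exact ⟨h1, h2, (this.mpr (Or.inr ⟨h1, h3⟩)).2⟩
    · simp only [Finset.mem_filter, Finset.mem_univ, true_and, Equiv.apply_symm_apply, not_and,
        not_lt]
      exact fun _ _ => (lo_lt_hi i).le
  · rw [add_zero]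
    congr 1
    ext p
    simp only [Finset.mem_filter, Finset.mem_univ, true_and]
    have := inversion_simple_mul h p
    constructor
    · rintro ⟨h1, h2, h3⟩
      rcases this.mp ⟨h1, h3⟩ with h4 | h4
      · rw [h4] at h2; exact absurd h2 he
      · exact ⟨h1, h2, h4.2⟩
    · rintro ⟨h1, h2, h3⟩
      exact ⟨h1, h2, (this.mpr (Or.inr ⟨h1, h3⟩)).2⟩

theorem simple_mul_simple_mul (i : Fin (n - 1)) (w : Equiv.Perm (Fin n)) :
    simple i * (simple i * w) = w := by
  rw [← mul_assoc, simple_mul_self, one_mul]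

theorem symm_simple_mul (i : Fin (n - 1)) (w : Equiv.Perm (Fin n)) (r : Fin n) :
    (simple i * w).symm r = w.symm (simple i r) := by
  rw [Equiv.symm_apply_eq, Equiv.Perm.mul_apply, Equiv.apply_symm_apply, simple_simple]

theorem inv_simple_mul_of_gt {i : Fin (n - 1)} {w : Equiv.Perm (Fin n)}
    (h : w.symm (hi i) < w.symm (lo i)) : inv (simple i * w) + 1 = inv w := by
  have := inv_simple_mul (i := i) (w := simple i * w)
    (by rw [symm_simple_mul, symm_simple_mul, simple_lo, simple_hi]; exact h)
  rw [simple_mul_simple_mul] at this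
  exact this.symm

theorem symm_lo_lt_or_gt (i : Fin (n - 1)) (w : Equiv.Perm (Fin n)) :
    w.symm (lo i) < w.symm (hi i) ∨ w.symm (hi i) < w.symm (lo i) :=
  lt_or_gt_of_ne fun h => lo_ne_hi i (w.symm.injective h)

theorem wordProd_cons (i : Fin (n - 1)) (l : List (Fin (n - 1))) :
    wordProd (i :: l) = simple i * wordProd l := by simp [wordProd]

@[simp] theorem inv_one : inv (1 : Equiv.Perm (Fin n)) = 0 := by
  rw [inv, Finset.card_eq_zero, Finset.filter_eq_empty_iff]
  rintro p _ ⟨h1, h2⟩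
  exact lt_asymm h1 h2

theorem inv_wordProd_le (l : List (Fin (n - 1))) : inv (wordProd l) ≤ l.length := by
  induction l with
  | nil => simp [wordProd]
  | cons i l ih =>
    rw [wordProd_cons, List.length_cons]
    rcases symm_lo_lt_or_gt i (wordProd l) with h | h
    · rw [inv_simple_mul h]; omega
    · have := inv_simple_mul_of_gt h; omega

/-- A permutation without descents is the identity. -/
theorem exists_descent {w : Equiv.Perm (Fin n)} (hw : w ≠ 1) :
    ∃ i : Fin (n - 1), w.symm (hi i) < w.symm (lo i) := by
  by_contra! h
  apply hw
  have hmono : Monotone w.symm := by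
    cases n with
    | zero => exact fun a => a.elim0
    | succ n => exact Fin.monotone_iff_le_succ.mpr fun i => h i
  have := (Equiv.Perm.monotone_iff _).mp hmono
  rw [← Equiv.symm_symm w, this]
  rfl

theorem exists_word_inv (w : Equiv.Perm (Fin n)) :
    ∃ l : List (Fin (n - 1)), wordProd l = w ∧ l.length = inv w := by
  induction hN : inv w using Nat.strong_induction_on generalizing w with
  | _ N ih =>
  by_cases hw : w = 1
  · subst hw; exact ⟨[], by simp [wordProd], by simpa using hN⟩
  obtain ⟨i, hi'⟩ := exists_descent hw
  have h := inv_simple_mul_of_gt hi'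
  obtain ⟨l, hl, hl'⟩ := ih _ (by omega) (simple i * w) rfl
  exact ⟨i :: l, by rw [wordProd_cons, hl, simple_mul_simple_mul], by
    rw [List.length_cons, hl']; omega⟩

/-- The length of a permutation is the number of its inversions. -/
theorem length_eq_inv (w : Equiv.Perm (Fin n)) : length w = inv w := by
  apply le_antisymm
  · exact Nat.sInf_le (exists_word_inv w)
  · obtain ⟨l, hl, hl'⟩ := exists_reduced w
    rw [← hl', ← hl]
    exact inv_wordProd_le l

/-- The first letter of a reduced word is a descent, and the rest is again reduced. -/
theorem reduced_cons {i : Fin (n - 1)} {l : List (Fin (n - 1))}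
    (h : (i :: l).length = inv (wordProd (i :: l))) :
    l.length = inv (wordProd l) ∧
      (wordProd (i :: l)).symm (hi i) < (wordProd (i :: l)).symm (lo i) := by
  have h1 := inv_wordProd_le l
  rw [wordProd_cons, List.length_cons] at h
  rcases symm_lo_lt_or_gt i (wordProd l) with h2 | h2
  · rw [inv_simple_mul h2] at h
    refine ⟨by omega, ?_⟩
    rw [wordProd_cons, symm_simple_mul, symm_simple_mul, simple_lo, simple_hi]
    exact h2
  · have := inv_simple_mul_of_gt h2
    omega

section Matsumoto

variable {M : Type*} [Monoid M] (F : Fin (n - 1) → M)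

/-- Matsumoto's theorem for the symmetric group: a product along a reduced word depends on the
permutation only, if the factors satisfy the braid relations. -/
theorem prod_map_eq_of_reduced
    (hcomm : ∀ i j : Fin (n - 1), i.val + 1 < j.val → F i * F j = F j * F i)
    (hbraid : ∀ i j : Fin (n - 1), i.val + 1 = j.val → F i * F j * F i = F j * F i * F j)
    (l l' : List (Fin (n - 1))) (h : wordProd l = wordProd l') (hl : l.length = inv (wordProd l))
    (hl' : l'.length = inv (wordProd l')) : (l.map F).prod = (l'.map F).prod := by
  induction hN : l.length using Nat.strong_induction_on generalizing l l' with
  | _ N ih =>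
  cases l with
  | nil =>
    have : l' = [] := by
      rw [← List.length_eq_zero_iff, hl', ← h, ← hl]; rfl
    rw [this]
  | cons i a =>
  cases l' with
  | nil =>
    rw [← h, ← hl] at hl'
    simp at hl'
  | cons j b =>
  set w := wordProd (i :: a) with hw
  have hlen : a.length = b.length := by
    rw [List.length_cons] at hl hl'
    rw [← h, ← hl] at hl'
    omega
  rw [List.length_cons] at hN
  obtain ⟨ha, hdi⟩ := reduced_cons hl
  obtain ⟨hb, hdj⟩ := reduced_cons hl'
  rw [← hw] at hdi
  rw [← h] at hdj
  have hwa : wordProd a = simple i * w := by rw [hw, wordProd_cons, simple_mul_simple_mul]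
  have hwb : wordProd b = simple j * w := by rw [h, wordProd_cons, simple_mul_simple_mul]
  rw [List.map_cons, List.map_cons, List.prod_cons, List.prod_cons]
  -- commuting letters: both words can be replaced by words starting with `i j` and `j i`
  have far : ∀ i j : Fin (n - 1), i.val + 1 < j.val → w.symm (hi i) < w.symm (lo i) →
      w.symm (hi j) < w.symm (lo j) → ∀ a b : List (Fin (n - 1)), a.length + 1 = N →
      b.length + 1 = N → a.length = inv (wordProd a) → b.length = inv (wordProd b) →
      wordProd a = simple i * w → wordProd b = simple j * w →
      F i * (a.map F).prod = F j * (b.map F).prod := by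
    intro i j hij hdi hdj a b haN hbN ha hb hwa hwb
    have e1 : lo j ≠ lo i := by simp only [lo, ne_eq, Fin.ext_iff]; omega
    have e2 : lo j ≠ hi i := by simp only [lo, hi, ne_eq, Fin.ext_iff]; omega
    have e3 : hi j ≠ lo i := by simp only [lo, hi, ne_eq, Fin.ext_iff]; omega
    have e4 : hi j ≠ hi i := by simp only [hi, ne_eq, Fin.ext_iff]; omega
    have hss : simple i * (simple j * w) = simple j * (simple i * w) := by
      rw [← mul_assoc, ← mul_assoc]
      congr 1
      exact (Equiv.Perm.disjoint_swap_swap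
        (by simp [e1.symm, e2.symm, e3.symm, e4.symm, lo_ne_hi])).commute
    have h1 : inv (simple j * (simple i * w)) + 1 = inv (simple i * w) := by
      apply inv_simple_mul_of_gt
      rw [symm_simple_mul, symm_simple_mul, simple_of_ne e1 e2, simple_of_ne e3 e4]
      exact hdj
    obtain ⟨c, hc, hc'⟩ := exists_word_inv (simple j * (simple i * w))
    have hj : wordProd (j :: c) = simple i * w := by
      rw [wordProd_cons, hc, simple_mul_simple_mul]
    have hi' : wordProd (i :: c) = simple j * w := by
      rw [wordProd_cons, hc, ← hss, simple_mul_simple_mul]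
    rw [ih a.length (by omega) a (j :: c) (hwa.trans hj.symm) ha (by
        rw [hj, List.length_cons, hc', h1]) rfl,
      ih b.length (by omega) b (i :: c) (hwb.trans hi'.symm) hb (by
        rw [hi', List.length_cons, hc', h1, ← hwa, ← hwb]; omega) rfl]
    rw [List.map_cons, List.map_cons, List.prod_cons, List.prod_cons, ← mul_assoc, hcomm i j hij,
      mul_assoc]
  -- neighbouring letters: both words can be replaced by words starting with `i j i` and `j i j`
  have near : ∀ i j : Fin (n - 1), i.val + 1 = j.val → w.symm (hi i) < w.symm (lo i) →
      w.symm (hi j) < w.symm (lo j) → ∀ a b : List (Fin (n - 1)), a.length + 1 = N →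
      b.length + 1 = N → a.length = inv (wordProd a) → b.length = inv (wordProd b) →
      wordProd a = simple i * w → wordProd b = simple j * w →
      F i * (a.map F).prod = F j * (b.map F).prod := by
    intro i j hij hdi hdj a b haN hbN ha hb hwa hwb
    have e : lo j = hi i := by simp only [lo, hi, Fin.ext_iff]; omega
    have e1 : hi j ≠ lo i := by simp only [lo, hi, ne_eq, Fin.ext_iff]; omega
    have e2 : hi j ≠ hi i := by simp only [hi, ne_eq, Fin.ext_iff]; omega
    have s1 : simple i (hi j) = hi j := simple_of_ne e1 e2
    have s2 : simple j (lo i) = lo i := simple_of_ne (e ▸ lo_ne_hi i) e1.symm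
    have s3 : simple j (hi i) = hi j := by rw [← e, simple_lo]
    have s4 : simple j (hi j) = hi i := by rw [simple_hi, e]
    rw [e] at hdj
    have hss : simple i * (simple j * (simple i * w)) = simple j * (simple i * (simple j * w)) := by
      have := congrArg (· * w) (simple_braid hij)
      simpa only [mul_assoc] using this
    have h1 : inv (simple j * (simple i * w)) + 1 = inv (simple i * w) := by
      apply inv_simple_mul_of_gt
      rw [symm_simple_mul, symm_simple_mul, s1, e, simple_hi]
      exact hdj.trans hdi
    have h2 : inv (simple i * (simple j * (simple i * w))) + 1 =
        inv (simple j * (simple i * w)) := by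
      apply inv_simple_mul_of_gt
      simp only [symm_simple_mul, s1, s2, s3, simple_lo]
      exact hdj
    obtain ⟨c, hc, hc'⟩ := exists_word_inv (simple i * (simple j * (simple i * w)))
    have hj : wordProd (j :: i :: c) = simple i * w := by
      rw [wordProd_cons, wordProd_cons, hc, simple_mul_simple_mul, simple_mul_simple_mul]
    have hi' : wordProd (i :: j :: c) = simple j * w := by
      rw [wordProd_cons, wordProd_cons, hc, hss, simple_mul_simple_mul, simple_mul_simple_mul]
    rw [ih a.length (by omega) a (j :: i :: c) (hwa.trans hj.symm) ha (by
        rw [hj, List.length_cons, List.length_cons, hc', h2, h1]) rfl,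
      ih b.length (by omega) b (i :: j :: c) (hwb.trans hi'.symm) hb (by
        rw [hi', List.length_cons, List.length_cons, hc', h2, h1, ← hwa, ← hwb]; omega) rfl]
    simp only [List.map_cons, List.prod_cons]
    simp only [← mul_assoc]
    rw [hbraid i j hij]
  rcases lt_trichotomy i.val j.val with hij | hij | hij
  · rcases (Nat.succ_le_of_lt hij).lt_or_eq with hij | hij
    · exact far i j hij hdi hdj a b hN (hlen ▸ hN) ha hb hwa hwb
    · exact near i j hij hdi hdj a b hN (hlen ▸ hN) ha hb hwa hwb
  · obtain rfl : i = j := Fin.ext hij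
    rw [ih a.length (by omega) a b (hwa.trans hwb.symm) ha hb rfl]
  · rcases (Nat.succ_le_of_lt hij).lt_or_eq with hij | hij
    · exact (far j i hij hdj hdi b a (hlen ▸ hN) hN hb ha hwb hwa).symm
    · exact (near j i hij hdj hdi b a (hlen ▸ hN) hN hb ha hwb hwa).symm

end Matsumoto

theorem prod_map_T_eq_Tw {l : List (Fin (n - 1))} (hl : l.length = inv (wordProd l)) :
    (l.map T).prod = Tw (wordProd l) := by
  obtain ⟨h1, h2⟩ := (exists_reduced (wordProd l)).choose_spec
  refine prod_map_eq_of_reduced T (fun i j => T_comm) (fun i j => T_braid) l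
    (reducedWord (wordProd l)) h1.symm hl ?_
  change (exists_reduced (wordProd l)).choose.length = inv (wordProd (exists_reduced _).choose)
  rw [h2, h1, length_eq_inv]

theorem Tw_one (f : MvPolynomial (Fin n) K) : Tw 1 f = f := by
  have := prod_map_T_eq_Tw (n := n) (l := []) (by simp [wordProd])
  have h1 : wordProd (n := n) [] = 1 := rfl
  rw [h1] at this
  rw [← this]
  rfl

/-- `T_i T_w = T_{s_i w}` if `ℓ(s_i w) > ℓ(w)`. -/
theorem T_Tw {i : Fin (n - 1)} {w : Equiv.Perm (Fin n)} (h : w.symm (lo i) < w.symm (hi i))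
    (f : MvPolynomial (Fin n) K) : T i (Tw w f) = Tw (simple i * w) f := by
  obtain ⟨l, hl, hl'⟩ := exists_word_inv w
  have h1 := prod_map_T_eq_Tw (l := l) (by rw [hl, hl'])
  have h2 := prod_map_T_eq_Tw (l := i :: l) (by
    rw [wordProd_cons, hl, inv_simple_mul h, List.length_cons, hl'])
  rw [wordProd_cons, hl, List.map_cons, List.prod_cons] at h2
  rw [hl] at h1
  rw [← h2, ← h1]
  rfl

/-! ### The parabolic subgroup -/

variable {m : ℕ}

/-- The extension of a permutation of the first `m` indices that fixes the last `k` ones. -/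
def ext (k : ℕ) (v : Equiv.Perm (Fin m)) : Equiv.Perm (Fin (m + k)) :=
  finSumFinEquiv.permCongr (Equiv.Perm.sumCongr v 1)

@[simp] theorem ext_castAdd (k : ℕ) (v : Equiv.Perm (Fin m)) (a : Fin m) :
    ext k v (Fin.castAdd k a) = Fin.castAdd k (v a) := by
  simp [ext, Equiv.permCongr_apply]

@[simp] theorem ext_natAdd {k : ℕ} (v : Equiv.Perm (Fin m)) (b : Fin k) :
    ext k v (Fin.natAdd m b) = Fin.natAdd m b := by
  simp [ext, Equiv.permCongr_apply]

theorem ext_injective (k : ℕ) : Function.Injective (ext (m := m) k) := by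
  intro v w h
  refine Equiv.ext fun a => ?_
  have := DFunLike.congr_fun h (Fin.castAdd k a)
  simpa using this

@[simp] theorem ext_symm_castAdd (k : ℕ) (v : Equiv.Perm (Fin m)) (a : Fin m) :
    (ext k v).symm (Fin.castAdd k a) = Fin.castAdd k (v.symm a) := by
  rw [Equiv.symm_apply_eq, ext_castAdd, Equiv.apply_symm_apply]

@[simp] theorem ext_symm_natAdd {k : ℕ} (v : Equiv.Perm (Fin m)) (b : Fin k) :
    (ext k v).symm (Fin.natAdd m b) = Fin.natAdd m b := by
  rw [Equiv.symm_apply_eq, ext_natAdd]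

theorem mem_parabolic_iff {k : ℕ} {w : Equiv.Perm (Fin (m + k))} :
    w ∈ parabolic m k ↔ ∃ v, ext k v = w := by
  classical
  simp only [parabolic, Finset.mem_filter, Finset.mem_univ, true_and]
  constructor
  · intro h
    have hr : finSumFinEquiv.symm.permCongr w ∈
        (Equiv.Perm.sumCongrHom (Fin m) (Fin k)).range := by
      apply Equiv.Perm.mem_sumCongrHom_range_of_perm_mapsTo_inl
      rintro _ ⟨a, rfl⟩
      rcases hx : finSumFinEquiv.symm.permCongr w (Sum.inl a) with b | b
      · exact ⟨b, rfl⟩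
      · have hb : finSumFinEquiv.symm.permCongr w (Sum.inr b) = Sum.inr b := by
          simp [Equiv.permCongr_apply, h]
        have := (finSumFinEquiv.symm.permCongr w).injective (hx.trans hb.symm)
        simp at this
    obtain ⟨⟨v, u⟩, hvu⟩ := hr
    refine ⟨v, Equiv.ext fun r => ?_⟩
    induction r using Fin.addCases with
    | left a =>
      have := DFunLike.congr_fun hvu (Sum.inl a)
      simp only [Equiv.Perm.sumCongrHom_apply, Equiv.Perm.sumCongr_apply, Sum.map_inl,
        Equiv.permCongr_apply, Equiv.symm_symm, finSumFinEquiv_apply_left] at this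
      rw [ext_castAdd, ← finSumFinEquiv_apply_left, this, Equiv.apply_symm_apply]
    | right b => rw [ext_natAdd, h]
  · rintro ⟨v, rfl⟩ b
    exact ext_natAdd v b

theorem sum_parabolic {k : ℕ} {A : Type*} [AddCommMonoid A] (F : Equiv.Perm (Fin (m + k)) → A) :
    ∑ w ∈ parabolic m k, F w = ∑ v : Equiv.Perm (Fin m), F (ext k v) := by
  classical
  rw [← Finset.sum_image (f := F) (g := ext k) fun _ _ _ _ h => ext_injective k h]
  refine Finset.sum_congr ?_ fun _ _ => rfl
  ext w
  rw [mem_parabolic_iff]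
  simp

theorem symmetrizer_apply {k : ℕ} (f : MvPolynomial (Fin (m + k)) K) :
    symmetrizer m k f = ∑ v : Equiv.Perm (Fin m), Tw (ext k v) f := by
  rw [symmetrizer, sum_parabolic, LinearMap.sum_apply]

/-- The index `i` of a simple transposition of the first `m` indices, among the first `m + k`. -/
def emb (k : ℕ) (i : Fin (m - 1)) : Fin (m + k - 1) := ⟨i.val, by omega⟩

theorem lo_emb (k : ℕ) (i : Fin (m - 1)) : lo (emb k i) = Fin.castAdd k (lo i) := rfl

theorem hi_emb (k : ℕ) (i : Fin (m - 1)) : hi (emb k i) = Fin.castAdd k (hi i) := rfl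

theorem castAdd_ne_natAdd {k : ℕ} (a : Fin m) (b : Fin k) : Fin.natAdd m b ≠ Fin.castAdd k a := by
  simp only [ne_eq, Fin.ext_iff, Fin.val_natAdd, Fin.val_castAdd]
  omega

theorem simple_emb_castAdd {k : ℕ} (i : Fin (m - 1)) (a : Fin m) :
    simple (emb k i) (Fin.castAdd k a) = Fin.castAdd k (simple i a) := by
  rw [Fin.ext_iff, simple_val, Fin.val_castAdd, Fin.val_castAdd, simple_val]
  rfl

theorem simple_emb_natAdd {k : ℕ} (i : Fin (m - 1)) (b : Fin k) :
    simple (emb k i) (Fin.natAdd m b) = Fin.natAdd m b :=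
  simple_of_ne (by rw [lo_emb]; exact castAdd_ne_natAdd _ _)
    (by rw [hi_emb]; exact castAdd_ne_natAdd _ _)

theorem split_castAdd {k : ℕ} (μ : Fin m → ℕ) (γ : Fin k → ℕ) (a : Fin m) :
    split μ γ (Fin.castAdd k a) = μ a := Fin.append_left _ _ _

theorem split_natAdd {k : ℕ} (μ : Fin m → ℕ) (γ : Fin k → ℕ) (b : Fin k) :
    split μ γ (Fin.natAdd m b) = γ b := Fin.append_right _ _ _

theorem simple_emb_mul_ext {k : ℕ} (i : Fin (m - 1)) (v : Equiv.Perm (Fin m)) :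
    simple (emb k i) * ext k v = ext k (simple i * v) := by
  refine Equiv.ext fun r => ?_
  induction r using Fin.addCases with
  | left a => simp [simple_emb_castAdd]
  | right b => simp [simple_emb_natAdd]

theorem act_simple_emb {k : ℕ} (i : Fin (m - 1)) (μ : Fin m → ℕ) (γ : Fin k → ℕ) :
    act (simple (emb k i)) (split μ γ) = split (act (simple i) μ) γ := by
  ext r
  rw [act_simple_apply]
  induction r using Fin.addCases with
  | left a => rw [simple_emb_castAdd, split_castAdd, split_castAdd, act_simple_apply]
  | right b => rw [simple_emb_natAdd, split_natAdd, split_natAdd]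

theorem act_ext {k : ℕ} (v : Equiv.Perm (Fin m)) (μ : Fin m → ℕ) (γ : Fin k → ℕ) :
    act (ext k v) (split μ γ) = split (act v μ) γ := by
  ext r
  rw [act]
  induction r using Fin.addCases with
  | left a => rw [ext_symm_castAdd, split_castAdd, split_castAdd, act]
  | right b => rw [ext_symm_natAdd, split_natAdd, split_natAdd]

theorem split_injective {k : ℕ} (γ : Fin k → ℕ) :
    Function.Injective fun μ : Fin m → ℕ => split μ γ := by
  intro μ ν h
  ext a
  have := congrFun h (Fin.castAdd k a)
  simpa using this

theorem inv_ext {k : ℕ} (v : Equiv.Perm (Fin m)) : inv (ext k v) = inv v := by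
  rw [inv, inv, eq_comm]
  refine Finset.card_bij (fun p _ => (Fin.castAdd k p.1, Fin.castAdd k p.2)) ?_ ?_ ?_
  · intro p hp
    simpa only [Finset.mem_filter, Finset.mem_univ, true_and, ext_castAdd, Fin.lt_def,
      Fin.val_castAdd] using hp
  · intro p _ p' _ h
    simpa [Prod.ext_iff] using h
  · rintro ⟨a, b⟩ hp
    simp only [Finset.mem_filter, Finset.mem_univ, true_and] at hp
    obtain ⟨h1, h2⟩ := hp
    induction a using Fin.addCases with
    | left a =>
      induction b using Fin.addCases with
      | left b =>
        refine ⟨(a, b), ?_, rfl⟩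
        simpa only [Finset.mem_filter, Finset.mem_univ, true_and, ext_castAdd, Fin.lt_def,
          Fin.val_castAdd] using And.intro h1 h2
      | right b =>
        rw [ext_castAdd, ext_natAdd, Fin.lt_def, Fin.val_natAdd, Fin.val_castAdd] at h2
        omega
    | right a =>
      induction b using Fin.addCases with
      | left b =>
        rw [Fin.lt_def, Fin.val_natAdd, Fin.val_castAdd] at h1
        omega
      | right b =>
        rw [ext_natAdd, ext_natAdd] at h2
        exact absurd h1 h2.not_gt

theorem ext_one (k : ℕ) : ext k (1 : Equiv.Perm (Fin m)) = 1 := by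
  refine Equiv.ext fun r => ?_
  induction r using Fin.addCases with
  | left a => simp
  | right b => simp

theorem ext_symm_lt_iff {k : ℕ} {i : Fin (m - 1)} {v : Equiv.Perm (Fin m)} :
    (ext k v).symm (lo (emb k i)) < (ext k v).symm (hi (emb k i)) ↔
      v.symm (lo i) < v.symm (hi i) := by
  rw [lo_emb, hi_emb, ext_symm_castAdd, ext_symm_castAdd, Fin.lt_def, Fin.lt_def]
  rfl

/-- The image of the partial symmetrizer consists of eigenvectors of the `T_i` with eigenvalue
`t`. -/
theorem T_symmetrizer {k : ℕ} (i : Fin (m - 1)) (f : MvPolynomial (Fin (m + k)) K) :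
    T (emb k i) (symmetrizer m k f) = t • symmetrizer m k f := by
  rw [← sub_eq_zero, symmetrizer_apply, map_sum, Finset.smul_sum, ← Finset.sum_sub_distrib]
  -- the terms of `v` and `s_i v` in `(T_i - t) ∑ T_v` cancel
  have key : ∀ v : Equiv.Perm (Fin m), v.symm (lo i) < v.symm (hi i) →
      (T (emb k i) (Tw (ext k v) f) - t • Tw (ext k v) f) +
        (T (emb k i) (Tw (ext k (simple i * v)) f) - t • Tw (ext k (simple i * v)) f) = 0 := by
    intro v hv
    have h1 := T_Tw (ext_symm_lt_iff.mpr hv) f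
    have h2 := T_T (emb k i) (Tw (ext k v) f)
    rw [h1, simple_emb_mul_ext] at h2
    rw [h1, simple_emb_mul_ext, h2, sub_smul, one_smul]
    abel
  refine Finset.sum_involution (fun v _ => simple i * v) ?_ ?_ (fun _ _ => Finset.mem_univ _)
    (fun v _ => simple_mul_simple_mul i v)
  · intro v _
    rcases symm_lo_lt_or_gt i v with h | h
    · exact key v h
    · have := key (simple i * v)
        (by rw [symm_simple_mul, symm_simple_mul, simple_lo, simple_hi]; exact h)
      rw [simple_mul_simple_mul] at this
      exact (add_comm _ _).trans this
  · intro v _ _ h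
    have := mul_eq_right.mp h
    have h1 := DFunLike.congr_fun this (lo i)
    rw [simple_lo] at h1
    exact lo_ne_hi i h1.symm

/-! ### Rearrangements -/

theorem act_mul (v w : Equiv.Perm (Fin n)) (ν : Fin n → ℕ) : act (v * w) ν = act v (act w ν) := by
  ext r
  simp only [act]
  congr 1

theorem act_eq_iff {w : Equiv.Perm (Fin n)} {ν μ : Fin n → ℕ} :
    act w ν = μ ↔ ∀ r, μ (w r) = ν r := by
  constructor
  · rintro rfl r; simp [act]
  · intro h
    ext r
    rw [act, ← h, Equiv.apply_symm_apply]

theorem mem_orbit {ν μ : Fin n → ℕ} : μ ∈ orbit ν ↔ ∃ w, act w ν = μ := by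
  simp [orbit]

theorem act_mem_orbit {ν μ : Fin n → ℕ} (w : Equiv.Perm (Fin n)) (h : μ ∈ orbit ν) :
    act w μ ∈ orbit ν := by
  obtain ⟨v, rfl⟩ := mem_orbit.mp h
  exact mem_orbit.mpr ⟨w * v, act_mul _ _ _⟩

theorem increasing_monotone (ν : Fin n → ℕ) : Monotone (increasing ν) := Tuple.monotone_sort ν

theorem increasing_eq_of_mem_orbit {ν μ : Fin n → ℕ} (h : μ ∈ orbit ν) :
    increasing μ = increasing ν := by
  obtain ⟨w, rfl⟩ := mem_orbit.mp h
  exact Tuple.comp_perm_comp_sort_eq_comp_sort (σ := w.symm)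

theorem act_sort_increasing (ν : Fin n → ℕ) : act (Tuple.sort ν) (increasing ν) = ν :=
  act_eq_iff.mpr fun _ => rfl

theorem increasing_mem_orbit (ν : Fin n → ℕ) : increasing ν ∈ orbit ν :=
  mem_orbit.mpr ⟨(Tuple.sort ν).symm, by
    rw [act_eq_iff]; intro r; rw [increasing, Function.comp_apply, Equiv.apply_symm_apply]⟩

theorem eq_increasing {ν μ : Fin n → ℕ} (h : μ ∈ orbit ν) (hm : Monotone μ) :
    μ = increasing ν := by
  rw [← increasing_eq_of_mem_orbit h, increasing, Tuple.sort_eq_refl_iff_monotone.mpr hm]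
  rfl

theorem blockInv_eq_zero_iff {ν : Fin n → ℕ} {w : Equiv.Perm (Fin n)} :
    blockInv ν w = 0 ↔ ∀ a b, a < b → ν a = ν b → w a < w b := by
  rw [blockInv, Finset.card_eq_zero, Finset.filter_eq_empty_iff]
  constructor
  · intro h a b hab he
    have := h (Finset.mem_univ (a, b))
    simp only [hab, he, true_and, not_lt] at this
    exact lt_of_le_of_ne this fun h' => hab.ne (w.injective h')
  · rintro h p _ ⟨h1, h2, h3⟩
    exact h3.not_gt (h _ _ h1 h2)

/-- A rearrangement can be effected by a permutation that preserves the order of the positions of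
equal entries. -/
theorem exists_blockInv_eq_zero {ν μ : Fin n → ℕ} (h : μ ∈ orbit ν) :
    ∃ u, act u ν = μ ∧ blockInv ν u = 0 := by
  have hinc := increasing_eq_of_mem_orbit h
  refine ⟨Tuple.sort μ * (Tuple.sort ν).symm, ?_, ?_⟩
  · rw [act_mul]
    have : act (Tuple.sort ν).symm ν = increasing ν := by
      rw [act_eq_iff]; intro r; rw [increasing, Function.comp_apply, Equiv.apply_symm_apply]
    rw [this, ← hinc, act_sort_increasing]
  · rw [blockInv_eq_zero_iff]
    intro a b hab he
    have h1 := (Tuple.eq_sort_iff (f := ν) (σ := Tuple.sort ν)).mp rfl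
    have h2 := (Tuple.eq_sort_iff (f := μ) (σ := Tuple.sort μ)).mp rfl
    rw [Equiv.Perm.mul_apply, Equiv.Perm.mul_apply]
    apply h2.2
    · rcases lt_trichotomy ((Tuple.sort ν).symm a) ((Tuple.sort ν).symm b) with h3 | h3 | h3
      · exact h3
      · exact absurd ((Tuple.sort ν).symm.injective h3) hab.ne
      · have := h1.2 _ _ h3 (by simp [he])
        simp only [Equiv.apply_symm_apply] at this
        exact absurd this hab.not_gt
    · have h4 : ∀ r, μ (Tuple.sort μ r) = ν (Tuple.sort ν r) := fun r => congrFun hinc r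
      rw [h4, h4, Equiv.apply_symm_apply, Equiv.apply_symm_apply, he]

/-- The number of pairs of positions at which `μ` decreases. -/
def coinv (μ : Fin n → ℕ) : ℕ :=
  (Finset.univ.filter fun p : Fin n × Fin n => p.1 < p.2 ∧ μ p.2 < μ p.1).card

/-- An inversion of `w` lies either between unequal entries of the increasing `ν`, where it becomes
a decrease of `w ν`, or between equal ones. -/
theorem inv_eq_coinv_add {ν μ : Fin n → ℕ} (hν : Monotone ν) {w : Equiv.Perm (Fin n)}
    (h : act w ν = μ) : inv w = coinv μ + blockInv ν w := by
  rw [act_eq_iff] at h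
  have hs : (Finset.univ.filter fun p : Fin n × Fin n => p.1 < p.2 ∧ w p.2 < w p.1) =
      (Finset.univ.filter fun p : Fin n × Fin n => ν p.1 < ν p.2 ∧ w p.2 < w p.1) ∪
      (Finset.univ.filter fun p : Fin n × Fin n => p.1 < p.2 ∧ ν p.1 = ν p.2 ∧ w p.2 < w p.1) := by
    ext p
    simp only [Finset.mem_filter, Finset.mem_univ, true_and, Finset.mem_union]
    constructor
    · rintro ⟨h1, h2⟩
      rcases (hν h1.le).lt_or_eq with h3 | h3
      · exact Or.inl ⟨h3, h2⟩
      · exact Or.inr ⟨h1, h3, h2⟩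
    · rintro (⟨h1, h2⟩ | ⟨h1, _, h2⟩)
      · exact ⟨hν.reflect_lt h1, h2⟩
      · exact ⟨h1, h2⟩
  rw [inv, hs, Finset.card_union_of_disjoint, blockInv]
  · congr 1
    rw [coinv]
    refine Finset.card_equiv ((Equiv.prodComm _ _).trans (Equiv.prodCongr w w)) fun p => ?_
    simp only [Finset.mem_filter, Finset.mem_univ, true_and, Equiv.trans_apply,
      Equiv.prodComm_apply, Equiv.prodCongr_apply, Prod.map_fst, Prod.map_snd, Prod.fst_swap,
      Prod.snd_swap, h]
    exact and_comm
  · rw [Finset.disjoint_filter]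
    rintro p _ ⟨h1, _⟩ ⟨_, h2, _⟩
    exact h1.ne h2

theorem blockInv_sort (μ : Fin n → ℕ) : blockInv (increasing μ) (Tuple.sort μ) = 0 :=
  blockInv_eq_zero_iff.mpr ((Tuple.eq_sort_iff (f := μ) (σ := Tuple.sort μ)).mp rfl).2

theorem inv_sort (μ : Fin n → ℕ) : inv (Tuple.sort μ) = coinv μ := by
  rw [inv_eq_coinv_add (increasing_monotone μ) (act_sort_increasing μ), blockInv_sort, add_zero]

/-- The minimal length element that sends the increasing rearrangement of `μ` to `μ` is the one
that sorts `μ` stably. -/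
theorem isMinimalTransport_iff {k : ℕ} {lam μ : Fin m → ℕ} (hμ : μ ∈ orbit lam)
    {w : Equiv.Perm (Fin (m + k))} :
    IsMinimalTransport k (increasing lam) μ w ↔ w = ext k (Tuple.sort μ) := by
  rw [← increasing_eq_of_mem_orbit hμ]
  have hact : ∀ v : Equiv.Perm (Fin m), act (ext k v) (split (increasing μ) (0 : Fin k → ℕ)) =
      split μ 0 ↔ act v (increasing μ) = μ := by
    intro v
    rw [act_ext]
    exact (split_injective _).eq_iff
  constructor
  · rintro ⟨⟨hp, ha⟩, hmin⟩
    obtain ⟨v, rfl⟩ := mem_parabolic_iff.mp hp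
    rw [hact] at ha
    have h1 := hmin (ext k (Tuple.sort μ)) (mem_parabolic_iff.mpr ⟨_, rfl⟩)
      ((hact _).mpr (act_sort_increasing μ))
    rw [length_eq_inv, length_eq_inv, inv_ext, inv_ext, inv_sort,
      inv_eq_coinv_add (increasing_monotone μ) ha] at h1
    have h2 := blockInv_eq_zero_iff.mp (by omega : blockInv (increasing μ) v = 0)
    rw [act_eq_iff] at ha
    have h3 : μ ∘ v = increasing μ := funext ha
    congr 1
    rw [Tuple.eq_sort_iff, h3]
    exact ⟨increasing_monotone μ, fun i j hij he => h2 i j hij (by rw [← ha, ← ha, he])⟩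
  · rintro rfl
    refine ⟨⟨mem_parabolic_iff.mpr ⟨_, rfl⟩, (hact _).mpr (act_sort_increasing μ)⟩, ?_⟩
    intro v hv ha
    obtain ⟨v, rfl⟩ := mem_parabolic_iff.mp hv
    rw [hact] at ha
    rw [length_eq_inv, length_eq_inv, inv_ext, inv_ext, inv_sort,
      inv_eq_coinv_add (increasing_monotone μ) ha]
    omega

theorem poincare_eq (k : ℕ) (lam : Fin m → ℕ) : poincare k lam =
    ∑ v : Equiv.Perm (Fin m), if act v lam = lam then t ^ inv v else 0 := by
  classical
  rw [poincare, Finset.sum_filter, sum_parabolic]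
  refine Finset.sum_congr rfl fun v _ => ?_
  rw [act_ext, length_eq_inv, inv_ext]
  by_cases h : act v lam = lam
  · rw [if_pos h, if_pos (congrArg (fun μ => split μ (0 : Fin k → ℕ)) h)]
  · rw [if_neg h, if_neg fun h' => h (split_injective (0 : Fin k → ℕ) h')]

/-- For a partition `λ`, the permutations that carry `λ` to a given rearrangement are
distributed, with respect to the inversions between equal entries, like the elements of the
stabilizer with respect to their length. -/
theorem sum_blockInv {lam μ : Fin m → ℕ} (hlam : Antitone lam) (hμ : μ ∈ orbit lam) (k : ℕ) :
    ∑ v : Equiv.Perm (Fin m), (if act v lam = μ then t ^ blockInv lam v else 0) =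
      poincare k lam := by
  obtain ⟨u, hu, hu0⟩ := exists_blockInv_eq_zero hμ
  rw [poincare_eq, ← Equiv.sum_comp (Equiv.mulLeft u)]
  refine Finset.sum_congr rfl fun v _ => ?_
  rw [Equiv.coe_mulLeft, act_mul]
  have hiff : act u (act v lam) = μ ↔ act v lam = lam := by
    rw [← hu]
    constructor
    · intro h
      ext r
      simpa [act] using congrFun h (u r)
    · intro h; rw [h]
  by_cases h : act v lam = lam
  · rw [if_pos (hiff.mpr h), if_pos h]
    congr 1
    rw [act_eq_iff] at h
    rw [blockInv_eq_zero_iff] at hu0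
    rw [blockInv, inv]
    refine congrArg Finset.card (Finset.ext fun p => ?_)
    rw [Finset.mem_filter, Finset.mem_filter]
    simp only [Finset.mem_univ, true_and, Equiv.Perm.mul_apply]
    constructor
    · rintro ⟨h1, h2, h3⟩
      refine ⟨h1, ?_⟩
      by_contra! h4
      have h5 : v p.1 < v p.2 := lt_of_le_of_ne h4 fun h' => h1.ne (v.injective h')
      exact h3.not_gt (hu0 _ _ h5 (by rw [h, h, h2]))
    · rintro ⟨h1, h2⟩
      have h3 : lam p.1 = lam p.2 := by
        apply le_antisymm
        · have := hlam h2.le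
          rwa [h, h] at this
        · exact hlam h1.le
      exact ⟨h1, h3, hu0 _ _ h2 (by rw [h, h, h3])⟩
  · rw [if_neg h, if_neg fun h' => h (hiff.mp h')]

/-! ### Arms, coarms and the product over the boxes -/

theorem arm_eq_sum (ν : Fin n → ℕ) (b : Fin n) (j : ℕ) : arm ν ⟨b, j⟩ =
    ∑ x, ((if x < b ∧ j ≤ ν x ∧ ν x ≤ ν b then 1 else 0) +
      (if b < x ∧ j ≤ ν x + 1 ∧ ν x < ν b then 1 else 0)) := by
  rw [arm, Finset.card_filter, Finset.card_filter, Finset.sum_add_distrib]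

theorem coarm_eq_sum (ν : Fin n → ℕ) (b : Fin n) : coarm ν b =
    ∑ x, ((if x < b ∧ ν b < ν x then 1 else 0) + (if b < x ∧ ν b ≤ ν x then 1 else 0)) := by
  rw [coarm, Finset.card_filter, Finset.card_filter, Finset.sum_add_distrib]

/-- The arm of the box `(i, ν_{i+1} + 1)` is the difference of two coarms. -/
theorem arm_add_coarm {i : Fin (n - 1)} {ν : Fin n → ℕ} (h : ν (hi i) < ν (lo i)) :
    arm ν ⟨lo i, ν (hi i) + 1⟩ + coarm ν (lo i) = coarm ν (hi i) := by
  rw [arm_eq_sum, coarm_eq_sum, coarm_eq_sum, ← Finset.sum_add_distrib,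
    ← Equiv.sum_comp (simple i) (fun x => (if x < hi i ∧ ν (hi i) < ν x then 1 else 0) +
      (if hi i < x ∧ ν (hi i) ≤ ν x then 1 else 0))]
  refine Finset.sum_congr rfl fun x _ => ?_
  have hlo : (lo i).val = i.val := rfl
  have hhi : (hi i).val = i.val + 1 := rfl
  by_cases h1 : x = lo i
  · subst h1
    rw [simple_lo]
    simp
  by_cases h2 : x = hi i
  · subst h2
    rw [simple_hi]
    simp [lo_lt_hi, (lo_lt_hi i).not_gt, h, h.not_ge]
  rw [simple_of_ne h1 h2]
  rw [Fin.ext_iff] at h1 h2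
  simp only [Fin.lt_def]
  split_ifs <;> omega

/-- The weight of the box `(i, ν_{i+1} + 1)` is a quotient of two eigenvalues. -/
theorem spec_mul_boxWeight {i : Fin (n - 1)} {ν : Fin n → ℕ} (h : ν (hi i) < ν (lo i)) :
    spec ν (lo i) * boxWeight ν ⟨lo i, ν (hi i) + 1⟩ = spec ν (hi i) := by
  have h1 : leg ν ⟨lo i, ν (hi i) + 1⟩ + 1 + ν (hi i) = ν (lo i) := by
    rw [leg]; simp only; omega
  rw [spec, spec, boxWeight, ← arm_add_coarm h]
  have h2 : q ^ ν (lo i) ≠ 0 := pow_ne_zero _ q_ne_zero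
  have h3 : q ^ ν (hi i) ≠ 0 := pow_ne_zero _ q_ne_zero
  have h4 : q ^ ν (lo i) = q ^ (leg ν ⟨lo i, ν (hi i) + 1⟩ + 1) * q ^ ν (hi i) := by
    rw [← pow_add, h1]
  field_simp
  rw [h4, pow_add]
  ring

theorem boxWeight_ne_one (ν : Fin n → ℕ) (b : Σ _ : Fin n, ℕ) : 1 - boxWeight ν b ≠ 0 := by
  intro h
  rw [sub_eq_zero, boxWeight] at h
  have := (q_pow_mul_t_pow_inj (a := 0) (b := 0) (c := leg ν b + 1) (d := arm ν b)
    (by simpa using h)).1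
  omega

theorem boxProd_ne_zero (ν : Fin n → ℕ) : boxProd ν ≠ 0 :=
  Finset.prod_ne_zero_iff.mpr fun b _ => boxWeight_ne_one ν b

/-- The factor of the one-step recursion, as the intertwiner constant of `E_ν`. -/
theorem one_sub_corr {i : Fin (n - 1)} {ν : Fin n → ℕ} (h : ν (hi i) < ν (lo i)) :
    1 - corr i ν = (t - boxWeight ν ⟨lo i, ν (hi i) + 1⟩) /
      (1 - boxWeight ν ⟨lo i, ν (hi i) + 1⟩) := by
  have h1 := boxWeight_ne_one ν ⟨lo i, ν (hi i) + 1⟩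
  have h2 := spec_ne_zero ν (lo i)
  have h3 := corr_mul i ν
  rw [← spec_mul_boxWeight h] at h3
  rw [eq_div_iff h1]
  apply mul_left_cancel₀ h2
  linear_combination -h3

/-- Exchanging the entries `ν_i > ν_{i+1}` changes the arm of one box only. -/
theorem arm_simple {i : Fin (n - 1)} {ν : Fin n → ℕ} (h : ν (hi i) < ν (lo i)) (r : Fin n)
    (j : ℕ) : arm ν ⟨simple i r, j⟩ = arm (act (simple i) ν) ⟨r, j⟩ +
      if r = hi i ∧ j = ν (hi i) + 1 then 1 else 0 := by
  have hsum : (if r = hi i ∧ j = ν (hi i) + 1 then 1 else 0) =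
      ∑ x, if x = lo i then (if r = hi i ∧ j = ν (hi i) + 1 then 1 else 0) else 0 := by
    rw [Finset.sum_ite_eq']; simp
  rw [hsum, arm_eq_sum, arm_eq_sum, ← Finset.sum_add_distrib,
    ← Equiv.sum_comp (simple i) (fun x =>
      (if x < simple i r ∧ j ≤ ν x ∧ ν x ≤ ν (simple i r) then 1 else 0) +
      (if simple i r < x ∧ j ≤ ν x + 1 ∧ ν x < ν (simple i r) then 1 else 0))]
  refine Finset.sum_congr rfl fun x _ => ?_
  simp only [act_simple_apply]
  by_cases h1 : x = lo i ∧ r = hi i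
  · obtain ⟨rfl, rfl⟩ := h1
    simp only [simple_lo, simple_hi, lo_lt_hi, (lo_lt_hi i).not_gt, if_true, true_and, false_and,
      if_false]
    split_ifs <;> omega
  by_cases h2 : x = hi i ∧ r = lo i
  · obtain ⟨rfl, rfl⟩ := h2
    simp only [simple_lo, simple_hi, lo_lt_hi, (lo_lt_hi i).not_gt, true_and, false_and,
      if_false, (lo_ne_hi i).symm]
    split_ifs <;> omega
  simp only [simple_lt_simple_iff h1 h2,
    simple_lt_simple_iff (show ¬(r = lo i ∧ x = hi i) by tauto) (by tauto)]
  have h3 : (if x = lo i then (if r = hi i ∧ j = ν (hi i) + 1 then 1 else 0) else 0) = 0 := by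
    split_ifs <;> tauto
  rw [h3, add_zero]

theorem boxWeight_simple {i : Fin (n - 1)} {ν : Fin n → ℕ} (h : ν (hi i) < ν (lo i)) (r : Fin n)
    (j : ℕ) : boxWeight ν ⟨simple i r, j⟩ = boxWeight (act (simple i) ν) ⟨r, j⟩ *
      if r = hi i ∧ j = ν (hi i) + 1 then t else 1 := by
  rw [boxWeight, boxWeight, arm_simple h, leg, leg, act_simple_apply]
  split_ifs
  · ring
  · rw [add_zero, mul_one]

/-- The effect of an exchange `ν_i > ν_{i+1}` on the product over all boxes. -/
theorem boxProd_simple {i : Fin (n - 1)} {ν : Fin n → ℕ} (h : ν (hi i) < ν (lo i)) :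
    boxProd ν * (t - boxWeight ν ⟨lo i, ν (hi i) + 1⟩) =
      t * boxProd (act (simple i) ν) * (1 - boxWeight ν ⟨lo i, ν (hi i) + 1⟩) := by
  set μ := act (simple i) ν with hμ
  have hrow : ∀ κ : Fin n → ℕ, boxProd κ =
      ∏ r, ∏ j ∈ Finset.Icc 1 (κ r), (1 - boxWeight κ ⟨r, j⟩) := by
    intro κ
    rw [boxProd, dg, Finset.prod_sigma]
  have e1 : boxProd ν = ∏ r, ∏ j ∈ Finset.Icc 1 (μ r), (1 - boxWeight ν ⟨simple i r, j⟩) := by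
    rw [hrow, ← Equiv.prod_comp (simple i)]
    simp only [hμ, act_simple_apply]
  have e2 : ∀ r ∈ Finset.univ.erase (hi i),
      ∏ j ∈ Finset.Icc 1 (μ r), (1 - boxWeight ν ⟨simple i r, j⟩) =
        ∏ j ∈ Finset.Icc 1 (μ r), (1 - boxWeight μ ⟨r, j⟩) := by
    intro r hr
    refine Finset.prod_congr rfl fun j _ => ?_
    rw [boxWeight_simple h, if_neg fun h' => (Finset.ne_of_mem_erase hr) h'.1, mul_one]
  have hmem : ν (hi i) + 1 ∈ Finset.Icc 1 (μ (hi i)) := by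
    rw [Finset.mem_Icc, hμ, act_simple_apply, simple_hi]
    omega
  have e3 : ∀ j ∈ (Finset.Icc 1 (μ (hi i))).erase (ν (hi i) + 1),
      (1 - boxWeight ν ⟨simple i (hi i), j⟩) = (1 - boxWeight μ ⟨hi i, j⟩) := by
    intro j hj
    rw [boxWeight_simple h, if_neg fun h' => (Finset.ne_of_mem_erase hj) h'.2, mul_one]
  have e4 : boxWeight ν ⟨lo i, ν (hi i) + 1⟩ = boxWeight μ ⟨hi i, ν (hi i) + 1⟩ * t := by
    have := boxWeight_simple h (hi i) (ν (hi i) + 1)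
    rwa [if_pos ⟨rfl, rfl⟩, simple_hi] at this
  rw [e1, hrow μ, ← Finset.mul_prod_erase _ _ (Finset.mem_univ (hi i)),
    ← Finset.mul_prod_erase _ (fun r => ∏ j ∈ Finset.Icc 1 (μ r), (1 - boxWeight μ ⟨r, j⟩))
      (Finset.mem_univ (hi i)), Finset.prod_congr rfl e2,
    ← Finset.mul_prod_erase _ _ hmem, ← Finset.mul_prod_erase _
      (fun j => 1 - boxWeight μ ⟨hi i, j⟩) hmem, Finset.prod_congr rfl e3, simple_hi, e4]
  ring

/-! ### Coefficients of eigenvectors of `T_i` -/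

/-- The coefficient of `T_i f` at `E_{s_i ν}` for `ν_i > ν_{i+1}`. -/
theorem coeE_T {i : Fin (n - 1)} {ν : Fin n → ℕ} (h : ν (hi i) < ν (lo i))
    (f : MvPolynomial (Fin n) K) : coeE (act (simple i) ν) (T i f) =
      (t - 1 + corr i ν) * coeE (act (simple i) ν) f + coeE ν f := by
  have key : (coeE (act (simple i) ν)).comp (T i) =
      (t - 1 + corr i ν) • coeE (act (simple i) ν) + coeE ν := by
    refine (macBasis n).ext fun σ => ?_
    simp only [macBasis_apply, LinearMap.comp_apply, LinearMap.add_apply, LinearMap.smul_apply,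
      smul_eq_mul]
    have hs : act (simple i) σ = act (simple i) ν ↔ σ = ν :=
      ⟨fun e => by simpa using congrArg (act (simple i)) e, fun e => e ▸ rfl⟩
    have hs' : act (simple i) σ = ν ↔ σ = act (simple i) ν :=
      ⟨fun e => by rw [← e, act_simple_act_simple], fun e => by rw [e, act_simple_act_simple]⟩
    rcases lt_trichotomy (σ (lo i)) (σ (hi i)) with hσ | hσ | hσ
    · have h1 : σ ≠ ν := by rintro rfl; exact hσ.not_gt h
      rw [T_E_of_lt hσ, map_add, map_smul, map_smul]
      simp only [coeE_E, smul_eq_mul, if_neg h1, if_neg fun e => h1 (hs.mp e)]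
      by_cases h2 : σ = act (simple i) ν
      · rw [if_pos h2, h2, act_simple_act_simple]; ring
      · rw [if_neg h2]; ring
    · have h1 : σ ≠ ν := by rintro rfl; exact h.ne hσ.symm
      have h2 : σ ≠ act (simple i) ν := by
        rintro rfl
        simp only [act_simple_apply, simple_lo, simple_hi] at hσ
        exact h.ne hσ
      rw [T_E_of_eq hσ, map_smul]
      simp only [coeE_E, if_neg h1, if_neg h2, smul_eq_mul]
      ring
    · have h2 : σ ≠ act (simple i) ν := by
        rintro rfl
        simp only [act_simple_apply, simple_lo, simple_hi] at hσ
        exact hσ.not_gt h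
      rw [T_E_of_gt hσ, map_sub, map_smul]
      simp only [coeE_E, if_neg h2, smul_eq_mul]
      by_cases h1 : σ = ν
      · rw [if_pos h1, if_pos (hs.mpr h1)]; ring
      · rw [if_neg h1, if_neg fun e => h1 (hs.mp e)]; ring
  exact DFunLike.congr_fun key f

/-- An eigenvector of `T_i` with eigenvalue `t` has proportional coefficients at `E_ν` and
`E_{s_i ν}`. -/
theorem coeE_of_T_eq {i : Fin (n - 1)} {ν : Fin n → ℕ} (h : ν (hi i) < ν (lo i))
    {f : MvPolynomial (Fin n) K} (hf : T i f = t • f) :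
    coeE ν f = coeE (act (simple i) ν) f *
      ((t - boxWeight ν ⟨lo i, ν (hi i) + 1⟩) / (1 - boxWeight ν ⟨lo i, ν (hi i) + 1⟩)) := by
  have e := coeE_T h f
  rw [hf, map_smul, smul_eq_mul] at e
  rw [← one_sub_corr h]
  linear_combination -e

/-! ### The expansion of the symmetrized polynomial -/

variable {m k : ℕ}

/-- The span of the `E_{(μ|γ)}` with `μ` in the orbit of `λ` and `(μ|γ)` in `S`. -/
def orbitSpan (lam : Fin m → ℕ) (γ : Fin k → ℕ) (S : Set (Fin (m + k) → ℕ)) :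
    Submodule K (MvPolynomial (Fin (m + k)) K) :=
  Submodule.span K {f | ∃ μ ∈ orbit lam, split μ γ ∈ S ∧ f = E (split μ γ)}

theorem E_mem_orbitSpan {lam μ : Fin m → ℕ} {γ : Fin k → ℕ} {S : Set (Fin (m + k) → ℕ)}
    (h1 : μ ∈ orbit lam) (h2 : split μ γ ∈ S) : E (split μ γ) ∈ orbitSpan lam γ S :=
  Submodule.subset_span ⟨μ, h1, h2, rfl⟩

theorem coeE_eq_zero_of_mem {lam : Fin m → ℕ} {γ : Fin k → ℕ} {S : Set (Fin (m + k) → ℕ)}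
    {f : MvPolynomial (Fin (m + k)) K} (hf : f ∈ orbitSpan lam γ S) {κ : Fin (m + k) → ℕ}
    (hκ : ∀ μ ∈ orbit lam, split μ γ ∈ S → split μ γ ≠ κ) : coeE κ f = 0 := by
  have : orbitSpan lam γ S ≤ LinearMap.ker (coeE κ) := by
    rw [orbitSpan, Submodule.span_le]
    rintro _ ⟨μ, h1, h2, rfl⟩
    rw [SetLike.mem_coe, LinearMap.mem_ker, coeE_E, if_neg (hκ μ h1 h2)]
  exact this hf

theorem split_lo {μ : Fin m → ℕ} {γ : Fin k → ℕ} (i : Fin (m - 1)) :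
    split μ γ (lo (emb k i)) = μ (lo i) := by rw [lo_emb, split_castAdd]

theorem split_hi {μ : Fin m → ℕ} {γ : Fin k → ℕ} (i : Fin (m - 1)) :
    split μ γ (hi (emb k i)) = μ (hi i) := by rw [hi_emb, split_castAdd]

/-- `T_i` maps the span of the `E_κ` with `κ < ν` to that of the `E_κ` with `κ < s_i ν`, if
`ν_i ≥ ν_{i+1}`. -/
theorem T_mem_orbitSpan {lam ν : Fin m → ℕ} {γ : Fin k → ℕ} {i : Fin (m - 1)}
    (h : ν (hi i) ≤ ν (lo i)) {f : MvPolynomial (Fin (m + k)) K}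
    (hf : f ∈ orbitSpan lam γ {κ | BruhatLT κ (split ν γ)}) :
    T (emb k i) f ∈ orbitSpan lam γ {κ | BruhatLT κ (split (act (simple i) ν) γ)} := by
  have htop : top (emb k i) (split ν γ) = split (act (simple i) ν) γ := by
    rw [top_of_ge (by rw [split_lo, split_hi]; exact h), act_simple_emb]
  suffices H : orbitSpan lam γ {κ | BruhatLT κ (split ν γ)} ≤
      (orbitSpan lam γ {κ | BruhatLT κ (split (act (simple i) ν) γ)}).comap (T (emb k i)) from H hf
  conv_lhs => rw [orbitSpan]
  rw [Submodule.span_le]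
  rintro _ ⟨μ, h1, h2, rfl⟩
  rw [Set.mem_ofPred_eq] at h2
  have m1 : E (split μ γ) ∈
      orbitSpan lam γ {κ | BruhatLT κ (split (act (simple i) ν) γ)} := by
    refine E_mem_orbitSpan h1 ?_
    rcases le_top (emb k i) (split ν γ) with e | e
    · rw [htop] at e; rw [← e]; exact h2
    · rw [htop] at e; exact h2.trans e
  have m2 : E (act (simple (emb k i)) (split μ γ)) ∈
      orbitSpan lam γ {κ | BruhatLT κ (split (act (simple i) ν) γ)} := by
    rw [act_simple_emb]
    refine E_mem_orbitSpan (act_mem_orbit _ h1) ?_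
    have h3 := (act_simple_le_top (emb k i) (split μ γ)).trans (BruhatLE.top_le h2.le)
    rw [act_simple_emb, htop] at h3
    rcases h3 with h3 | h3
    · have h4 := congrArg (act (simple (emb k i))) h3
      rw [act_simple_emb, act_simple_emb, act_simple_act_simple, act_simple_act_simple] at h4
      rw [h4] at h2
      exact (bruhatLT_irrefl _ h2).elim
    · exact h3
  change T (emb k i) (E (split μ γ)) ∈
    orbitSpan lam γ {κ | BruhatLT κ (split (act (simple i) ν) γ)}
  rcases lt_trichotomy (split μ γ (lo (emb k i))) (split μ γ (hi (emb k i))) with hσ | hσ | hσ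
  · rw [T_E_of_lt hσ]
    exact Submodule.add_mem _ (Submodule.smul_mem _ _ m1) (Submodule.smul_mem _ _ m2)
  · rw [T_E_of_eq hσ]
    exact Submodule.smul_mem _ _ m1
  · rw [T_E_of_gt hσ]
    exact Submodule.sub_mem _ m2 (Submodule.smul_mem _ _ m1)

/-- `T_v E_{(λ|γ)}` has leading term a power of `t` times `E_{(vλ|γ)}`. -/
theorem Tw_E_mem {lam : Fin m → ℕ} (hlam : Antitone lam) (γ : Fin k → ℕ)
    (v : Equiv.Perm (Fin m)) :
    Tw (ext k v) (E (split lam γ)) - t ^ blockInv lam v • E (split (act v lam) γ) ∈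
      orbitSpan lam γ {κ | BruhatLT κ (split (act v lam) γ)} := by
  induction hN : inv v using Nat.strong_induction_on generalizing v with
  | _ N ih =>
  by_cases hv : v = 1
  · subst hv
    have h1 : blockInv lam 1 = 0 := blockInv_eq_zero_iff.mpr fun _ _ h _ => h
    have h2 : act 1 lam = lam := rfl
    rw [ext_one, Tw_one, h1, h2, pow_zero, one_smul, sub_self]
    exact Submodule.zero_mem _
  obtain ⟨i, hi'⟩ := exists_descent hv
  have hinv := inv_simple_mul_of_gt hi'
  obtain ⟨w, rfl⟩ : ∃ w, v = simple i * w := ⟨simple i * v, (simple_mul_simple_mul i v).symm⟩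
  rw [simple_mul_simple_mul] at hinv
  rw [symm_simple_mul, symm_simple_mul, simple_lo, simple_hi] at hi'
  have hle : act w lam (hi i) ≤ act w lam (lo i) := hlam hi'.le
  have IH := T_mem_orbitSpan hle (ih _ (by omega) w rfl)
  rw [map_sub, map_smul, T_Tw (ext_symm_lt_iff.mpr hi'), simple_emb_mul_ext, ← act_mul] at IH
  rw [blockInv_simple_mul lam hi']
  have hmem : act w lam ∈ orbit lam := mem_orbit.mpr ⟨w, rfl⟩
  have hE : T (emb k i) (E (split (act w lam) γ)) -
      (t ^ (if lam (w.symm (lo i)) = lam (w.symm (hi i)) then 1 else 0)) •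
        E (split (act (simple i * w) lam) γ) ∈
      orbitSpan lam γ {κ | BruhatLT κ (split (act (simple i * w) lam) γ)} := by
    rw [act_mul]
    rcases hle.lt_or_eq with h | h
    · have h' : split (act w lam) γ (hi (emb k i)) < split (act w lam) γ (lo (emb k i)) := by
        rw [split_lo, split_hi]; exact h
      rw [if_neg (fun e => h.ne e.symm), pow_zero, one_smul, T_E_of_gt h', act_simple_emb,
        sub_sub_cancel_left]
      refine Submodule.neg_mem _ (Submodule.smul_mem _ _ (E_mem_orbitSpan hmem ?_))
      have := lt_act_simple h'
      rwa [act_simple_emb] at this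
    · have h' : split (act w lam) γ (lo (emb k i)) = split (act w lam) γ (hi (emb k i)) := by
        rw [split_lo, split_hi]; exact h.symm
      rw [if_pos (show lam _ = lam _ from h.symm), pow_one, T_E_of_eq h', act_simple_eq h.symm,
        sub_self]
      exact Submodule.zero_mem _
  have := Submodule.add_mem _ IH (Submodule.smul_mem _ (t ^ blockInv lam w) hE)
  rwa [smul_sub, smul_smul, ← pow_add, sub_add_sub_cancel] at this

/-- The increasing rearrangement is the largest in its orbit. -/
theorem not_increasing_lt {lam μ : Fin m → ℕ} (γ : Fin k → ℕ) (hμ : μ ∈ orbit lam) :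
    ¬ BruhatLT (split (increasing lam) γ) (split μ γ) := by
  intro h
  -- the sums of squares agree, and `∑ r ν_r` is maximal for increasing entries
  have hr := rank_lt h
  rw [← increasing_eq_of_mem_orbit hμ] at hr
  have hval : ∀ r, increasing μ r = μ (Tuple.sort μ r) := fun r => rfl
  rw [rank, rank, Prod.Lex.toLex_lt_toLex] at hr
  simp only [Fin.sum_univ_add, split_castAdd, split_natAdd] at hr
  have h1 : ∑ a, increasing μ a ^ 2 = ∑ a, μ a ^ 2 :=
    Equiv.sum_comp (Tuple.sort μ) fun a => μ a ^ 2
  have h2 : ∑ a : Fin m, a.val * μ a ≤ ∑ a : Fin m, a.val * increasing μ a := by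
    have hmono : Monovary (fun a : Fin m => a.val) (increasing μ) :=
      Monotone.monovary (fun a b hab => hab) (increasing_monotone μ)
    have := hmono.sum_mul_comp_perm_le_sum_mul (σ := (Tuple.sort μ).symm)
    refine le_trans (le_of_eq ?_) this
    refine Finset.sum_congr rfl fun a _ => ?_
    rw [hval, Equiv.apply_symm_apply]
  simp only [Fin.val_castAdd] at hr
  omega

theorem poincare_ne_zero (k : ℕ) (lam : Fin m → ℕ) : poincare k lam ≠ 0 := by
  intro h
  rw [poincare_eq] at h
  have h1 : algebraMap (MvPolynomial (Fin 2) ℚ) K (∑ v : Equiv.Perm (Fin m),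
      if act v lam = lam then X 1 ^ inv v else 0) = 0 := by
    rw [map_sum, ← h]
    refine Finset.sum_congr rfl fun v _ => ?_
    split_ifs
    · rw [map_pow, t]
    · rw [map_zero]
  rw [FaithfulSMul.algebraMap_eq_zero_iff] at h1
  -- at `t = 1` the sum counts the stabilizer
  have h2 := congrArg (eval fun _ => (1 : ℚ)) h1
  rw [map_sum, map_zero, Finset.sum_eq_zero_iff_of_nonneg] at h2
  · have := h2 1 (Finset.mem_univ _)
    rw [if_pos (show act 1 lam = lam from rfl)] at this
    simp at this
  · intro v _
    split_ifs <;> simp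

/-- Only the `v` that carry `λ` to its increasing rearrangement contribute to the coefficient
there, since that rearrangement lies below no other one. -/
theorem coeE_Tw_E {lam : Fin m → ℕ} (hlam : Antitone lam) (γ : Fin k → ℕ)
    (v : Equiv.Perm (Fin m)) :
    coeE (split (increasing lam) γ) (Tw (ext k v) (E (split lam γ))) =
      if act v lam = increasing lam then t ^ blockInv lam v else 0 := by
  have hmem : act v lam ∈ orbit lam := mem_orbit.mpr ⟨v, rfl⟩
  have h := coeE_eq_zero_of_mem (Tw_E_mem hlam γ v) (κ := split (increasing lam) γ)
    fun μ _ h2 e => not_increasing_lt γ hmem (e ▸ h2)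
  rw [map_sub, map_smul, coeE_E, sub_eq_zero] at h
  rw [h, smul_eq_mul]
  by_cases h' : act v lam = increasing lam
  · rw [if_pos h', if_pos (by rw [h']), mul_one]
  · rw [if_neg h', if_neg (fun e => h' (split_injective γ e)), mul_zero]

theorem coeE_P_increasing {lam : Fin m → ℕ} (hlam : Antitone lam) (γ : Fin k → ℕ) :
    coeE (split (increasing lam) γ) (P lam γ) = 1 := by
  rw [P, map_smul, symmetrizer_apply, map_sum, Finset.sum_congr rfl fun v _ => coeE_Tw_E hlam γ v,
    sum_blockInv hlam (increasing_mem_orbit lam) k, smul_eq_mul,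
    inv_mul_cancel₀ (poincare_ne_zero k lam)]

theorem P_mem_orbitSpan {lam : Fin m → ℕ} (hlam : Antitone lam) (γ : Fin k → ℕ) :
    P lam γ ∈ orbitSpan lam γ Set.univ := by
  rw [P, symmetrizer_apply]
  refine Submodule.smul_mem _ _ (Submodule.sum_mem _ fun v _ => ?_)
  have h1 : Tw (ext k v) (E (split lam γ)) - t ^ blockInv lam v • E (split (act v lam) γ) ∈
      orbitSpan lam γ Set.univ := by
    refine Submodule.span_mono ?_ (Tw_E_mem hlam γ v)
    rintro _ ⟨μ, h1, _, rfl⟩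
    exact ⟨μ, h1, Set.mem_univ _, rfl⟩
  have h2 : t ^ blockInv lam v • E (split (act v lam) γ) ∈ orbitSpan lam γ Set.univ :=
    Submodule.smul_mem _ _ (E_mem_orbitSpan (mem_orbit.mpr ⟨v, rfl⟩) (Set.mem_univ _))
  have := Submodule.add_mem _ h1 h2
  rwa [sub_add_cancel] at this

theorem coeE_P_eq_zero {lam : Fin m → ℕ} (hlam : Antitone lam) (γ : Fin k → ℕ)
    {κ : Fin (m + k) → ℕ} (hκ : ∀ μ ∈ orbit lam, κ ≠ split μ γ) : coeE κ (P lam γ) = 0 :=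
  coeE_eq_zero_of_mem (P_mem_orbitSpan hlam γ) fun μ h1 _ h2 => hκ μ h1 h2.symm

theorem P_eq_sum {lam : Fin m → ℕ} (hlam : Antitone lam) (γ : Fin k → ℕ) :
    P lam γ = ∑ μ ∈ orbit lam, coeE (split μ γ) (P lam γ) • E (split μ γ) := by
  refine ext_coeE fun κ => ?_
  rw [map_sum]
  by_cases hκ : ∃ μ ∈ orbit lam, κ = split μ γ
  · obtain ⟨μ, hμ, rfl⟩ := hκ
    rw [Finset.sum_eq_single μ]
    · rw [map_smul, coeE_E, if_pos rfl, smul_eq_mul, mul_one]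
    · intro ν _ hν
      rw [map_smul, coeE_E, if_neg (fun e => hν (split_injective γ e)), smul_zero]
    · exact fun h => absurd hμ h
  · push Not at hκ
    rw [coeE_P_eq_zero hlam γ hκ, Finset.sum_eq_zero]
    intro μ hμ
    rw [map_smul, coeE_E, if_neg (hκ μ hμ).symm, smul_zero]

theorem coeE_sum (c : (Fin n → ℕ) →₀ K) (κ : Fin n → ℕ) :
    coeE κ (c.sum fun ν a => a • E ν) = c κ := by
  rw [Finsupp.sum, map_sum, Finset.sum_eq_single κ]
  · rw [map_smul, coeE_E, if_pos rfl, smul_eq_mul, mul_one]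
  · intro ν _ hν
    rw [map_smul, coeE_E, if_neg hν, smul_zero]
  · intro h
    rw [Finsupp.notMem_support_iff.mp h, zero_smul, map_zero]

theorem T_P (lam : Fin m → ℕ) (γ : Fin k → ℕ) (i : Fin (m - 1)) :
    T (emb k i) (P lam γ) = t • P lam γ := by
  rw [P, map_smul, T_symmetrizer, smul_comm]

/-- The one-step recursion, from `s_i μ` to `μ` for `μ_i > μ_{i+1}`. -/
theorem coeE_P_simple (lam : Fin m → ℕ) (γ : Fin k → ℕ) {i : Fin (m - 1)} {μ : Fin m → ℕ}
    (h : μ (hi i) < μ (lo i)) :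
    coeE (split μ γ) (P lam γ) = coeE (split (act (simple i) μ) γ) (P lam γ) *
      ((t - boxWeight (split μ γ) ⟨Fin.castAdd k (lo i), μ (hi i) + 1⟩) /
        (1 - boxWeight (split μ γ) ⟨Fin.castAdd k (lo i), μ (hi i) + 1⟩)) := by
  have := coeE_of_T_eq (i := emb k i) (ν := split μ γ) (by rw [split_lo, split_hi]; exact h)
    (T_P lam γ i)
  rwa [act_simple_emb, split_hi, lo_emb] at this

/-- Exchanging `μ_i > μ_{i+1}` removes one decreasing pair, as is seen from the inversions of the
permutations that sort the two compositions. -/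
theorem coinv_simple {i : Fin (n - 1)} {μ : Fin n → ℕ} (h : μ (hi i) < μ (lo i)) :
    coinv μ = coinv (act (simple i) μ) + 1 := by
  set μ' := act (simple i) μ with hμ'
  set w := Tuple.sort μ'
  have hw : act w (increasing μ') = μ' := act_sort_increasing μ'
  have hlt : increasing μ' (w.symm (lo i)) < increasing μ' (w.symm (hi i)) := by
    change act w (increasing μ') (lo i) < act w (increasing μ') (hi i)
    rw [hw, hμ', act_simple_apply, act_simple_apply, simple_lo, simple_hi]
    exact h
  have hlt' := (increasing_monotone μ').reflect_lt hlt
  have h1 : inv (simple i * w) = coinv μ + blockInv (increasing μ') (simple i * w) :=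
    inv_eq_coinv_add (increasing_monotone μ') (by rw [act_mul, hw, hμ', act_simple_act_simple])
  rw [inv_simple_mul hlt', inv_sort, blockInv_simple_mul _ hlt', blockInv_sort,
    if_neg hlt.ne] at h1
  exact h1.symm

theorem exists_lt_of_not_monotone {μ : Fin n → ℕ} (h : ¬ Monotone μ) :
    ∃ i : Fin (n - 1), μ (hi i) < μ (lo i) := by
  by_contra! h'
  apply h
  cases n with
  | zero => exact fun a => a.elim0
  | succ n => exact Fin.monotone_iff_le_succ.mpr fun i => h' i

/-- The closed formula for the coefficients, with the denominator cleared. -/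
theorem coeE_P_mul_boxProd {lam : Fin m → ℕ} (hlam : Antitone lam) (γ : Fin k → ℕ)
    {μ : Fin m → ℕ} (hμ : μ ∈ orbit lam) :
    coeE (split μ γ) (P lam γ) * boxProd (split μ γ) =
      t ^ coinv μ * boxProd (split (increasing lam) γ) := by
  induction hN : coinv μ using Nat.strong_induction_on generalizing μ with
  | _ N ih =>
  by_cases hm : Monotone μ
  · have h0 : coinv μ = 0 := by
      rw [coinv, Finset.card_eq_zero, Finset.filter_eq_empty_iff]
      rintro p _ ⟨h1, h2⟩
      exact (hm h1.le).not_gt h2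
    rw [← hN, h0, eq_increasing hμ hm, coeE_P_increasing hlam, pow_zero]
  · obtain ⟨i, h⟩ := exists_lt_of_not_monotone hm
    have h1 := coinv_simple h
    have h2 := ih _ (by omega) (act_mem_orbit (simple i) hμ) rfl
    have h3 := boxProd_simple (i := emb k i) (ν := split μ γ)
      (by rw [split_lo, split_hi]; exact h)
    rw [act_simple_emb, split_hi, lo_emb] at h3
    have h4 := boxWeight_ne_one (split μ γ) ⟨Fin.castAdd k (lo i), μ (hi i) + 1⟩
    rw [coeE_P_simple lam γ h, mul_assoc, div_mul_eq_mul_div, mul_comm (t - _), h3,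
      mul_div_cancel_right₀ _ h4, ← hN, h1, pow_succ]
    linear_combination t * h2

end PSMac

end

theorem mainTheorem8 (m k : ℕ) (hn : 0 < m + k) (lam : Fin m → ℕ) (hlam : Antitone lam)
    (γ : Fin k → ℕ) :
    ∃ f : (Fin m → ℕ) → PSMac.K,
      -- the expansion of `P` in the nonsymmetric Macdonald polynomials
      PSMac.P lam γ = ∑ μ ∈ PSMac.orbit lam, f μ • PSMac.E (PSMac.split μ γ) ∧
      -- there is no other expansion, so that the `f μ` are the coefficients of `P`
      (∀ c : (Fin (m + k) → ℕ) →₀ PSMac.K,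
        PSMac.P lam γ = c.sum (fun ν a => a • PSMac.E ν) →
          (∀ μ ∈ PSMac.orbit lam, c (PSMac.split μ γ) = f μ) ∧
          ∀ ν, (∀ μ ∈ PSMac.orbit lam, ν ≠ PSMac.split μ γ) → c ν = 0) ∧
      -- initial value
      f (PSMac.increasing lam) = 1 ∧
      -- one-step recursion, with the box `u = (i, μ_i + 1)` of `(s_i μ | γ)`
      (∀ μ ∈ PSMac.orbit lam, ∀ i : Fin (m - 1),
        PSMac.BruhatLT (PSMac.act (PSMac.simple i) μ) μ →
          f (PSMac.act (PSMac.simple i) μ) = f μ *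
            ((PSMac.t - PSMac.boxWeight (PSMac.split (PSMac.act (PSMac.simple i) μ) γ)
                ⟨Fin.castAdd k (PSMac.lo i), μ (PSMac.lo i) + 1⟩) /
              (1 - PSMac.boxWeight (PSMac.split (PSMac.act (PSMac.simple i) μ) γ)
                ⟨Fin.castAdd k (PSMac.lo i), μ (PSMac.lo i) + 1⟩))) ∧
      -- closed formula, with the minimal length element sending the increasing rearrangement to `μ`
      (∀ μ ∈ PSMac.orbit lam,
        ∃! w : Equiv.Perm (Fin (m + k)),
          PSMac.IsMinimalTransport k (PSMac.increasing lam) μ w) ∧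
      ∀ μ ∈ PSMac.orbit lam, ∀ w : Equiv.Perm (Fin (m + k)),
        PSMac.IsMinimalTransport k (PSMac.increasing lam) μ w →
          f μ = PSMac.t ^ PSMac.length w *
            (PSMac.boxProd (PSMac.split (PSMac.increasing lam) γ) /
              PSMac.boxProd (PSMac.split μ γ)) := by
  refine ⟨fun μ => PSMac.coeE (PSMac.split μ γ) (PSMac.P lam γ), PSMac.P_eq_sum hlam γ, ?_,
    PSMac.coeE_P_increasing hlam γ, ?_, ?_, ?_⟩
  · intro c hc
    have h : ∀ ν, c ν = PSMac.coeE ν (PSMac.P lam γ) := fun ν => by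
      rw [hc, PSMac.coeE_sum]
    exact ⟨fun μ _ => h _, fun ν hν => by rw [h, PSMac.coeE_P_eq_zero hlam γ hν]⟩
  · intro μ _ i hi
    have h := PSMac.act_simple_lt_iff.mp hi
    have key := PSMac.coeE_P_simple lam γ (i := i) (μ := PSMac.act (PSMac.simple i) μ) (by
      simpa only [PSMac.act_simple_apply, PSMac.simple_lo, PSMac.simple_hi] using h)
    rwa [PSMac.act_simple_act_simple, PSMac.act_simple_apply, PSMac.simple_hi] at key
  · intro μ hμ
    exact ⟨PSMac.ext k (Tuple.sort μ), (PSMac.isMinimalTransport_iff hμ).mpr rfl,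
      fun w hw => (PSMac.isMinimalTransport_iff hμ).mp hw⟩
  · intro μ hμ w hw
    rw [(PSMac.isMinimalTransport_iff hμ).mp hw, PSMac.length_eq_inv, PSMac.inv_ext,
      PSMac.inv_sort, mul_div_assoc', eq_div_iff (PSMac.boxProd_ne_zero _)]
    exact PSMac.coeE_P_mul_boxProd hlam γ hμ
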